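/- Let $\gamma\ge 1$, $f(u)=f_\gamma(u)=u^\gamma/(2\gamma)$, and let $K(x)=\exp\big(d\,[c_{\gamma,d}-f(|x|^2/d)]\big)$ be the $\gamma$-kernel on $\mathbb{R}^d$, where $c_{\gamma,d}$ is the constant for which $\int K=1$. For each $d$ let $\rho=\rho_d$ be the centered Gaussian law on $\mathbb{R}^d$ with positive definite covariance matrix $C_d$, with $\mathrm{Tr}\,C_d=O(d)$. Assume that the empirical distributions of the eigenvalues of $C_d$ converge weakly, as $d\to\infty$, to a probability measure $\rho_C$ on $(0,\infty)$, that $\langle|\log\lambda|\rangle<\infty$ and that $\frac1d\mathrm{Tr}\log C_d\to\langle\log\lambda\rangle$, where $\langle\psi(\lambda)\rangle=\int\psi(\lambda)\,\rho_C(d\lambda)$. Let $\alpha>0$ and let $n=n_d$ be integers with $\frac1d\log n_d\to\alpha$. Let $\hat\rho_h(x)=\frac{1}{nh^d}\sum_{i=1}^nK\big(\frac{x-y_i}{h}\big)$, with $y_1,\dots,y_n$ drawn independently from $\rho_d$. Let $$\overline g(h^2,m)=\lim_{d\to\infty}\Big[\tfrac1d\,\mathbb{E}_x\log\mathbb{E}_y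 K^m\big(\tfrac{x-y}{h}\big)-m\log h\Big]\ \ (x,y\sim\rho_d),\qquad \phi_{\alpha,h}(m)=\tfrac{1-m}{m}\alpha+\tfrac1m\,\overline g(h^2,m),$$ and $D(\alpha,h)=\partial_m\phi_{\alpha,h}(1)$. These limits and derivatives exist for all $h,m>0$ (the derivative at $m=1$), and there is a unique $h_G(\alpha)>0$ with $D(\alpha,h_G(\alpha))=0$; one has $D(\alpha,h)>0$ for $0<h<h_G(\alpha)$ (the 1RSB phase) and $D(\alpha,h)<0$ for $h>h_G(\alpha)$ (the RS phase). The equation $$\alpha=\tfrac12\Big\langle\log(1+\lambda\hat l)-\frac{\lambda\hat l}{(1+\lambda\hat l)^2}\Big\rangle$$ has a unique solution $\hat l>0$; let $$l=\Big\langle\frac{\lambda}{1+\hat l\lambda}+\frac{\lambda}{(1+\hat l\lambda)^2}\Big\rangle>0 .$$ Then for every $h>0$ the random variable $\frac1d D_{KL}(\rho\|\hat\rho_h)$ concentrates, as $d\to\infty$, around a deterministic limit $\mathcal D(h)$ (its mean over the database converges to $\mathcal D(h)$, and it converges to $\mathcal D(h)$ in probability). The equation $$\frac{l}{h^2}\,f'\!\Big(\frac{l}{h^2}\Big)=\frac12$$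 has a unique solution $h=h^*(\alpha)>0$, and $h^*(\alpha)$ is the unique minimizer of $\mathcal D$ on $(0,\infty)$. Moreover $h^*(\alpha)<h_G(\alpha)$, so the optimal bandwidth lies in the 1RSB phase, and the minimal value is $$\mathcal D(h^*(\alpha))=\alpha-\tfrac12\langle\log\lambda\rangle+\tfrac12\log l ,$$ which does not depend on $\gamma$, that is, on the kernel. -/

import Mathlib

open MeasureTheory ProbabilityTheory Filter Topology InformationTheory
open scoped ENNReal BoundedContinuousFunction

noncomputable section

namespace HighDimKDE

/-! ### Kernels and the kernel density estimator -/

/-- The rate function `f_γ(u) = u ^ γ / (2 γ)` of the `γ`-kernel. -/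
def kernelRate (γ u : ℝ) : ℝ := u ^ γ / (2 * γ)

/-- The normalization constant `c` of the `γ`-kernel in dimension `d`, i.e. (for `d ≥ 1`) the
number for which `∫ exp (d (c - f_γ(|x|² / d))) dx = 1`. -/
def kernelConst (γ : ℝ) (d : ℕ) : ℝ :=
  -(1 / (d : ℝ)) * Real.log (∫ x : EuclideanSpace ℝ (Fin d),
    Real.exp (-((d : ℝ) * kernelRate γ (‖x‖ ^ 2 / d))))

/-- The `γ`-kernel `K_γ(x) = exp (d [c - (1 / 2γ) (|x|² / d) ^ γ])` on `ℝ ^ d`. -/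
def kernel (γ : ℝ) (d : ℕ) (x : EuclideanSpace ℝ (Fin d)) : ℝ :=
  Real.exp ((d : ℝ) * (kernelConst γ d - kernelRate γ (‖x‖ ^ 2 / d)))

/-- The kernel density estimator `(1 / (n h ^ d)) ∑ i, K ((x - y i) / h)` at the point `x`. -/
def kde (γ h : ℝ) {d n : ℕ} (y : Fin n → EuclideanSpace ℝ (Fin d))
    (x : EuclideanSpace ℝ (Fin d)) : ℝ :=
  1 / ((n : ℝ) * h ^ d) * ∑ i, kernel γ d (h⁻¹ • (x - y i))

/-- The measure on `ℝ ^ d` whose density is the kernel density estimator. -/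
def kdeMeasure (γ h : ℝ) {d n : ℕ} (y : Fin n → EuclideanSpace ℝ (Fin d)) :
    Measure (EuclideanSpace ℝ (Fin d)) :=
  volume.withDensity fun x => ENNReal.ofReal (kde γ h y x)

/-! ### Gaussian data -/

/-- The centered Gaussian law on `ℝ ^ d` with covariance matrix `C`. -/
def gaussianLaw {d : ℕ} (C : Matrix (Fin d) (Fin d) ℝ) : Measure (EuclideanSpace ℝ (Fin d)) :=
  multivariateGaussian 0 C

/-- The law of a database of `n` independent points of law `gaussianLaw C`. -/
def databaseLaw {d : ℕ} (C : Matrix (Fin d) (Fin d) ℝ) (n : ℕ) :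
    Measure (Fin n → EuclideanSpace ℝ (Fin d)) :=
  Measure.pi fun _ => gaussianLaw C

/-- The random variable `(1 / d) D_KL(ρ ‖ ρ̂_h)`, a function of the database `y`. -/
def normalizedKL (γ h : ℝ) {d n : ℕ} (C : Matrix (Fin d) (Fin d) ℝ)
    (y : Fin n → EuclideanSpace ℝ (Fin d)) : ℝ≥0∞ :=
  klDiv (gaussianLaw C) (kdeMeasure γ h y) / d

/-- The `[0, ∞]`-valued random variables `X d` concentrate around the real number `a` as
`d → ∞`: their means converge to `a`, and they converge to `a` in probability. -/
def ConcentratesAt {Ω : ℕ → Type} [∀ d, MeasurableSpace (Ω d)] (P : ∀ d, Measure (Ω d))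
    (X : ∀ d, Ω d → ℝ≥0∞) (a : ℝ) : Prop :=
  Tendsto (fun d => ∫⁻ ω, X d ω ∂(P d)) atTop (𝓝 (ENNReal.ofReal a)) ∧
  ∀ ε : ℝ, 0 < ε →
    Tendsto (fun d => P d {ω | X d ω = ∞ ∨ ε ≤ |(X d ω).toReal - a|}) atTop (𝓝 0)

/-- The empirical spectral distributions `(1 / d) ∑ r, δ_{c_r}` of the covariance matrices
converge weakly to `ρC`. -/
def SpectralLimit (C : ∀ d : ℕ, Matrix (Fin d) (Fin d) ℝ) (hC : ∀ d, (C d).PosDef)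
    (ρC : Measure ℝ) : Prop :=
  ∀ φ : ℝ →ᵇ ℝ, Tendsto (fun d : ℕ => (1 / (d : ℝ)) * ∑ r, φ ((hC d).isHermitian.eigenvalues r))
    atTop (𝓝 (∫ c, φ c ∂ρC))

/-! ### Replica free entropy and the glass transition -/

/-- `(1 / d) E_x log E_y K ^ m ((x - y) / h) - m log h` in dimension `d`, where `x` and `y` have
law `gaussianLaw C`. -/
def gMean (γ : ℝ) {d : ℕ} (C : Matrix (Fin d) (Fin d) ℝ) (h m : ℝ) : ℝ :=
  (1 / (d : ℝ)) * (∫ x, Real.log (∫ y, kernel γ d (h⁻¹ • (x - y)) ^ m ∂(gaussianLaw C))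
    ∂(gaussianLaw C)) - m * Real.log h

/-- `gbar h m` is the limit of `gMean γ (C d) h m` as `d → ∞`, for all `h, m > 0`. -/
def IsLimitG (γ : ℝ) (C : ∀ d : ℕ, Matrix (Fin d) (Fin d) ℝ) (gbar : ℝ → ℝ → ℝ) : Prop :=
  ∀ h m : ℝ, 0 < h → 0 < m → Tendsto (fun d : ℕ => gMean γ (C d) h m) atTop (𝓝 (gbar h m))

/-- The replica free entropy `φ_{α,h}(m) = ((1 - m) / m) α + (1 / m) gbar h m`. -/
def replicaFreeEntropy (gbar : ℝ → ℝ → ℝ) (α h m : ℝ) : ℝ :=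
  (1 - m) / m * α + 1 / m * gbar h m

/-- `D(α, h)`, the derivative of the replica free entropy at `m = 1`. -/
def glassD (gbar : ℝ → ℝ → ℝ) (α h : ℝ) : ℝ :=
  deriv (replicaFreeEntropy gbar α h) 1

/-- `hG` is the bandwidth of the glass transition: `D(α, h)` is well defined for all `h > 0`, it
is positive for `h < hG` (the 1RSB phase), zero at `hG`, and negative for `h > hG` (the RS
phase). -/
def IsGlassBandwidth (gbar : ℝ → ℝ → ℝ) (α hG : ℝ) : Prop :=
  0 < hG ∧ ∀ h : ℝ, 0 < h →
    DifferentiableAt ℝ (replicaFreeEntropy gbar α h) 1 ∧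
    (h < hG → 0 < glassD gbar α h) ∧
    (h = hG → glassD gbar α h = 0) ∧
    (hG < h → glassD gbar α h < 0)

/-! ### The parameters `l̂` and `l` -/

/-- `(1 / 2) ∫ (log (1 + λ l̂) - λ l̂ / (1 + λ l̂)²) ρC(dλ)`. -/
def spectralEntropy (ρC : Measure ℝ) (lhat : ℝ) : ℝ :=
  (1 / 2) * ∫ c, (Real.log (1 + c * lhat) - c * lhat / (1 + c * lhat) ^ 2) ∂ρC

/-- `l = ∫ (λ / (1 + l̂ λ) + λ / (1 + l̂ λ)²) ρC(dλ)` as a function of `l̂`. -/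
def spectralL (ρC : Measure ℝ) (lhat : ℝ) : ℝ :=
  ∫ c, (c / (1 + lhat * c) + c / (1 + lhat * c) ^ 2) ∂ρC

end HighDimKDE

end

/-! Up to explicit constants, the divergence per dimension is minus the mean over `x` of `(1/d) log
((1/n) ∑ᵢ exp(-d f(|x - yᵢ|²/(d h²))))`, the free energy of a random energy model with about
`e^{αd}` levels. Everything is parametrized by a Gaussian tilt `t`. Write `L = spectralL` and `S =
spectralEntropy`. Under the weight `exp(-t|x - y|²/2)` the point `y` sits at squared distance about
`d L(t)` from a typical `x`, and the ball of that squared radius has mass about `exp(-d S(t))`. The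
two functions satisfy `dS = -(t/2) dL`.

The scale `t` therefore contributes `exp(-d [S(t) + f(L(t)/h²)])`, and it contains data points only
if `S(t) < α = S(lhat)`, that is `t < lhat`. The best admissible tilt is `τ = min(T(h^{-2γ}),
lhat)`, where `T(h^{-2γ})` is the unconstrained optimum; freezing at `lhat` is the 1RSB phase. The
lower bound on the free energy counts sample points in balls by Chebyshev
(`tendsto_measureReal_quenched_lt`). The upper bound is the replica bound with an exponent `m ≤ 1`
(`integral_quenched_le`), with `m` tuned in the frozen phase so that the stationary tilt is `lhat`.
The annealed free energy for general `γ` reduces to the exactly solvable case `γ = 1`: convexity of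
`f` gives one side (`kernelRate_tangent`), ball masses (`diagGaussian_ball_bad_le`) give the other,
and `tendsto_integral_abs_sub` joins such bounds into convergence in mean.

For the minimization put `w = (L(τ)/h²)^γ`. Then `limitKL_eq` reads `D(h) = -½⟨log λ⟩ + [S(τ) + ½
log L(τ)] + (w - 1 - log w)/(2γ)`. Since `t L(t) < 1` (`mul_spectralL_lt_one`), the bracket is
nonincreasing in `τ ≤ lhat`, hence at least `α + ½ log l`. The last term is nonnegative and vanishes
only at `w = 1`; in the unfrozen phase `w = τ L(τ) < 1`, so equality forces `τ = lhat` and `h² = l`.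
The bandwidth `√l` is indeed frozen because `lhat · l < 1`, and `γ` has dropped out of the value. -/

noncomputable section

namespace HighDimKDE

/-! ### The spectral functionals -/

/-- `∫ λ² (3 + λ t) / (1 + λ t)³ ρC(dλ)`, which is minus the derivative of `spectralL`. -/
def spectralQ (ρC : Measure ℝ) (t : ℝ) : ℝ := ∫ c, c ^ 2 * (3 + c * t) / (1 + c * t) ^ 3 ∂ρC

section Spectral

variable {ρC : Measure ℝ} [IsProbabilityMeasure ρC]

lemma spectralQ_integrand_bounds {c t : ℝ} (hc : 0 < c) (ht : 0 < t) :
    0 < c ^ 2 * (3 + c * t) / (1 + c * t) ^ 3 ∧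
      c ^ 2 * (3 + c * t) / (1 + c * t) ^ 3 ≤ 3 / t ^ 2 := by
  have h : 0 < c * t := by positivity
  refine ⟨by positivity, ?_⟩
  rw [div_le_div_iff₀ (by positivity) (by positivity)]
  have : c ^ 2 * (3 + c * t) * t ^ 2 = (c * t) ^ 2 * (3 + c * t) := by ring
  rw [this]
  nlinarith [pow_pos h 2, pow_pos h 3]

lemma spectralL_integrand_bounds {c t : ℝ} (hc : 0 < c) (ht : 0 < t) :
    0 < c / (1 + t * c) + c / (1 + t * c) ^ 2 ∧
      c / (1 + t * c) + c / (1 + t * c) ^ 2 < 1 / t := by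
  have h : 0 < t * c := by positivity
  refine ⟨by positivity, ?_⟩
  have h1 : c / (1 + t * c) + c / (1 + t * c) ^ 2 = c * (2 + t * c) / (1 + t * c) ^ 2 := by
    field_simp; ring
  rw [h1, div_lt_div_iff₀ (by positivity) (by positivity)]
  nlinarith

lemma spectralEntropy_integrand_bound {c t : ℝ} (hc : 0 < c) (ht : 0 < t) :
    |Real.log (1 + c * t)| ≤ Real.log 2 + |Real.log c| + |Real.log t| := by
  have h : 0 < c * t := by positivity
  rw [abs_of_nonneg (Real.log_nonneg (by linarith))]
  rcases le_total (c * t) 1 with h1 | h1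
  · have := Real.log_le_log (by linarith) (show 1 + c * t ≤ 2 by linarith)
    linarith [abs_nonneg (Real.log c), abs_nonneg (Real.log t)]
  · have := Real.log_le_log (by linarith) (show 1 + c * t ≤ 2 * (c * t) by linarith)
    rw [Real.log_mul (by norm_num) (by positivity), Real.log_mul hc.ne' ht.ne'] at this
    linarith [le_abs_self (Real.log c), le_abs_self (Real.log t)]

lemma div_one_add_sq_bounds {x : ℝ} (hx : 0 < x) : 0 ≤ x / (1 + x) ^ 2 ∧ x / (1 + x) ^ 2 ≤ 1 / 4 := by
  refine ⟨by positivity, ?_⟩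
  rw [div_le_div_iff₀ (by positivity) (by positivity)]
  nlinarith [sq_nonneg (x - 1)]

lemma integrable_log_one_add (hpos : ∀ᵐ c ∂ρC, 0 < c) (hlog : Integrable Real.log ρC) {t : ℝ}
    (ht : 0 < t) : Integrable (fun c => Real.log (1 + c * t)) ρC := by
  have : Integrable (fun c => Real.log 2 + |Real.log c| + |Real.log t|) ρC :=
    ((integrable_const _).add hlog.abs).add (integrable_const _)
  refine this.mono' (Measurable.aestronglyMeasurable (by fun_prop)) ?_
  filter_upwards [hpos] with c hc
  exact spectralEntropy_integrand_bound hc ht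

lemma integrable_div_one_add_sq (hpos : ∀ᵐ c ∂ρC, 0 < c) {t : ℝ} (ht : 0 < t) :
    Integrable (fun c => c * t / (1 + c * t) ^ 2) ρC := by
  refine (integrable_const (1 / 4 : ℝ)).mono' (Measurable.aestronglyMeasurable (by fun_prop)) ?_
  filter_upwards [hpos] with c hc
  have := div_one_add_sq_bounds (mul_pos hc ht)
  rw [Real.norm_of_nonneg this.1]
  exact this.2

lemma integrable_spectralEntropy (hpos : ∀ᵐ c ∂ρC, 0 < c) (hlog : Integrable Real.log ρC) {t : ℝ}
    (ht : 0 < t) : Integrable (fun c => Real.log (1 + c * t) - c * t / (1 + c * t) ^ 2) ρC :=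
  (integrable_log_one_add hpos hlog ht).sub (integrable_div_one_add_sq hpos ht)

lemma integrable_spectralL (hpos : ∀ᵐ c ∂ρC, 0 < c) {t : ℝ} (ht : 0 < t) :
    Integrable (fun c => c / (1 + t * c) + c / (1 + t * c) ^ 2) ρC := by
  refine (integrable_const (1 / t)).mono' (Measurable.aestronglyMeasurable (by fun_prop)) ?_
  filter_upwards [hpos] with c hc
  have := spectralL_integrand_bounds hc ht
  rw [Real.norm_of_nonneg this.1.le]
  exact this.2.le

lemma integral_pos_of_ae_pos {g : ℝ → ℝ} (hg : Integrable g ρC) (h : ∀ᵐ c ∂ρC, 0 < g c) :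
    0 < ∫ c, g c ∂ρC := by
  rw [integral_pos_iff_support_of_nonneg_ae (h.mono fun _ h => h.le) hg]
  have : Function.support g =ᵐ[ρC] Set.univ := by
    filter_upwards [h] with c hc
    exact propext (iff_of_true hc.ne' trivial)
  rw [measure_congr this]
  simp

lemma spectralL_pos (hpos : ∀ᵐ c ∂ρC, 0 < c) {t : ℝ} (ht : 0 < t) : 0 < spectralL ρC t :=
  integral_pos_of_ae_pos (integrable_spectralL hpos ht)
    (hpos.mono fun _ hc => (spectralL_integrand_bounds hc ht).1)

/-- Integrated form of `x (2 + x) < (1 + x)²` with `x = λt`. This strict inequality drives the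
conclusion: it makes `S + ½ log L` monotone, keeps `h² = l` inside the frozen phase, and rules out a
minimizer in the unfrozen one. -/
lemma mul_spectralL_lt_one (hpos : ∀ᵐ c ∂ρC, 0 < c) {t : ℝ} (ht : 0 < t) :
    t * spectralL ρC t < 1 := by
  have hi := integrable_spectralL hpos ht
  have := integral_pos_of_ae_pos ((integrable_const (1 / t)).sub hi)
    (hpos.mono fun c hc => sub_pos.2 (spectralL_integrand_bounds hc ht).2)
  simp only [Pi.sub_apply] at this
  rw [integral_sub (integrable_const _) hi] at this
  simp only [integral_const, probReal_univ, smul_eq_mul, one_mul] at this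
  change 0 < 1 / t - spectralL ρC t at this
  rw [sub_pos, lt_div_iff₀ ht] at this
  linarith

lemma integrable_spectralQ (hpos : ∀ᵐ c ∂ρC, 0 < c) {t : ℝ} (ht : 0 < t) :
    Integrable (fun c => c ^ 2 * (3 + c * t) / (1 + c * t) ^ 3) ρC := by
  refine (integrable_const (3 / t ^ 2)).mono' (Measurable.aestronglyMeasurable (by fun_prop)) ?_
  filter_upwards [hpos] with c hc
  have := spectralQ_integrand_bounds hc ht
  rw [Real.norm_of_nonneg this.1.le]
  exact this.2

lemma spectralQ_pos (hpos : ∀ᵐ c ∂ρC, 0 < c) {t : ℝ} (ht : 0 < t) : 0 < spectralQ ρC t :=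
  integral_pos_of_ae_pos (integrable_spectralQ hpos ht)
    (hpos.mono fun _ hc => (spectralQ_integrand_bounds hc ht).1)

/-- Differentiation under the integral: on `(t/2, ∞)` the derivative is bounded by `3/(t/2)²`
uniformly in `λ`, so no moment of `ρC` is needed. -/
lemma hasDerivAt_spectralL (hpos : ∀ᵐ c ∂ρC, 0 < c) {t : ℝ} (ht : 0 < t) :
    HasDerivAt (spectralL ρC) (-spectralQ ρC t) t := by
  have hs : Set.Ioi (t / 2) ∈ 𝓝 t := Ioi_mem_nhds (by linarith)
  have := (hasDerivAt_integral_of_dominated_loc_of_deriv_le (μ := ρC)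
    (F := fun t c => c / (1 + t * c) + c / (1 + t * c) ^ 2)
    (F' := fun t c => -(c ^ 2 * (3 + c * t) / (1 + c * t) ^ 3))
    (bound := fun _ => 3 / (t / 2) ^ 2) hs
    (by filter_upwards with x; exact Measurable.aestronglyMeasurable (by fun_prop))
    (integrable_spectralL hpos ht)
    (Measurable.aestronglyMeasurable (by fun_prop)) ?_ (integrable_const _) ?_).2
  · rwa [integral_neg] at this
  · filter_upwards [hpos] with c hc x hx
    have hx' : t / 2 < x := hx
    have hx0 : 0 < x := by linarith
    have := spectralQ_integrand_bounds hc hx0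
    rw [norm_neg, Real.norm_of_nonneg this.1.le]
    refine this.2.trans ?_
    gcongr
  · filter_upwards [hpos] with c hc x hx
    have hx' : t / 2 < x := hx
    have hx0 : 0 < x := by linarith
    have h0 : 1 + x * c ≠ 0 := by positivity
    have h1 : HasDerivAt (fun x => 1 + x * c) c x := by
      simpa using ((hasDerivAt_id x).mul_const c).const_add 1
    have h2 := ((hasDerivAt_const x c).div h1 h0).add
      ((hasDerivAt_const x c).div (h1.pow 2) (pow_ne_zero 2 h0))
    refine h2.congr_deriv ?_
    have h3 : 1 + c * x ≠ 0 := by rwa [mul_comm]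
    simp only [mul_comm x c, Pi.pow_apply] at *
    field_simp
    ring

/-- Together with `L' = -Q` this is the duality `dS = -(t/2) dL` between the log-mass of a ball and
its squared radius. -/
lemma hasDerivAt_spectralEntropy (hpos : ∀ᵐ c ∂ρC, 0 < c) (hlog : Integrable Real.log ρC) {t : ℝ}
    (ht : 0 < t) : HasDerivAt (spectralEntropy ρC) (t * spectralQ ρC t / 2) t := by
  have hs : Set.Ioo (t / 2) (2 * t) ∈ 𝓝 t := Ioo_mem_nhds (by linarith) (by linarith)
  have := (hasDerivAt_integral_of_dominated_loc_of_deriv_le (μ := ρC)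
    (F := fun t c => Real.log (1 + c * t) - c * t / (1 + c * t) ^ 2)
    (F' := fun t c => t * (c ^ 2 * (3 + c * t) / (1 + c * t) ^ 3))
    (bound := fun _ => 2 * t * (3 / (t / 2) ^ 2)) hs
    (by filter_upwards with x; exact Measurable.aestronglyMeasurable (by fun_prop))
    (integrable_spectralEntropy hpos hlog ht)
    (Measurable.aestronglyMeasurable (by fun_prop)) ?_ (integrable_const _) ?_).2
  · rw [integral_const_mul] at this
    refine (this.const_mul (1 / 2 : ℝ)).congr_deriv ?_
    rw [spectralQ]; ring
  · filter_upwards [hpos] with c hc x hx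
    have hx' : t / 2 < x := hx.1
    have hx2 : x < 2 * t := hx.2
    have hx0 : 0 < x := by linarith
    have := spectralQ_integrand_bounds hc hx0
    rw [norm_mul, Real.norm_of_nonneg this.1.le, Real.norm_of_nonneg hx0.le]
    refine mul_le_mul hx2.le (this.2.trans ?_) this.1.le (by linarith)
    gcongr
  · filter_upwards [hpos] with c hc x hx
    have hx' : t / 2 < x := hx.1
    have hx0 : 0 < x := by linarith
    have h0 : 1 + c * x ≠ 0 := by positivity
    have h3 : HasDerivAt (fun x => c * x) c x := by
      simpa using (hasDerivAt_id x).const_mul c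
    have h1 : HasDerivAt (fun x => 1 + c * x) c x := h3.const_add 1
    have h2 := (h1.log h0).sub (h3.div (h1.pow 2) (pow_ne_zero 2 h0))
    refine h2.congr_deriv ?_
    simp only [Pi.pow_apply] at *
    field_simp
    ring

lemma strictAntiOn_spectralL (hpos : ∀ᵐ c ∂ρC, 0 < c) :
    StrictAntiOn (spectralL ρC) (Set.Ioi 0) := by
  refine strictAntiOn_of_deriv_neg (convex_Ioi 0)
    (fun t ht => (hasDerivAt_spectralL hpos ht).continuousAt.continuousWithinAt) fun t ht => ?_
  rw [interior_Ioi] at ht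
  rw [(hasDerivAt_spectralL hpos ht).deriv]
  linarith [spectralQ_pos hpos ht]

lemma strictMonoOn_spectralEntropy (hpos : ∀ᵐ c ∂ρC, 0 < c) (hlog : Integrable Real.log ρC) :
    StrictMonoOn (spectralEntropy ρC) (Set.Ioi 0) := by
  refine strictMonoOn_of_deriv_pos (convex_Ioi 0)
    (fun t ht => (hasDerivAt_spectralEntropy hpos hlog ht).continuousAt.continuousWithinAt)
    fun t ht => ?_
  rw [interior_Ioi] at ht
  rw [(hasDerivAt_spectralEntropy hpos hlog ht).deriv]
  have := mul_pos ht (spectralQ_pos hpos ht)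
  linarith

/-- The derivative is `Q (tL - 1)/(2L)`, negative because `tL < 1`. -/
lemma antitoneOn_spectralEntropy_add_log (hpos : ∀ᵐ c ∂ρC, 0 < c) (hlog : Integrable Real.log ρC) :
    AntitoneOn (fun t => spectralEntropy ρC t + 1 / 2 * Real.log (spectralL ρC t)) (Set.Ioi 0) := by
  have hd : ∀ t ∈ Set.Ioi (0 : ℝ), HasDerivAt
      (fun t => spectralEntropy ρC t + 1 / 2 * Real.log (spectralL ρC t))
      (t * spectralQ ρC t / 2 + 1 / 2 * (-spectralQ ρC t / spectralL ρC t)) t := fun t ht =>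
    (hasDerivAt_spectralEntropy hpos hlog ht).add
      (((hasDerivAt_spectralL hpos ht).log (spectralL_pos hpos ht).ne').const_mul _)
  refine antitoneOn_of_deriv_nonpos (convex_Ioi 0)
    (fun t ht => (hd t ht).continuousAt.continuousWithinAt)
    (fun t ht => (hd t (interior_subset ht)).differentiableAt.differentiableWithinAt)
    fun t ht => ?_
  rw [interior_Ioi] at ht
  rw [(hd t ht).deriv]
  have hL := spectralL_pos hpos ht
  have hQ := spectralQ_pos hpos ht
  have h1 := mul_spectralL_lt_one hpos ht
  have : t * spectralQ ρC t / 2 + 1 / 2 * (-spectralQ ρC t / spectralL ρC t) =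
      spectralQ ρC t * (t * spectralL ρC t - 1) / (2 * spectralL ρC t) := by
    field_simp
    ring
  rw [this]
  apply div_nonpos_of_nonpos_of_nonneg _ (by positivity)
  nlinarith

lemma tendsto_spectralEntropy_zero (hpos : ∀ᵐ c ∂ρC, 0 < c) (hlog : Integrable Real.log ρC) :
    Tendsto (spectralEntropy ρC) (𝓝[>] 0) (𝓝 0) := by
  have hb : Integrable (fun c => Real.log (1 + c * 1) + 1) ρC :=
    (integrable_log_one_add hpos hlog one_pos).add (integrable_const _)
  have hmem : Set.Ioo (0 : ℝ) 1 ∈ 𝓝[>] (0 : ℝ) := Ioo_mem_nhdsGT one_pos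
  have h := tendsto_integral_filter_of_dominated_convergence (μ := ρC) (l := 𝓝[>] (0 : ℝ))
    (F := fun t c => Real.log (1 + c * t) - c * t / (1 + c * t) ^ 2) (f := fun _ => (0 : ℝ))
    _ (by filter_upwards with x; exact Measurable.aestronglyMeasurable (by fun_prop)) ?_ hb ?_
  · have := h.const_mul (1 / 2 : ℝ)
    simp only [integral_zero, mul_zero] at this
    exact this
  · filter_upwards [hmem] with t ht
    filter_upwards [hpos] with c hc
    have h1 := div_one_add_sq_bounds (mul_pos hc ht.1)
    have h2 := mul_pos hc ht.1
    have h3 := Real.log_nonneg (show 1 ≤ 1 + c * t by linarith)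
    have h4 := Real.log_le_log (show 0 < 1 + c * t by linarith)
      (show 1 + c * t ≤ 1 + c * 1 by nlinarith [ht.2])
    rw [Real.norm_eq_abs, abs_le]
    constructor <;> linarith
  · filter_upwards [hpos] with c hc
    have : ContinuousAt (fun t => Real.log (1 + c * t) - c * t / (1 + c * t) ^ 2) 0 := by
      refine ContinuousAt.sub (ContinuousAt.log (by fun_prop) (by simp))
        (ContinuousAt.div₀ (by fun_prop) (by fun_prop) (by simp))
    have := this.tendsto
    simp only [mul_zero, add_zero, Real.log_one, zero_div, sub_zero] at this
    exact this.mono_left nhdsWithin_le_nhds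

lemma le_spectralEntropy (hpos : ∀ᵐ c ∂ρC, 0 < c) (hlog : Integrable Real.log ρC) {t : ℝ}
    (ht : 0 < t) :
    1 / 2 * (Real.log t + ∫ c, Real.log c ∂ρC - 1 / 4) ≤ spectralEntropy ρC t := by
  rw [spectralEntropy]
  gcongr
  have : Real.log t + ∫ c, Real.log c ∂ρC - 1 / 4 = ∫ c, (Real.log t + Real.log c - 1 / 4) ∂ρC := by
    have h1 : Integrable (fun c => Real.log t + Real.log c) ρC := (integrable_const _).add hlog
    rw [integral_sub h1 (integrable_const _), integral_add (integrable_const _) hlog]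
    simp
  rw [this]
  refine integral_mono_ae (((integrable_const _).add hlog).sub (integrable_const _))
    (integrable_spectralEntropy hpos hlog ht) ?_
  filter_upwards [hpos] with c hc
  have h1 := div_one_add_sq_bounds (mul_pos hc ht)
  have h2 := Real.log_le_log (mul_pos hc ht) (show c * t ≤ 1 + c * t by linarith)
  rw [Real.log_mul hc.ne' ht.ne'] at h2
  linarith

/-- The equation `spectralEntropy = α` has a positive solution. -/
lemma exists_spectralEntropy_eq (hpos : ∀ᵐ c ∂ρC, 0 < c) (hlog : Integrable Real.log ρC) {α : ℝ}
    (hα : 0 < α) : ∃ t, 0 < t ∧ spectralEntropy ρC t = α := by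
  have h0 : ∀ᶠ t in 𝓝[>] (0 : ℝ), spectralEntropy ρC t < α :=
    (tendsto_spectralEntropy_zero hpos hlog).eventually (gt_mem_nhds hα)
  obtain ⟨a, ha, ha0⟩ := (h0.and self_mem_nhdsWithin).exists
  have ha0 : 0 < a := ha0
  -- `b` makes the lower bound of `le_spectralEntropy` equal to `α`.
  set b := Real.exp (2 * α - ∫ c, Real.log c ∂ρC + 1 / 4) with hb
  have hb0 : 0 < b := Real.exp_pos _
  have hbα : α ≤ spectralEntropy ρC b := by
    refine le_trans ?_ (le_spectralEntropy hpos hlog hb0)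
    rw [hb, Real.log_exp]
    linarith
  have hab : a ≤ b := by
    by_contra! h
    have := (strictMonoOn_spectralEntropy hpos hlog) hb0 ha0 h
    linarith
  obtain ⟨t, ht, hte⟩ := intermediate_value_Icc hab
    (fun t ht => (hasDerivAt_spectralEntropy hpos hlog
      (ha0.trans_le ht.1)).continuousAt.continuousWithinAt) ⟨ha.le, hbα⟩
  exact ⟨t, ha0.trans_le ht.1, hte⟩

/-- For `γ ≥ 1` the map `t ↦ t / L(t) ^ (γ - 1)` is a strictly increasing bijection of the
positive half-line. -/
lemma strictMonoOn_div_spectralL_rpow (hpos : ∀ᵐ c ∂ρC, 0 < c) {γ : ℝ} (hγ : 1 ≤ γ) :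
    StrictMonoOn (fun t => t / spectralL ρC t ^ (γ - 1)) (Set.Ioi 0) := by
  intro s hs t ht hst
  have hLs := spectralL_pos hpos hs
  have hLt := spectralL_pos hpos ht
  have h1 := (strictAntiOn_spectralL hpos hs ht hst).le
  have h2 := Real.rpow_le_rpow hLt.le h1 (sub_nonneg.2 hγ)
  have h3 := Real.rpow_pos_of_pos hLt (γ - 1)
  have h4 : 0 < s := hs
  calc s / spectralL ρC s ^ (γ - 1) ≤ s / spectralL ρC t ^ (γ - 1) := by gcongr
    _ < t / spectralL ρC t ^ (γ - 1) := by gcongr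

lemma exists_div_spectralL_rpow_eq (hpos : ∀ᵐ c ∂ρC, 0 < c) {γ : ℝ} (hγ : 1 ≤ γ) {v : ℝ}
    (hv : 0 < v) : ∃ t, 0 < t ∧ t / spectralL ρC t ^ (γ - 1) = v := by
  have hL1 := spectralL_pos hpos one_pos
  have hA : 0 < spectralL ρC 1 ^ (γ - 1) := Real.rpow_pos_of_pos hL1 _
  -- Comparing `L(a)` and `L(b)` with `L(1)` makes the endpoints bracket `v`: as `L` decreases,
  -- `L(b) ≤ L(1) ≤ L(a)`.
  set a := min 1 (v * spectralL ρC 1 ^ (γ - 1)) with ha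
  set b := max 1 (v * spectralL ρC 1 ^ (γ - 1)) with hb
  have ha0 : 0 < a := lt_min one_pos (by positivity)
  have hb0 : 0 < b := one_pos.trans_le (le_max_left _ _)
  have hanti := (strictAntiOn_spectralL hpos).antitoneOn
  have h1 : a / spectralL ρC a ^ (γ - 1) ≤ v := by
    rw [div_le_iff₀ (Real.rpow_pos_of_pos (spectralL_pos hpos ha0) _)]
    refine (min_le_right _ _).trans ?_
    refine mul_le_mul_of_nonneg_left ?_ hv.le
    exact Real.rpow_le_rpow hL1.le (hanti ha0 (Set.mem_Ioi.2 one_pos) (min_le_left _ _))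
      (sub_nonneg.2 hγ)
  have h2 : v ≤ b / spectralL ρC b ^ (γ - 1) := by
    rw [le_div_iff₀ (Real.rpow_pos_of_pos (spectralL_pos hpos hb0) _)]
    refine le_trans ?_ (le_max_right _ _)
    refine mul_le_mul_of_nonneg_left ?_ hv.le
    exact Real.rpow_le_rpow (spectralL_pos hpos hb0).le
      (hanti (Set.mem_Ioi.2 one_pos) hb0 (le_max_left _ _)) (sub_nonneg.2 hγ)
  obtain ⟨t, ht, hte⟩ := intermediate_value_Icc
    (f := fun t => t / spectralL ρC t ^ (γ - 1)) ((min_le_left _ _).trans (le_max_left _ _) : a ≤ b)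
    (fun t ht => by
      have ht0 := ha0.trans_le ht.1
      have hL := spectralL_pos hpos ht0
      exact (continuousAt_id.div ((hasDerivAt_spectralL hpos ht0).continuousAt.rpow_const
        (Or.inl hL.ne')) (Real.rpow_pos_of_pos hL _).ne').continuousWithinAt) ⟨h1, h2⟩
  exact ⟨t, ha0.trans_le ht.1, hte⟩

end Spectral

/-! ### The rate function -/

lemma kernelRate_nonneg {γ u : ℝ} (hγ : 1 ≤ γ) (hu : 0 ≤ u) : 0 ≤ kernelRate γ u := by
  have := Real.rpow_nonneg hu γ
  rw [kernelRate]
  positivity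

lemma kernelRate_mono {γ u v : ℝ} (hγ : 1 ≤ γ) (hu : 0 ≤ u) (huv : u ≤ v) :
    kernelRate γ u ≤ kernelRate γ v := by
  have := Real.rpow_le_rpow hu huv (by linarith : 0 ≤ γ)
  rw [kernelRate, kernelRate]
  gcongr

lemma continuous_kernelRate {γ : ℝ} (hγ : 1 ≤ γ) : Continuous (kernelRate γ) := by
  have h : Continuous fun u : ℝ => u ^ γ :=
    continuous_id.rpow_const fun _ => Or.inr (by linarith)
  exact h.div_const _

/-- The tangent line inequality for the convex function `kernelRate γ`. -/
lemma kernelRate_tangent {γ u v : ℝ} (hγ : 1 ≤ γ) (hu : 0 ≤ u) (hv : 0 < v) :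
    kernelRate γ v + v ^ (γ - 1) / 2 * (u - v) ≤ kernelRate γ u := by
  -- Bernoulli's inequality for `u/v = 1 + (u/v - 1)`, then multiplied by `v^γ/(2γ)`.
  have h1 := one_add_mul_self_le_rpow_one_add (s := u / v - 1) (by
    have : 0 ≤ u / v := by positivity
    linarith) hγ
  rw [add_sub_cancel, Real.div_rpow hu hv.le] at h1
  have hvp := Real.rpow_pos_of_pos hv γ
  have h2 := mul_le_mul_of_nonneg_right h1 hvp.le
  rw [div_mul_cancel₀ _ hvp.ne'] at h2
  rw [kernelRate, kernelRate, Real.rpow_sub_one hv.ne']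
  have h3 : v ^ γ / (2 * γ) + v ^ γ / v / 2 * (u - v) =
      (1 + γ * (u / v - 1)) * v ^ γ / (2 * γ) := by field_simp
  rw [h3]
  gcongr

/-- The energy `f_γ(|z|² / (d h²))` of a displacement `z`. -/
def energy (γ h : ℝ) {d : ℕ} (z : EuclideanSpace ℝ (Fin d)) : ℝ :=
  kernelRate γ (‖h⁻¹ • z‖ ^ 2 / d)

lemma energy_eq (γ h : ℝ) {d : ℕ} (z : EuclideanSpace ℝ (Fin d)) :
    energy γ h z = kernelRate γ (‖z‖ ^ 2 / d / h ^ 2) := by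
  rw [energy, norm_smul, mul_pow, Real.norm_eq_abs, sq_abs]
  congr 1
  rw [inv_pow, div_div, mul_comm (d : ℝ), ← div_div, inv_mul_eq_div]

lemma energy_nonneg {γ : ℝ} (hγ : 1 ≤ γ) (h : ℝ) {d : ℕ} (z : EuclideanSpace ℝ (Fin d)) :
    0 ≤ energy γ h z := kernelRate_nonneg hγ (by positivity)

lemma continuous_energy {γ : ℝ} (hγ : 1 ≤ γ) (h : ℝ) {d : ℕ} :
    Continuous (energy γ h (d := d)) := by
  have := continuous_kernelRate hγ
  unfold energy
  fun_prop

lemma energy_one_one {d : ℕ} (z : EuclideanSpace ℝ (Fin d)) :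
    energy 1 1 z = ‖z‖ ^ 2 / d / 2 := by
  rw [energy_eq]; simp [kernelRate]

/-! ### A criterion for convergence in mean -/

section Criterion

variable {Ω : ℕ → Type} [∀ d, MeasurableSpace (Ω d)] {μ : ∀ d, Measure (Ω d)}
  [∀ d, IsProbabilityMeasure (μ d)] {X W : ∀ d, Ω d → ℝ}

/-- For `W > 0`, optimizing over `δ` turns the last hypothesis into `-X ≤ √W`. The version linear in
`W` survives averaging, and a bound on the mean of `W` then plays the role of uniform integrability.
-/
lemma integrable_of_nonpos_of_neg_le {Ω : Type} [MeasurableSpace Ω] {μ : Measure Ω}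
    [IsProbabilityMeasure μ] {X W : Ω → ℝ} (hXm : Measurable X) (hX0 : ∀ ω, X ω ≤ 0)
    (hW : Integrable W μ) (hXW : ∀ᵐ ω ∂μ, ∀ δ > 0, -X ω ≤ δ * W ω + 1 / (4 * δ)) :
    Integrable X μ := by
  refine (hW.add (integrable_const (1 / 4 : ℝ))).mono' hXm.aestronglyMeasurable ?_
  filter_upwards [hXW] with ω hω
  have := hω 1 one_pos
  rw [Real.norm_eq_abs, abs_of_nonpos (hX0 ω)]
  simpa using this

/-- If `X d ≤ 0` is bounded from below by a uniformly integrable variable, asymptotically at least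
`F` in probability and at most `F` on average, then it converges to `F` in mean. -/
lemma tendsto_integral_abs_sub {F M : ℝ} (hXm : ∀ᶠ d in atTop, Measurable (X d))
    (hX0 : ∀ᶠ d in atTop, ∀ ω, X d ω ≤ 0) (hW : ∀ᶠ d in atTop, Integrable (W d) (μ d))
    (hWM : ∀ᶠ d in atTop, ∫ ω, W d ω ∂μ d ≤ M)
    (hXW : ∀ᶠ d in atTop, ∀ᵐ ω ∂μ d, ∀ δ > 0, -X d ω ≤ δ * W d ω + 1 / (4 * δ))
    (hlow : ∀ ε > 0, Tendsto (fun d => (μ d).real {ω | X d ω < F - ε}) atTop (𝓝 0))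
    (hup : ∀ ε > 0, ∀ᶠ d in atTop, ∫ ω, X d ω ∂μ d ≤ F + ε)
    (hW0 : ∀ᶠ d in atTop, ∀ ω, 0 ≤ W d ω) :
    Tendsto (fun d => ∫ ω, |X d ω - F| ∂μ d) atTop (𝓝 0) := by
  rw [Metric.tendsto_nhds]
  intro ε' hε'
  set ε := ε' / 8 with hε
  have hε0 : 0 < ε := by positivity
  set δ := ε / (|M| + 1) with hδ
  have hδ0 : 0 < δ := by positivity
  set K := |F| + 1 / (4 * δ) with hK
  have hK0 : 0 < K := by positivity
  have hlow' := (hlow ε hε0).eventually (gt_mem_nhds (show 0 < ε / K by positivity))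
  filter_upwards [hXm, hX0, hW, hWM, hXW, hlow', hup ε hε0, hW0] with d h1 h2 h3 h4 h5 h6 h7 h8
  have hXi := integrable_of_nonpos_of_neg_le h1 h2 h3 h5
  have hB : MeasurableSet {ω | X d ω < F - ε} := measurableSet_lt h1 measurable_const
  set B := {ω | X d ω < F - ε} with hBd
  have hBi : Integrable (B.indicator fun _ => (1 : ℝ)) (μ d) :=
    (integrable_const _).indicator hB
  have hi1 : Integrable (fun ω => X d ω - F) (μ d) := hXi.sub (integrable_const _)
  have hi2 : Integrable (fun ω => 2 * (ε + K * B.indicator (fun _ => 1) ω + δ * W d ω)) (μ d) :=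
    (((integrable_const _).add (hBi.const_mul K)).add (h3.const_mul δ)).const_mul 2
  -- `|a| = a + 2a⁻` with `a = X - F`. The mean of `a` is at most `ε`; `a⁻` is at most `ε` off `B`
  -- and at most `K + δW` on `B`. The four contributions sum to at most `7ε < ε'`.
  have key : ∫ ω, |X d ω - F| ∂μ d ≤
      ∫ ω, ((X d ω - F) + 2 * (ε + K * B.indicator (fun _ => 1) ω + δ * W d ω)) ∂μ d := by
    refine integral_mono_ae hi1.abs (hi1.add hi2) ?_
    filter_upwards [h5] with ω hω
    have hδω := hω δ hδ0
    have hWω := mul_nonneg hδ0.le (h8 ω)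
    by_cases hm : ω ∈ B
    · rw [Set.indicator_of_mem hm]
      have h9 : X d ω < F - ε := hm
      rw [abs_of_nonpos (by linarith)]
      have := le_abs_self F
      linarith
    · rw [Set.indicator_of_notMem hm]
      have h9 : F - ε ≤ X d ω := not_lt.1 hm
      rcases le_total 0 (X d ω - F) with h | h
      · rw [abs_of_nonneg h]; linarith
      · rw [abs_of_nonpos h]; linarith
  have h9 : ∫ ω, B.indicator (fun _ => (1 : ℝ)) ω ∂μ d = (μ d).real B := by
    rw [integral_indicator hB]; simp
  have hi3 : Integrable (fun ω => ε + K * B.indicator (fun _ => (1 : ℝ)) ω) (μ d) :=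
    (integrable_const _).add (hBi.const_mul K)
  rw [integral_add hi1 hi2, integral_sub hXi (integrable_const _), integral_const_mul,
    integral_add hi3 (h3.const_mul δ), integral_add (integrable_const _) (hBi.const_mul K),
    integral_const_mul, integral_const_mul, h9] at key
  simp only [integral_const, probReal_univ, one_smul] at key
  have h10 : K * (μ d).real B ≤ ε := by
    have := mul_le_mul_of_nonneg_left h6.le hK0.le
    rwa [mul_div_cancel₀ _ hK0.ne'] at this
  have h11 : δ * ∫ ω, W d ω ∂μ d ≤ ε := by
    have h12 := mul_le_mul_of_nonneg_left (h4.trans (le_abs_self M)) hδ0.le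
    have h13 : δ * |M| ≤ δ * (|M| + 1) := by gcongr; linarith
    have h14 : δ * (|M| + 1) = ε := by rw [hδ]; field_simp
    linarith
  have h15 : 0 ≤ ∫ ω, |X d ω - F| ∂μ d := integral_nonneg fun _ => abs_nonneg _
  rw [Real.dist_eq, sub_zero, abs_of_nonneg h15]
  linarith

lemma tendsto_integral_of_abs_sub {F : ℝ} (hX : ∀ᶠ d in atTop, Integrable (X d) (μ d))
    (h : Tendsto (fun d => ∫ ω, |X d ω - F| ∂μ d) atTop (𝓝 0)) :
    Tendsto (fun d => ∫ ω, X d ω ∂μ d) atTop (𝓝 F) := by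
  rw [tendsto_iff_norm_sub_tendsto_zero]
  refine squeeze_zero' (by filter_upwards with d; positivity) ?_ h
  filter_upwards [hX] with d hd
  have : ∫ ω, X d ω ∂μ d - F = ∫ ω, (X d ω - F) ∂μ d := by
    rw [integral_sub hd (integrable_const _)]; simp
  rw [this]
  exact norm_integral_le_integral_norm _

end Criterion

/-! ### The limiting free energies -/

section FreeEnergy

variable {γ h : ℝ}

/-- `(1 / d) log ∫ exp (-d m f(|x - y|² / (d h²))) ρ(dy)`. -/
def annealed (γ h m : ℝ) {d : ℕ} (ρ : Measure (EuclideanSpace ℝ (Fin d)))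
    (x : EuclideanSpace ℝ (Fin d)) : ℝ :=
  1 / d * Real.log (∫ y, Real.exp (-(d * (m * energy γ h (x - y)))) ∂ρ)

/-- The displacement of two independent points of law `ρ d` has bounded normalized moments. -/
def MomentBounds (ρ : ∀ d : ℕ, Measure (EuclideanSpace ℝ (Fin d))) : Prop :=
  ∀ p : ℕ, ∃ M : ℝ, ∀ d : ℕ,
    Integrable (fun z : EuclideanSpace ℝ (Fin d) × EuclideanSpace ℝ (Fin d) =>
      (‖z.1 - z.2‖ ^ 2 / d) ^ p) ((ρ d).prod (ρ d)) ∧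
    ∫ z, (‖z.1 - z.2‖ ^ 2 / d) ^ p ∂((ρ d).prod (ρ d)) ≤ M

/-- Up to a small relative error, the ball of squared radius `d L` around a typical point of law
`ρ d` has `ρ d`-mass at least `exp (- d S)`. -/
def BallMassLimit (ρ : ∀ d : ℕ, Measure (EuclideanSpace ℝ (Fin d))) (S L : ℝ) : Prop :=
  ∀ ε > 0, Tendsto (fun d : ℕ => (ρ d).real {x | (ρ d).real {y | ‖x - y‖ ^ 2 / d ≤ L + ε} <
    Real.exp (-(d * (S + ε)))}) atTop (𝓝 0)

/-- `MomentBounds` only speaks of integer powers, hence the comparison `u^{2γ} ≤ 1 + u^{⌈2γ⌉}`. -/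
lemma kernelRate_sq_le (hγ : 1 ≤ γ) (hh : 0 < h) {u : ℝ} (hu : 0 ≤ u) :
    kernelRate γ (u / h ^ 2) ^ 2 ≤
      (1 / (2 * γ * (h ^ 2) ^ γ)) ^ 2 * (1 + u ^ ⌈2 * γ⌉₊) := by
  have h1 : kernelRate γ (u / h ^ 2) = 1 / (2 * γ * (h ^ 2) ^ γ) * u ^ γ := by
    rw [kernelRate, Real.div_rpow hu (by positivity)]
    field_simp
  rw [h1, mul_pow]
  gcongr
  have h2 : (u ^ γ) ^ 2 = u ^ (2 * γ) := by
    rw [mul_comm, Real.rpow_mul hu, Real.rpow_two]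
  rw [h2]
  rcases le_total u 1 with h3 | h3
  · have := Real.rpow_le_one hu h3 (by linarith : 0 ≤ 2 * γ)
    have := pow_nonneg hu ⌈2 * γ⌉₊
    linarith
  · have := Real.rpow_le_rpow_of_exponent_le h3 (Nat.le_ceil (2 * γ))
    rw [Real.rpow_natCast] at this
    linarith

variable {ρ : ∀ d : ℕ, Measure (EuclideanSpace ℝ (Fin d))} [∀ d, IsProbabilityMeasure (ρ d)]

lemma MomentBounds.exists_energy_bound (hρ : MomentBounds ρ) (hγ : 1 ≤ γ) (hh : 0 < h) :
    ∃ M : ℝ, ∀ d : ℕ,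
      Integrable (fun z : EuclideanSpace ℝ (Fin d) × EuclideanSpace ℝ (Fin d) =>
        energy γ h (z.1 - z.2) ^ 2) ((ρ d).prod (ρ d)) ∧
      ∫ z, energy γ h (z.1 - z.2) ^ 2 ∂((ρ d).prod (ρ d)) ≤ M := by
  obtain ⟨M, hM⟩ := hρ ⌈2 * γ⌉₊
  refine ⟨(1 / (2 * γ * (h ^ 2) ^ γ)) ^ 2 * (1 + M), fun d => ?_⟩
  have hi := ((integrable_const (1 : ℝ)).add (hM d).1).const_mul ((1 / (2 * γ * (h ^ 2) ^ γ)) ^ 2)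
  have hb : ∀ z : EuclideanSpace ℝ (Fin d) × EuclideanSpace ℝ (Fin d),
      energy γ h (z.1 - z.2) ^ 2 ≤ (1 / (2 * γ * (h ^ 2) ^ γ)) ^ 2 *
        (1 + (‖z.1 - z.2‖ ^ 2 / d) ^ ⌈2 * γ⌉₊) := fun z => by
    rw [energy_eq]
    exact kernelRate_sq_le hγ hh (by positivity)
  have hc := continuous_energy hγ h (d := d)
  have hI : Integrable (fun z : EuclideanSpace ℝ (Fin d) × EuclideanSpace ℝ (Fin d) =>
        energy γ h (z.1 - z.2) ^ 2) ((ρ d).prod (ρ d)) := by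
    refine hi.mono' (Continuous.aestronglyMeasurable (by fun_prop)) (ae_of_all _ fun z => ?_)
    rw [Real.norm_of_nonneg (sq_nonneg _)]
    exact hb z
  refine ⟨hI, (integral_mono hI hi hb).trans ?_⟩
  simp only [Pi.add_apply]
  rw [integral_const_mul, integral_add (integrable_const _) (hM d).1]
  simp only [integral_const, probReal_univ, one_smul]
  gcongr
  exact (hM d).2

section Fixed

variable {d : ℕ} {ν : Measure (EuclideanSpace ℝ (Fin d))} [IsProbabilityMeasure ν] {m : ℝ}

lemma continuous_exp_energy (hγ : 1 ≤ γ) : Continuous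
    fun z : EuclideanSpace ℝ (Fin d) × EuclideanSpace ℝ (Fin d) =>
      Real.exp (-(d * (m * energy γ h (z.1 - z.2)))) := by
  have hc := continuous_energy hγ h (d := d)
  fun_prop

lemma exp_energy_le_one (hγ : 1 ≤ γ) (hm : 0 ≤ m) (z : EuclideanSpace ℝ (Fin d)) :
    Real.exp (-(d * (m * energy γ h z))) ≤ 1 := by
  have := energy_nonneg hγ h z
  rw [Real.exp_le_one_iff]
  have : 0 ≤ d * (m * energy γ h z) := by positivity
  linarith

lemma integrable_exp_energy (hγ : 1 ≤ γ) (hm : 0 ≤ m) (x : EuclideanSpace ℝ (Fin d)) :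
    Integrable (fun y => Real.exp (-(d * (m * energy γ h (x - y))))) ν := by
  refine (integrable_const (1 : ℝ)).mono' ?_ (ae_of_all _ fun y => ?_)
  · exact ((continuous_exp_energy hγ).comp (Continuous.prodMk_right x)).aestronglyMeasurable
  · rw [Real.norm_of_nonneg (Real.exp_pos _).le]
    exact exp_energy_le_one hγ hm _

lemma integral_exp_energy_pos (hγ : 1 ≤ γ) (hm : 0 ≤ m) (x : EuclideanSpace ℝ (Fin d)) :
    0 < ∫ y, Real.exp (-(d * (m * energy γ h (x - y)))) ∂ν :=
  integral_exp_pos (integrable_exp_energy hγ hm x)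

lemma measurable_annealed (hγ : 1 ≤ γ) : Measurable (annealed γ h m ν) := by
  have := ((continuous_exp_energy hγ (h := h) (m := m) (d := d)).stronglyMeasurable.integral_prod_right'
    (ν := ν)).measurable
  exact (this.log).const_mul _

lemma annealed_nonpos (hγ : 1 ≤ γ) (hm : 0 ≤ m) (x : EuclideanSpace ℝ (Fin d)) :
    annealed γ h m ν x ≤ 0 := by
  refine mul_nonpos_of_nonneg_of_nonpos (by positivity) (Real.log_nonpos ?_ ?_)
  · exact (integral_exp_energy_pos hγ hm x).le
  · refine (integral_mono (integrable_exp_energy hγ hm x) (integrable_const (1 : ℝ))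
      fun y => exp_energy_le_one hγ hm _).trans ?_
    simp

/-- Jensen for `exp` bounds `-annealed` by the mean of `m · energy`, and `e ≤ δe² + 1/(4δ)`
finishes. This supplies the domination hypothesis of `tendsto_integral_abs_sub`. -/
lemma neg_annealed_le (hγ : 1 ≤ γ) (hm : 0 ≤ m) (hd : 0 < d)
    (hi : Integrable (fun z : EuclideanSpace ℝ (Fin d) × EuclideanSpace ℝ (Fin d) =>
        energy γ h (z.1 - z.2) ^ 2) (ν.prod ν)) :
    ∀ᵐ x ∂ν, ∀ δ > 0, -annealed γ h m ν x ≤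
      δ * (m ^ 2 * ∫ y, energy γ h (x - y) ^ 2 ∂ν) + 1 / (4 * δ) := by
  filter_upwards [hi.prod_right_ae] with x hx δ hδ
  have hd' : (0 : ℝ) < d := Nat.cast_pos.2 hd
  have hc := continuous_energy hγ h (d := d)
  have hsq : ∀ y, m * energy γ h (x - y) ≤ δ * (m ^ 2 * energy γ h (x - y) ^ 2) + 1 / (4 * δ) := by
    intro y
    have h1 : δ * (m ^ 2 * energy γ h (x - y) ^ 2) + 1 / (4 * δ) - m * energy γ h (x - y) =
        (2 * δ * (m * energy γ h (x - y)) - 1) ^ 2 / (4 * δ) := by field_simp; ring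
    have h2 : 0 ≤ (2 * δ * (m * energy γ h (x - y)) - 1) ^ 2 / (4 * δ) := by positivity
    linarith
  have hb : Integrable (fun y => δ * (m ^ 2 * energy γ h (x - y) ^ 2) + 1 / (4 * δ)) ν :=
    ((hx.const_mul (m ^ 2)).const_mul δ).add (integrable_const _)
  have he : Integrable (fun y => m * energy γ h (x - y)) ν := by
    refine hb.mono' (Continuous.aestronglyMeasurable (by fun_prop)) (ae_of_all _ fun y => ?_)
    rw [Real.norm_of_nonneg (mul_nonneg hm (energy_nonneg hγ h _))]
    exact hsq y
  have hj := convexOn_exp.map_integral_le (μ := ν) (f := fun y => -(d * (m * energy γ h (x - y))))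
    Real.continuous_exp.continuousOn isClosed_univ (by simp) (he.const_mul (d : ℝ)).neg
    (integrable_exp_energy hγ hm x)
  have hl := Real.log_le_log (Real.exp_pos _) hj
  rw [Real.log_exp, integral_neg, integral_const_mul] at hl
  have h3 : -annealed γ h m ν x ≤ ∫ y, m * energy γ h (x - y) ∂ν := by
    rw [annealed, ← mul_neg, one_div_mul_eq_div, div_le_iff₀ hd']
    linarith
  refine h3.trans ((integral_mono he hb hsq).trans ?_)
  rw [integral_add ((hx.const_mul (m ^ 2)).const_mul δ) (integrable_const _), integral_const_mul,
    integral_const_mul]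
  simp

lemma integrable_annealed (hγ : 1 ≤ γ) (hm : 0 ≤ m) (hd : 0 < d)
    (hi : Integrable (fun z : EuclideanSpace ℝ (Fin d) × EuclideanSpace ℝ (Fin d) =>
        energy γ h (z.1 - z.2) ^ 2) (ν.prod ν)) : Integrable (annealed γ h m ν) ν :=
  integrable_of_nonpos_of_neg_le (measurable_annealed hγ) (annealed_nonpos hγ hm)
    (hi.integral_prod_left.const_mul (m ^ 2)) (neg_annealed_le hγ hm hd hi)

end Fixed

/-- The limit of the annealed free energy of the `γ`-kernel, deduced from the case `γ = 1`. -/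
lemma tendsto_annealed (hρ : MomentBounds ρ) (hγ : 1 ≤ γ) (hh : 0 < h) {m t S L : ℝ} (hm : 0 < m)
    (ht : 0 < t) (hL : 0 < L) (htm : t * h ^ 2 = m * (L / h ^ 2) ^ (γ - 1))
    (h1 : Tendsto (fun d => ∫ x, annealed 1 1 t (ρ d) x ∂(ρ d)) atTop (𝓝 (-(S + t * L / 2))))
    (h2 : BallMassLimit ρ S L) :
    Tendsto (fun d => ∫ x, annealed γ h m (ρ d) x ∂(ρ d)) atTop
      (𝓝 (-(S + m * kernelRate γ (L / h ^ 2)))) := by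
  obtain ⟨M, hM⟩ := hρ.exists_energy_bound hγ hh
  obtain ⟨M₁, hM₁⟩ := hρ.exists_energy_bound (le_refl 1) one_pos
  have hd0 : ∀ᶠ d : ℕ in atTop, 0 < d := eventually_gt_atTop 0
  set F := -(S + m * kernelRate γ (L / h ^ 2)) with hF
  refine tendsto_integral_of_abs_sub
    (hd0.mono fun d hd => integrable_annealed hγ hm.le hd (hM d).1) ?_
  refine tendsto_integral_abs_sub (W := fun d x => m ^ 2 * ∫ y, energy γ h (x - y) ^ 2 ∂(ρ d))
    (M := m ^ 2 * M) (.of_forall fun d => measurable_annealed hγ)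
    (.of_forall fun d => annealed_nonpos hγ hm.le)
    (.of_forall fun d => (hM d).1.integral_prod_left.const_mul (m ^ 2))
    (.of_forall fun d => ?_) (hd0.mono fun d hd => neg_annealed_le hγ hm.le hd (hM d).1) ?_ ?_
    (.of_forall fun d x => mul_nonneg (sq_nonneg m) (integral_nonneg fun y => sq_nonneg _))
  · rw [integral_const_mul]
    gcongr
    rw [← integral_prod _ (hM d).1]
    exact (hM d).2
  · intro ε' hε'
    have hcont : ContinuousAt (fun ε => m * kernelRate γ ((L + ε) / h ^ 2) + ε) 0 := by
      have := continuous_kernelRate hγ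
      fun_prop
    have hev : ∀ᶠ ε in 𝓝[>] (0 : ℝ), m * kernelRate γ ((L + ε) / h ^ 2) + ε <
        m * kernelRate γ (L / h ^ 2) + ε' := by
      refine (hcont.tendsto.mono_left nhdsWithin_le_nhds).eventually (gt_mem_nhds ?_)
      simp only [add_zero]
      linarith
    obtain ⟨ε, hε, hε0⟩ := (hev.and self_mem_nhdsWithin).exists
    have hε0 : 0 < ε := hε0
    refine squeeze_zero' (.of_forall fun d => measureReal_nonneg) ?_ (h2 ε hε0)
    filter_upwards [hd0] with d hd
    refine measureReal_mono fun x hx => ?_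
    have hx : annealed γ h m (ρ d) x < F - ε' := hx
    by_contra hcon
    have hcon : Real.exp (-(d * (S + ε))) ≤ (ρ d).real {y | ‖x - y‖ ^ 2 / d ≤ L + ε} :=
      not_lt.1 hcon
    have hd' : (0 : ℝ) < d := Nat.cast_pos.2 hd
    have hms : MeasurableSet {y | ‖x - y‖ ^ 2 / d ≤ L + ε} :=
      measurableSet_le (by fun_prop) measurable_const
    -- Lower bound: keep only the ball of squared radius `d(L + ε)`, on which the energy is
    -- controlled by monotonicity of `f`.
    have hlb : Real.exp (-(d * (m * kernelRate γ ((L + ε) / h ^ 2)))) *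
        (ρ d).real {y | ‖x - y‖ ^ 2 / d ≤ L + ε} ≤
        ∫ y, Real.exp (-(d * (m * energy γ h (x - y)))) ∂(ρ d) := by
      have : ∫ y, {y | ‖x - y‖ ^ 2 / d ≤ L + ε}.indicator
          (fun _ => Real.exp (-(d * (m * kernelRate γ ((L + ε) / h ^ 2))))) y ∂(ρ d) =
          Real.exp (-(d * (m * kernelRate γ ((L + ε) / h ^ 2)))) *
          (ρ d).real {y | ‖x - y‖ ^ 2 / d ≤ L + ε} := by
        rw [integral_indicator hms]; simp [mul_comm]
      rw [← this]
      refine integral_mono ((integrable_const _).indicator hms) (integrable_exp_energy hγ hm.le x)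
        fun y => ?_
      by_cases hy : y ∈ {y | ‖x - y‖ ^ 2 / d ≤ L + ε}
      · rw [Set.indicator_of_mem hy]
        have hy' : ‖x - y‖ ^ 2 / d ≤ L + ε := hy
        have : energy γ h (x - y) ≤ kernelRate γ ((L + ε) / h ^ 2) := by
          rw [energy_eq]
          exact kernelRate_mono hγ (by positivity) (by gcongr)
        simp only
        gcongr
      · rw [Set.indicator_of_notMem hy]
        exact (Real.exp_pos _).le
    have hlog := Real.log_le_log (by positivity)
      ((mul_le_mul_of_nonneg_left hcon (Real.exp_pos _).le).trans hlb)
    rw [← Real.exp_add, Real.log_exp] at hlog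
    have : -(m * kernelRate γ ((L + ε) / h ^ 2)) - (S + ε) ≤ annealed γ h m (ρ d) x := by
      rw [annealed, one_div_mul_eq_div, le_div_iff₀ hd']
      linarith
    linarith
  · intro ε hε
    have hlim := h1.add_const (t * L / 2 - m * kernelRate γ (L / h ^ 2))
    have hlt : -(S + t * L / 2) + (t * L / 2 - m * kernelRate γ (L / h ^ 2)) < F + ε := by
      rw [hF]; linarith
    filter_upwards [hlim.eventually (gt_mem_nhds hlt), hd0] with d hd hdpos
    refine le_trans ?_ hd.le
    have hd' : (0 : ℝ) < d := Nat.cast_pos.2 hdpos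
    have hi1 := integrable_annealed (m := t) (le_refl 1) ht.le hdpos (hM₁ d).1
    have : ∫ x, annealed 1 1 t (ρ d) x ∂(ρ d) + (t * L / 2 - m * kernelRate γ (L / h ^ 2)) =
        ∫ x, (annealed 1 1 t (ρ d) x + (t * L / 2 - m * kernelRate γ (L / h ^ 2))) ∂(ρ d) := by
      rw [integral_add hi1 (integrable_const _)]; simp
    rw [this]
    refine integral_mono (integrable_annealed hγ hm.le hdpos (hM d).1)
      (hi1.add (integrable_const _)) fun x => ?_
    simp only [annealed]
    -- Upper bound: replace `f` by its tangent at `L/h²`. By `htm` the slope `m f'(L/h²)/h²` equals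
    -- `t/2`, so what remains is the quadratic energy with tilt `t`.
    have hpt : ∀ y, Real.exp (-(d * (m * energy γ h (x - y)))) ≤
        Real.exp (d * (t * L / 2 - m * kernelRate γ (L / h ^ 2))) *
          Real.exp (-(d * (t * energy 1 1 (x - y)))) := by
      intro y
      rw [← Real.exp_add, Real.exp_le_exp, energy_one_one, energy_eq]
      have htan := kernelRate_tangent (u := ‖x - y‖ ^ 2 / d / h ^ 2) (v := L / h ^ 2) hγ
        (by positivity) (by positivity)
      have h3 : m * (kernelRate γ (L / h ^ 2) +
          (L / h ^ 2) ^ (γ - 1) / 2 * (‖x - y‖ ^ 2 / d / h ^ 2 - L / h ^ 2)) =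
          m * kernelRate γ (L / h ^ 2) + t * (‖x - y‖ ^ 2 / d / 2) - t * L / 2 := by
        have h4 : m * ((L / h ^ 2) ^ (γ - 1) / 2 * (‖x - y‖ ^ 2 / d / h ^ 2 - L / h ^ 2)) =
            (m * (L / h ^ 2) ^ (γ - 1)) / 2 * (‖x - y‖ ^ 2 / d / h ^ 2 - L / h ^ 2) := by ring
        rw [mul_add, h4, ← htm]
        field_simp
        ring
      have h5 := mul_le_mul_of_nonneg_left htan hm.le
      rw [h3] at h5
      have h6 := mul_le_mul_of_nonneg_left h5 hd'.le
      linarith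
    have hint := integral_mono (integrable_exp_energy (ν := ρ d) hγ hm.le x)
      ((integrable_exp_energy (ν := ρ d) (le_refl 1) ht.le x).const_mul _) hpt
    rw [integral_const_mul] at hint
    have hlog := Real.log_le_log (integral_exp_energy_pos hγ hm.le x) hint
    rw [Real.log_mul (Real.exp_pos _).ne' (integral_exp_energy_pos (le_refl 1) ht.le x).ne',
      Real.log_exp] at hlog
    rw [one_div_mul_eq_div, one_div_mul_eq_div, div_add' _ _ _ hd'.ne', div_le_div_iff_of_pos_right hd']
    linarith

end FreeEnergy

/-! ### The random energy model -/

section Quenched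

variable {γ h : ℝ}

/-- `(1 / d) log ((1 / n) ∑ i, exp (-d f(|x - y i|² / (d h²))))`. -/
def quenched (γ h : ℝ) {d n : ℕ}
    (z : EuclideanSpace ℝ (Fin d) × (Fin n → EuclideanSpace ℝ (Fin d))) : ℝ :=
  1 / d * Real.log (1 / n * ∑ i, Real.exp (-(d * energy γ h (z.1 - z.2 i))))

lemma sum_exp_pos {n : ℕ} (hn : 0 < n) (e : Fin n → ℝ) : 0 < ∑ i, Real.exp (e i) :=
  Finset.sum_pos (fun _ _ => Real.exp_pos _) ⟨⟨0, hn⟩, Finset.mem_univ _⟩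

/-- Subadditivity of `a ↦ a ^ m` for `m ≤ 1`, in logarithmic form. -/
lemma log_sum_exp_le {n : ℕ} (hn : 0 < n) (e : Fin n → ℝ) {m : ℝ} (hm : 0 < m) (hm1 : m ≤ 1) :
    Real.log (∑ i, Real.exp (e i)) ≤ 1 / m * Real.log (∑ i, Real.exp (m * e i)) := by
  set s := Real.log (∑ i, Real.exp (e i)) with hs
  have hpos := sum_exp_pos hn e
  have h1 : ∀ i, e i ≤ s := fun i => by
    rw [hs, Real.le_log_iff_exp_le hpos]
    exact Finset.single_le_sum (f := fun i => Real.exp (e i)) (fun _ _ => (Real.exp_pos _).le)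
      (Finset.mem_univ i)
  have h2 : Real.exp (m * s) ≤ ∑ i, Real.exp (m * e i) := by
    -- Spread `e^{ms} = e^{(m-1)s} e^s` over the sum; since `m - 1 ≤ 0` and `e i ≤ s`, each factor
    -- `e^{(m-1)s}` is at most `e^{(m-1) e i}`.
    have h3 : Real.exp (m * s) = ∑ i, Real.exp ((m - 1) * s) * Real.exp (e i) := by
      rw [← Finset.mul_sum, ← Real.exp_log hpos, ← hs, ← Real.exp_add]
      ring_nf
    rw [h3]
    refine Finset.sum_le_sum fun i _ => ?_
    rw [← Real.exp_add, Real.exp_le_exp]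
    nlinarith [h1 i]
  have h4 := Real.log_le_log (Real.exp_pos _) h2
  rw [Real.log_exp] at h4
  rw [one_div_mul_eq_div, le_div_iff₀ hm]
  linarith

section Fixed

variable {d n : ℕ} {ν : Measure (EuclideanSpace ℝ (Fin d))} [IsProbabilityMeasure ν]

lemma measurable_quenched (hγ : 1 ≤ γ) : Measurable (quenched γ h (d := d) (n := n)) := by
  have hc := continuous_energy hγ h (d := d)
  have : Continuous fun z : EuclideanSpace ℝ (Fin d) × (Fin n → EuclideanSpace ℝ (Fin d)) =>
      1 / (n : ℝ) * ∑ i, Real.exp (-(d * energy γ h (z.1 - z.2 i))) := by fun_prop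
  exact (this.measurable.log).const_mul _

lemma quenched_nonpos (hγ : 1 ≤ γ) (hn : 0 < n)
    (z : EuclideanSpace ℝ (Fin d) × (Fin n → EuclideanSpace ℝ (Fin d))) :
    quenched γ h z ≤ 0 := by
  have hn' : (0 : ℝ) < n := Nat.cast_pos.2 hn
  refine mul_nonpos_of_nonneg_of_nonpos (by positivity) (Real.log_nonpos ?_ ?_)
  · have := sum_exp_pos hn fun i => -(d * energy γ h (z.1 - z.2 i))
    positivity
  · rw [one_div_mul_eq_div, div_le_one hn']
    refine (Finset.sum_le_sum fun i _ => ?_).trans (b := ∑ _i : Fin n, (1 : ℝ)) (by simp)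
    simpa using exp_energy_le_one (m := 1) hγ zero_le_one (z.1 - z.2 i)

lemma neg_quenched_le (hn : 0 < n) (hd : 0 < d)
    (z : EuclideanSpace ℝ (Fin d) × (Fin n → EuclideanSpace ℝ (Fin d))) {δ : ℝ} (hδ : 0 < δ) :
    -quenched γ h z ≤
      δ * (1 / n * ∑ i, energy γ h (z.1 - z.2 i) ^ 2) + 1 / (4 * δ) := by
  have hn' : (0 : ℝ) < n := Nat.cast_pos.2 hn
  have hd' : (0 : ℝ) < d := Nat.cast_pos.2 hd
  have hj := convexOn_exp.map_sum_le (t := Finset.univ) (w := fun _ : Fin n => 1 / (n : ℝ))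
    (p := fun i => -(d * energy γ h (z.1 - z.2 i))) (fun _ _ => by positivity)
    (by simp [hn'.ne']) (fun _ _ => Set.mem_univ _)
  simp only [smul_eq_mul, ← Finset.mul_sum] at hj
  have hl := Real.log_le_log (Real.exp_pos _) hj
  rw [Real.log_exp] at hl
  have h1 : -quenched γ h z ≤ 1 / n * ∑ i, energy γ h (z.1 - z.2 i) := by
    rw [quenched, ← mul_neg, one_div_mul_eq_div (d : ℝ), div_le_iff₀ hd']
    have : 1 / (n : ℝ) * ∑ i, -(d * energy γ h (z.1 - z.2 i)) =
      -(1 / n * ∑ i, energy γ h (z.1 - z.2 i) * d) := by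
      rw [Finset.sum_neg_distrib, mul_neg]
      simp only [mul_comm]
    rw [this, ← Finset.sum_mul] at hl
    linarith
  have h2 : δ * (1 / n * ∑ i, energy γ h (z.1 - z.2 i) ^ 2) + 1 / (4 * δ) =
      1 / n * ∑ i, (δ * energy γ h (z.1 - z.2 i) ^ 2 + 1 / (4 * δ)) := by
    rw [Finset.sum_add_distrib, ← Finset.mul_sum]
    simp only [Finset.sum_const, Finset.card_univ, Fintype.card_fin, nsmul_eq_mul]
    field_simp
  rw [h2]
  refine h1.trans (mul_le_mul_of_nonneg_left (Finset.sum_le_sum fun i _ => ?_) (by positivity))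
  have h3 : δ * energy γ h (z.1 - z.2 i) ^ 2 + 1 / (4 * δ) - energy γ h (z.1 - z.2 i) =
      (2 * δ * energy γ h (z.1 - z.2 i) - 1) ^ 2 / (4 * δ) := by field_simp; ring
  have h4 : 0 ≤ (2 * δ * energy γ h (z.1 - z.2 i) - 1) ^ 2 / (4 * δ) := by positivity
  linarith

lemma measurePreserving_prodMap_eval (i : Fin n) :
    MeasurePreserving (fun z : EuclideanSpace ℝ (Fin d) × (Fin n → EuclideanSpace ℝ (Fin d)) =>
      (z.1, z.2 i)) (ν.prod (Measure.pi fun _ => ν)) (ν.prod ν) :=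
  (MeasurePreserving.id ν).prod (measurePreserving_eval (fun _ : Fin n => ν) i)

lemma integrable_and_integral_sum_energy_sq (hn : 0 < n)
    (hi : Integrable (fun z : EuclideanSpace ℝ (Fin d) × EuclideanSpace ℝ (Fin d) =>
        energy γ h (z.1 - z.2) ^ 2) (ν.prod ν)) :
    Integrable (fun z : EuclideanSpace ℝ (Fin d) × (Fin n → EuclideanSpace ℝ (Fin d)) =>
      1 / n * ∑ i, energy γ h (z.1 - z.2 i) ^ 2) (ν.prod (Measure.pi fun _ => ν)) ∧
    ∫ z : EuclideanSpace ℝ (Fin d) × (Fin n → EuclideanSpace ℝ (Fin d)),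
      1 / n * ∑ i, energy γ h (z.1 - z.2 i) ^ 2 ∂(ν.prod (Measure.pi fun _ => ν)) =
      ∫ z, energy γ h (z.1 - z.2) ^ 2 ∂(ν.prod ν) := by
  have hn' : (n : ℝ) ≠ 0 := Nat.cast_ne_zero.2 hn.ne'
  have h1 : ∀ i : Fin n, Integrable
      (fun z : EuclideanSpace ℝ (Fin d) × (Fin n → EuclideanSpace ℝ (Fin d)) =>
        energy γ h (z.1 - z.2 i) ^ 2) (ν.prod (Measure.pi fun _ => ν)) := fun i =>
    (measurePreserving_prodMap_eval i).integrable_comp_of_integrable hi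
  refine ⟨(integrable_finsetSum _ fun i _ => h1 i).const_mul _, ?_⟩
  rw [integral_const_mul, integral_finsetSum _ fun i _ => h1 i]
  have h2 : ∀ i : Fin n, ∫ z : EuclideanSpace ℝ (Fin d) × (Fin n → EuclideanSpace ℝ (Fin d)),
      energy γ h (z.1 - z.2 i) ^ 2 ∂(ν.prod (Measure.pi fun _ => ν)) =
      ∫ z, energy γ h (z.1 - z.2) ^ 2 ∂(ν.prod ν) := fun i => by
    have hmp := measurePreserving_prodMap_eval (ν := ν) i
    rw [← hmp.map_eq] at hi ⊢
    rw [integral_map hmp.measurable.aemeasurable hi.aestronglyMeasurable]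
  simp only [h2, Finset.sum_const, Finset.card_univ, Fintype.card_fin, nsmul_eq_mul]
  field_simp

lemma integrable_quenched (hγ : 1 ≤ γ) (hn : 0 < n) (hd : 0 < d)
    (hi : Integrable (fun z : EuclideanSpace ℝ (Fin d) × EuclideanSpace ℝ (Fin d) =>
        energy γ h (z.1 - z.2) ^ 2) (ν.prod ν)) :
    Integrable (quenched γ h (n := n)) (ν.prod (Measure.pi fun _ => ν)) := by
  refine (((integrable_and_integral_sum_energy_sq hn hi).1).add
    (integrable_const (1 / 4 : ℝ))).mono' (measurable_quenched hγ).aestronglyMeasurable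
    (ae_of_all _ fun z => ?_)
  have := neg_quenched_le (γ := γ) (h := h) hn hd z one_pos
  rw [Real.norm_eq_abs, abs_of_nonpos (quenched_nonpos hγ hn z)]
  simpa using this

/-- The replica bound: subadditivity of `a ↦ a^m` replaces the sum by the sum of `m`-th powers, and
Jensen moves the database average inside the logarithm. The right side is `φ_{α,h}(m)` without the
kernel's constants. -/
lemma integral_quenched_le (hγ : 1 ≤ γ) (hn : 0 < n) (hd : 0 < d)
    (hi : Integrable (fun z : EuclideanSpace ℝ (Fin d) × EuclideanSpace ℝ (Fin d) =>
        energy γ h (z.1 - z.2) ^ 2) (ν.prod ν)) {m : ℝ} (hm : 0 < m) (hm1 : m ≤ 1) :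
    ∫ z, quenched γ h (n := n) z ∂(ν.prod (Measure.pi fun _ => ν)) ≤
      (1 - m) / m * (Real.log n / d) + 1 / m * ∫ x, annealed γ h m ν x ∂ν := by
  have hn' : (0 : ℝ) < n := Nat.cast_pos.2 hn
  have hd' : (0 : ℝ) < d := Nat.cast_pos.2 hd
  have hI := integrable_quenched (n := n) hγ hn hd hi
  have hA := integrable_annealed hγ hm.le hd hi
  rw [integral_prod _ hI]
  have h0 : (1 - m) / m * (Real.log n / d) + 1 / m * ∫ x, annealed γ h m ν x ∂ν =
      ∫ x, ((1 - m) / m * (Real.log n / d) + 1 / m * annealed γ h m ν x) ∂ν := by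
    rw [integral_add (integrable_const _) (hA.const_mul _), integral_const, integral_const_mul]; simp
  rw [h0]
  refine integral_mono_ae hI.integral_prod_left ((integrable_const _).add (hA.const_mul _)) ?_
  filter_upwards [hI.prod_right_ae] with x hx
  set I := ∫ y, Real.exp (-(d * (m * energy γ h (x - y)))) ∂ν with hId
  have hIpos : 0 < I := integral_exp_energy_pos hγ hm.le x
  have hWi : ∀ i : Fin n, Integrable (fun y : Fin n → EuclideanSpace ℝ (Fin d) =>
      Real.exp (-(d * (m * energy γ h (x - y i))))) (Measure.pi fun _ => ν) := fun i =>
    (measurePreserving_eval (fun _ : Fin n => ν) i).integrable_comp_of_integrable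
      (integrable_exp_energy hγ hm.le x)
  have hpt : ∀ y : Fin n → EuclideanSpace ℝ (Fin d), quenched γ h (x, y) ≤
      1 / d * (-Real.log n + 1 / m * (Real.log (n * I) - 1)) +
      1 / d * (1 / m * (1 / (n * I))) * ∑ i, Real.exp (-(d * (m * energy γ h (x - y i)))) := by
    intro y
    have hs1 := sum_exp_pos hn fun i => -(d * energy γ h (x - y i))
    have hs2 := sum_exp_pos hn fun i => -(d * (m * energy γ h (x - y i)))
    have h1 := log_sum_exp_le hn (fun i => -(d * energy γ h (x - y i))) hm hm1
    have h2 : ∀ i, m * -(d * energy γ h (x - y i)) = -(d * (m * energy γ h (x - y i))) :=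
      fun i => by ring
    simp only [h2] at h1
    -- Jensen in tangent form, `log Z ≤ log(nI) + Z/(nI) - 1` with `nI` the mean of `Z`;
    -- integrability of `log Z` is then not needed.
    have h3 := Real.log_le_sub_one_of_pos
      (show 0 < (∑ i, Real.exp (-(d * (m * energy γ h (x - y i))))) / (n * I) by positivity)
    rw [Real.log_div hs2.ne' (by positivity)] at h3
    rw [quenched, Real.log_mul (by positivity) hs1.ne', one_div (n : ℝ), Real.log_inv]
    have h4 := mul_le_mul_of_nonneg_left h3 (show 0 ≤ 1 / m by positivity)
    have h5 : -Real.log n + Real.log (∑ i, Real.exp (-(d * energy γ h (x - y i)))) ≤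
        -Real.log n + 1 / m * (Real.log (n * I) - 1) + 1 / m * (1 / (n * I)) *
          ∑ i, Real.exp (-(d * (m * energy γ h (x - y i)))) := by
      have h6 : 1 / m * (1 / (n * I)) * ∑ i, Real.exp (-(d * (m * energy γ h (x - y i)))) =
          1 / m * ((∑ i, Real.exp (-(d * (m * energy γ h (x - y i))))) / (n * I)) := by ring
      rw [h6]
      linarith
    have h7 := mul_le_mul_of_nonneg_left h5 (show 0 ≤ 1 / (d : ℝ) by positivity)
    refine h7.trans (le_of_eq ?_)
    ring
  have hint := integral_mono hx ((integrable_const _).add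
    ((integrable_finsetSum _ fun i _ => hWi i).const_mul _)) hpt
  refine hint.trans (le_of_eq ?_)
  simp only [Pi.add_apply]
  rw [integral_add (integrable_const _) ((integrable_finsetSum _ fun i _ => hWi i).const_mul _),
    integral_const, integral_const_mul, integral_finsetSum _ fun i _ => hWi i]
  have hev : ∀ i : Fin n, ∫ y : Fin n → EuclideanSpace ℝ (Fin d),
      Real.exp (-(d * (m * energy γ h (x - y i)))) ∂(Measure.pi fun _ => ν) = I := fun i =>
    integral_comp_eval (μ := fun _ : Fin n => ν) (i := i)
      (f := fun y => Real.exp (-(d * (m * energy γ h (x - y)))))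
      (integrable_exp_energy hγ hm.le x).aestronglyMeasurable
  simp only [hev, Finset.sum_const, Finset.card_univ, Fintype.card_fin, nsmul_eq_mul,
    probReal_univ, smul_eq_mul, one_mul]
  rw [Real.log_mul hn'.ne' hIpos.ne', annealed, ← hId]
  field_simp
  ring

/-- Chebyshev's inequality for the number of points of a sample in a given set. -/
lemma measure_count_lt_le {A : Set (EuclideanSpace ℝ (Fin d))} (hA : MeasurableSet A)
    (hn : 0 < n) {p : ℝ} (hp : 0 < p) (hpA : p ≤ ν.real A) :
    (Measure.pi fun _ : Fin n => ν) {y | ∑ i, A.indicator (fun _ => (1 : ℝ)) (y i) < n * p / 2} ≤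
      ENNReal.ofReal (4 / (n * p)) := by
  have hn' : (0 : ℝ) < n := Nat.cast_pos.2 hn
  set q := ν.real A with hq
  have hq0 : 0 < q := hp.trans_le hpA
  set P := Measure.pi fun _ : Fin n => ν with hP
  set f : EuclideanSpace ℝ (Fin d) → ℝ := A.indicator fun _ => 1 with hf
  have hfm : Measurable f := measurable_const.indicator hA
  have hf2 : MemLp f 2 ν := (memLp_const 1).indicator hA
  have hfi : ∫ x, f x ∂ν = q := by rw [hf, integral_indicator hA]; simp [hq]
  set N : (Fin n → EuclideanSpace ℝ (Fin d)) → ℝ := ∑ i, fun y => f (y i) with hN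
  have hfL : ∀ i, MemLp (fun y : Fin n → EuclideanSpace ℝ (Fin d) => f (y i)) 2 P := fun i =>
    hf2.comp_measurePreserving (measurePreserving_eval (fun _ : Fin n => ν) i)
  have hNL : MemLp N 2 P := memLp_finsetSum' _ fun i _ => hfL i
  have hEN : ∫ y, N y ∂P = n * q := by
    simp only [hN, Finset.sum_apply]
    rw [integral_finsetSum _ fun i _ => (hfL i).integrable one_le_two]
    have : ∀ i : Fin n, ∫ y : Fin n → EuclideanSpace ℝ (Fin d), f (y i) ∂P = q := fun i => by
      rw [hP, integral_comp_eval (μ := fun _ : Fin n => ν) hfm.aestronglyMeasurable, hfi]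
    simp [this]
  have hVf : Var[f; ν] ≤ q := by
    refine (variance_le_expectation_sq hfm.aestronglyMeasurable).trans (le_of_eq ?_)
    rw [← hfi]
    refine integral_congr_ae (ae_of_all _ fun x => ?_)
    by_cases hx : x ∈ A <;> simp [hf, hx]
  have hVN : Var[N; P] ≤ n * q := by
    rw [hN, hP, variance_sum_pi (X := fun _ => f) fun _ => hf2]
    simp only [Finset.sum_const, Finset.card_univ, Fintype.card_fin, nsmul_eq_mul]
    gcongr
  have hch := meas_ge_le_variance_div_sq hNL (show 0 < n * q / 2 by positivity)
  refine (measure_mono fun y hy => ?_).trans (hch.trans (ENNReal.ofReal_le_ofReal ?_))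
  · have hy : ∑ i, f (y i) < n * p / 2 := hy
    have h1 : N y = ∑ i, f (y i) := by simp [hN]
    have h2 : n * p / 2 ≤ n * q / 2 := by gcongr
    simp only [Set.mem_ofPred_eq, hEN, h1]
    rw [abs_of_nonpos (by nlinarith)]
    linarith
  · calc Var[N; P] / (n * q / 2) ^ 2 ≤ n * q / (n * q / 2) ^ 2 := by gcongr
      _ = 4 / (n * q) := by field_simp; norm_num
      _ ≤ 4 / (n * p) := by gcongr

lemma le_quenched_of_count (hγ : 1 ≤ γ) (hn : 0 < n) (hd : 0 < d) {u p : ℝ} (hp : 0 < p)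
    {x : EuclideanSpace ℝ (Fin d)} {y : Fin n → EuclideanSpace ℝ (Fin d)}
    (hy : n * p / 2 ≤
      ∑ i, {y | ‖x - y‖ ^ 2 / d ≤ u}.indicator (fun _ => (1 : ℝ)) (y i)) :
    1 / d * Real.log (p / 2) - kernelRate γ (u / h ^ 2) ≤ quenched γ h (x, y) := by
  have hn' : (0 : ℝ) < n := Nat.cast_pos.2 hn
  have hd' : (0 : ℝ) < d := Nat.cast_pos.2 hd
  have h1 : (n * p / 2) * Real.exp (-(d * kernelRate γ (u / h ^ 2))) ≤
      ∑ i, Real.exp (-(d * energy γ h (x - y i))) := by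
    refine (mul_le_mul_of_nonneg_right hy (Real.exp_pos _).le).trans ?_
    rw [Finset.sum_mul]
    refine Finset.sum_le_sum fun i _ => ?_
    by_cases hi : y i ∈ {y | ‖x - y‖ ^ 2 / d ≤ u}
    · rw [Set.indicator_of_mem hi, one_mul]
      have hi' : ‖x - y i‖ ^ 2 / d ≤ u := hi
      have : energy γ h (x - y i) ≤ kernelRate γ (u / h ^ 2) := by
        rw [energy_eq]
        exact kernelRate_mono hγ (by positivity) (by gcongr)
      gcongr
    · rw [Set.indicator_of_notMem hi, zero_mul]
      exact (Real.exp_pos _).le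
  have h2 : p / 2 * Real.exp (-(d * kernelRate γ (u / h ^ 2))) ≤
      1 / n * ∑ i, Real.exp (-(d * energy γ h (x - y i))) := by
    refine le_trans (le_of_eq ?_) (mul_le_mul_of_nonneg_left h1 (by positivity))
    field_simp
  have h3 := Real.log_le_log (by positivity) h2
  rw [Real.log_mul (by positivity) (Real.exp_pos _).ne', Real.log_exp] at h3
  have h4 := mul_le_mul_of_nonneg_left h3 (show 0 ≤ 1 / (d : ℝ) by positivity)
  rw [quenched]
  refine le_trans (le_of_eq ?_) h4
  field_simp
  ring

end Fixed

variable {ρ : ∀ d : ℕ, Measure (EuclideanSpace ℝ (Fin d))} [∀ d, IsProbabilityMeasure (ρ d)]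

lemma eventually_pos_of_log_div_tendsto {n : ℕ → ℕ} {α : ℝ} (hα : 0 < α)
    (hn : Tendsto (fun d : ℕ => Real.log (n d) / d) atTop (𝓝 α)) : ∀ᶠ d in atTop, 0 < n d := by
  filter_upwards [hn.eventually (lt_mem_nhds hα)] with d hd
  by_contra! h
  -- For `n d = 0` the convention `Real.log 0 = 0` makes the ratio `0`, which is not positive.
  rw [Nat.le_zero.1 h] at hd
  simp at hd

/-- Lower bound in probability for the quenched free energy: the second moment method. -/
lemma tendsto_measureReal_quenched_lt (hγ : 1 ≤ γ) {n : ℕ → ℕ} {α : ℝ} (hα : 0 < α)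
    (hn : Tendsto (fun d : ℕ => Real.log (n d) / d) atTop (𝓝 α)) {S L ε : ℝ} (hε : 0 < ε)
    (hSα : S + ε < α) (hB : BallMassLimit ρ S L) {b : ℝ}
    (hb : b < -(S + ε + kernelRate γ ((L + ε) / h ^ 2))) :
    Tendsto (fun d => ((ρ d).prod (Measure.pi fun _ : Fin (n d) => ρ d)).real
      {z | quenched γ h z < b}) atTop (𝓝 0) := by
  have hlim1 := hB ε hε
  -- This is `4/(np)` with `p = e^{-d(S+ε)}`: the expected number of sample points in the ball is at
  -- least `np`, which diverges because `S + ε < α`.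
  have hexp : Tendsto (fun d : ℕ => 4 * Real.exp (-(d * (Real.log (n d) / d - (S + ε))))) atTop
      (𝓝 0) := by
    have h1 : Tendsto (fun d : ℕ => (d : ℝ) * (Real.log (n d) / d - (S + ε))) atTop atTop :=
      Tendsto.atTop_mul_pos (sub_pos.2 hSα) tendsto_natCast_atTop_atTop (hn.sub_const _)
    have := (Real.tendsto_exp_neg_atTop_nhds_zero.comp h1).const_mul 4
    simpa using this
  have hlog2 : Tendsto (fun d : ℕ => 1 / (d : ℝ) * Real.log 2) atTop (𝓝 0) := by
    simpa using tendsto_one_div_atTop_nhds_zero_nat.mul_const (Real.log 2)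
  have hgap : 0 < -(S + ε + kernelRate γ ((L + ε) / h ^ 2)) - b := by linarith
  refine squeeze_zero' (.of_forall fun d => measureReal_nonneg) ?_
    (by simpa using hlim1.add hexp)
  filter_upwards [eventually_gt_atTop 0, eventually_pos_of_log_div_tendsto hα hn,
    hlog2.eventually (gt_mem_nhds hgap)] with d hd hnd hl2
  have hd' : (0 : ℝ) < d := Nat.cast_pos.2 hd
  have hn' : (0 : ℝ) < n d := Nat.cast_pos.2 hnd
  set p := Real.exp (-(d * (S + ε))) with hp
  have hp0 : 0 < p := Real.exp_pos _
  set bad := {x | (ρ d).real {y | ‖x - y‖ ^ 2 / d ≤ L + ε} < p} with hbad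
  have hms : MeasurableSet {z : EuclideanSpace ℝ (Fin d) × (Fin (n d) → EuclideanSpace ℝ (Fin d)) |
      quenched γ h z < b} := measurableSet_lt (measurable_quenched hγ) measurable_const
  have hnp : 4 / (n d * p) = 4 * Real.exp (-(d * (Real.log (n d) / d - (S + ε)))) := by
    have h1 : -(d * (Real.log (n d) / d - (S + ε))) = -(Real.log (n d) + -(d * (S + ε))) := by
      field_simp
      ring
    rw [h1, Real.exp_neg, Real.exp_add, Real.exp_log hn', ← hp, div_eq_mul_inv]
  -- Either the ball around `x` is too light, or the ball is heavy and Chebyshev bounds the chance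
  -- that it holds fewer than half of the `np` points.
  have hfib : ∀ x, (Measure.pi fun _ : Fin (n d) => ρ d) (Prod.mk x ⁻¹' {z | quenched γ h z < b}) ≤
      bad.indicator 1 x + ENNReal.ofReal (4 / (n d * p)) := by
    intro x
    by_cases hx : x ∈ bad
    · rw [Set.indicator_of_mem hx]
      exact prob_le_one.trans le_self_add
    · refine le_add_left ?_
      have hx' : p ≤ (ρ d).real {y | ‖x - y‖ ^ 2 / d ≤ L + ε} := not_lt.1 hx
      refine (measure_mono fun y hy => ?_).trans (measure_count_lt_le (A :=
        {y | ‖x - y‖ ^ 2 / d ≤ L + ε}) (measurableSet_le (by fun_prop) measurable_const) hnd hp0 hx')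
      have hy : quenched γ h (x, y) < b := hy
      by_contra hcon
      have h2 := le_quenched_of_count (γ := γ) (h := h) hγ hnd hd hp0 (not_lt.1 hcon)
      rw [Real.log_div hp0.ne' two_ne_zero, hp, Real.log_exp] at h2
      have h3 : 1 / (d : ℝ) * (-(d * (S + ε)) - Real.log 2) =
          -(S + ε) - 1 / (d : ℝ) * Real.log 2 := by field_simp
      linarith
  have hmeas : ((ρ d).prod (Measure.pi fun _ : Fin (n d) => ρ d)) {z | quenched γ h z < b} ≤
      ρ d bad + ENNReal.ofReal (4 / (n d * p)) := by
    rw [Measure.prod_apply hms]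
    refine (lintegral_mono hfib).trans ?_
    rw [lintegral_add_right _ measurable_const]
    gcongr
    · exact lintegral_indicator_one_le _
    · simp
  rw [← hnp, measureReal_def]
  refine (ENNReal.toReal_mono (by finiteness) hmeas).trans ?_
  rw [ENNReal.toReal_add (by finiteness) (by finiteness), ENNReal.toReal_ofReal (by positivity)]
  rfl

/-- Convergence in mean of the quenched free energy, given a matching annealed upper bound with
exponent `m ≤ 1` and lower bounds by ball masses. -/
lemma tendsto_integral_abs_quenched_sub (hρ : MomentBounds ρ) (hγ : 1 ≤ γ) (hh : 0 < h)
    {n : ℕ → ℕ} {α : ℝ} (hα : 0 < α)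
    (hn : Tendsto (fun d : ℕ => Real.log (n d) / d) atTop (𝓝 α)) {m G F : ℝ} (hm : 0 < m)
    (hm1 : m ≤ 1) (hG : Tendsto (fun d => ∫ x, annealed γ h m (ρ d) x ∂(ρ d)) atTop (𝓝 G))
    (hF : (1 - m) / m * α + 1 / m * G = F)
    (hlow : ∀ ε' > 0, ∃ S L ε, 0 < ε ∧ S + ε < α ∧ BallMassLimit ρ S L ∧
      F - ε' < -(S + ε + kernelRate γ ((L + ε) / h ^ 2))) :
    Tendsto (fun d => ∫ z, |quenched γ h (n := n d) z - F|
      ∂((ρ d).prod (Measure.pi fun _ => ρ d))) atTop (𝓝 0) := by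
  obtain ⟨M, hM⟩ := hρ.exists_energy_bound hγ hh
  have hd0 : ∀ᶠ d : ℕ in atTop, 0 < d := eventually_gt_atTop 0
  have hn0 := eventually_pos_of_log_div_tendsto hα hn
  refine tendsto_integral_abs_sub
    (Ω := fun d => EuclideanSpace ℝ (Fin d) × (Fin (n d) → EuclideanSpace ℝ (Fin d)))
    (μ := fun d => (ρ d).prod (Measure.pi fun _ => ρ d)) (X := fun d => quenched γ h) (M := M)
    (W := fun d z => 1 / (n d : ℝ) * ∑ i, energy γ h (z.1 - z.2 i) ^ 2)
    (.of_forall fun d => measurable_quenched hγ) (hn0.mono fun d hnd => quenched_nonpos hγ hnd)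
    (hn0.mono fun d hnd => (integrable_and_integral_sum_energy_sq hnd (hM d).1).1)
    (hn0.mono fun d hnd => ?_) ?_ ?_ ?_
    (.of_forall fun d z => by positivity)
  · rw [(integrable_and_integral_sum_energy_sq hnd (hM d).1).2]
    exact (hM d).2
  · filter_upwards [hd0, hn0] with d hd hnd
    exact ae_of_all _ fun z δ hδ => neg_quenched_le hnd hd z hδ
  · intro ε' hε'
    obtain ⟨S, L, ε, hε, hS, hB, hlt⟩ := hlow ε' hε'
    exact tendsto_measureReal_quenched_lt hγ hα hn hε hS hB hlt
  · intro ε hε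
    have hlim := (hn.const_mul ((1 - m) / m)).add (hG.const_mul (1 / m))
    rw [hF] at hlim
    filter_upwards [hd0, hn0, hlim.eventually (gt_mem_nhds (show F < F + ε by linarith))]
      with d hd hnd hlt
    exact (integral_quenched_le hγ hnd hd (hM d).1 hm hm1).trans hlt.le

end Quenched

/-! ### Products of one-dimensional Gaussian laws -/

section DiagGaussian

/-- On a box the indicator splits into the factors and independence splits the integral.
σ-finiteness of the factors is what makes boxes determine the product. -/
lemma pi_withDensity {ι : Type*} [Fintype ι] {X : ι → Type*} [∀ i, MeasurableSpace (X i)]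
    (μ : ∀ i, Measure (X i)) [∀ i, IsProbabilityMeasure (μ i)] {f : ∀ i, X i → ℝ≥0∞}
    (hf : ∀ i, Measurable (f i)) [∀ i, SigmaFinite ((μ i).withDensity (f i))] :
    (Measure.pi μ).withDensity (fun x => ∏ i, f i (x i)) =
      Measure.pi fun i => (μ i).withDensity (f i) := by
  refine (Measure.pi_eq fun s hs => ?_).symm
  rw [withDensity_apply _ (.univ_pi hs), ← lintegral_indicator (.univ_pi hs)]
  have h1 : (Set.univ.pi s).indicator (fun x => ∏ i, f i (x i)) =
      fun x => ∏ i, (s i).indicator (f i) (x i) := by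
    ext x
    by_cases hx : x ∈ Set.univ.pi s
    · rw [Set.indicator_of_mem hx]
      exact Finset.prod_congr rfl fun i _ => (Set.indicator_of_mem (hx i trivial) _).symm
    · rw [Set.indicator_of_notMem hx]
      simp only [Set.mem_pi, Set.mem_univ, true_implies, not_forall] at hx
      obtain ⟨i, hi⟩ := hx
      exact (Finset.prod_eq_zero (Finset.mem_univ i) (Set.indicator_of_notMem hi _)).symm
  have hm : ∀ i, Measurable ((s i).indicator (f i)) := fun i => (hf i).indicator (hs i)
  have hind := iIndepFun_pi (μ := μ) (X := fun i => (s i).indicator (f i))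
    fun i => (hm i).aemeasurable
  rw [h1, lintegral_prod_eq_prod_lintegral_of_indepFun Finset.univ _ hind
    fun i => (hm i).comp (measurable_pi_apply i)]
  refine Finset.prod_congr rfl fun i _ => ?_
  rw [withDensity_apply _ (hs i), ← lintegral_indicator (hs i)]
  exact (measurePreserving_eval μ i).lintegral_comp (hm i)

lemma withDensity_pi_exp {d : ℕ} (μ : Fin d → Measure ℝ) [∀ i, IsProbabilityMeasure (μ i)]
    {g : Fin d → ℝ → ℝ} (hg : ∀ i, Measurable (g i))
    [∀ i, SigmaFinite ((μ i).withDensity fun x => ENNReal.ofReal (Real.exp (g i x)))] :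
    (Measure.pi μ).withDensity (fun x => ENNReal.ofReal (Real.exp (∑ i, g i (x i)))) =
      Measure.pi fun i => (μ i).withDensity fun x => ENNReal.ofReal (Real.exp (g i x)) := by
  rw [← pi_withDensity μ fun i => by fun_prop]
  congr with x
  rw [Real.exp_sum, ENNReal.ofReal_prod_of_nonneg fun i _ => (Real.exp_pos _).le]

/-- The centered Gaussian law on `ℝ ^ d` with independent coordinates of variances `v`. -/
def diagGaussian {d : ℕ} (v : Fin d → NNReal) : Measure (Fin d → ℝ) :=
  Measure.pi fun r => gaussianReal 0 (v r)

instance {d : ℕ} (v : Fin d → NNReal) : IsProbabilityMeasure (diagGaussian v) := by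
  unfold diagGaussian; infer_instance

lemma gaussianReal_withDensity_eq_volume {v : NNReal} (hv : v ≠ 0) :
    (gaussianReal 0 v).withDensity (fun x => ENNReal.ofReal
      (Real.exp (1 / 2 * Real.log (2 * Real.pi * v) + x ^ 2 / (2 * v)))) = volume := by
  have hv' : (0 : ℝ) < v := NNReal.coe_pos.2 (pos_iff_ne_zero.2 hv)
  rw [gaussianReal_of_var_ne_zero _ hv, ← withDensity_mul _ (measurable_gaussianPDF _ _) (by fun_prop)]
  have : gaussianPDF 0 v * (fun x => ENNReal.ofReal
      (Real.exp (1 / 2 * Real.log (2 * Real.pi * v) + x ^ 2 / (2 * v)))) = 1 := by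
    ext x
    rw [Pi.mul_apply, gaussianPDF, ← ENNReal.ofReal_mul (gaussianPDFReal_nonneg _ _ _),
      gaussianPDFReal, Real.exp_add, mul_comm (1 / 2 : ℝ), ← Real.rpow_def_of_pos (by positivity),
      ← Real.sqrt_eq_rpow]
    have h1 : Real.exp (-(x - 0) ^ 2 / (2 * v)) * Real.exp (x ^ 2 / (2 * v)) = 1 := by
      rw [← Real.exp_add, ← Real.exp_zero]
      congr 1
      ring
    have h2 : √(2 * Real.pi * v) ≠ 0 := by positivity
    have h3 : (√(2 * Real.pi * v))⁻¹ * Real.exp (-(x - 0) ^ 2 / (2 * v)) *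
        (√(2 * Real.pi * v) * Real.exp (x ^ 2 / (2 * v))) =
        (√(2 * Real.pi * v))⁻¹ * √(2 * Real.pi * v) *
        (Real.exp (-(x - 0) ^ 2 / (2 * v)) * Real.exp (x ^ 2 / (2 * v))) := by ring
    rw [h3, h1, inv_mul_cancel₀ h2]
    simp
  rw [this, withDensity_one]

/-- Lebesgue measure is expressed relative to the Gaussian law, so that the estimator's density and
the log-likelihood ratio live over a probability measure. -/
lemma diagGaussian_withDensity_eq_volume {d : ℕ} {v : Fin d → NNReal} (hv : ∀ r, v r ≠ 0) :
    (diagGaussian v).withDensity (fun x => ENNReal.ofReal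
      (Real.exp (∑ r, (1 / 2 * Real.log (2 * Real.pi * v r) + x r ^ 2 / (2 * v r))))) = volume := by
  have : ∀ r, SigmaFinite ((gaussianReal 0 (v r)).withDensity (fun x => ENNReal.ofReal
      (Real.exp (1 / 2 * Real.log (2 * Real.pi * v r) + x ^ 2 / (2 * v r))))) := fun r => by
    rw [gaussianReal_withDensity_eq_volume (hv r)]; infer_instance
  rw [diagGaussian, withDensity_pi_exp (fun r => gaussianReal 0 (v r))
    (g := fun r x => 1 / 2 * Real.log (2 * Real.pi * v r) + x ^ 2 / (2 * v r))
    fun r => by fun_prop]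
  simp only [gaussianReal_withDensity_eq_volume (hv _)]
  rfl

/-- Gaussian tilting of a one-dimensional Gaussian law. -/
lemma gaussianReal_tilt {v b : NNReal} (hv : v ≠ 0) {t : ℝ} (ht : 0 < t)
    (hb : (b : ℝ) = v / (1 + t * v)) (x : ℝ) :
    (gaussianReal 0 v).withDensity (fun y => ENNReal.ofReal (Real.exp
      (1 / 2 * Real.log (1 + t * v) + t * x ^ 2 / (2 * (1 + t * v)) - t / 2 * (x - y) ^ 2))) =
    gaussianReal (t * v * x / (1 + t * v)) b := by
  have hv' : (0 : ℝ) < v := NNReal.coe_pos.2 (pos_iff_ne_zero.2 hv)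
  have hb0 : b ≠ 0 := by
    intro h
    rw [h, NNReal.coe_zero] at hb
    have : 0 < v / (1 + t * v) := by positivity
    linarith
  rw [gaussianReal_of_var_ne_zero _ hv, gaussianReal_of_var_ne_zero _ hb0,
    ← withDensity_mul _ (measurable_gaussianPDF _ _) (by fun_prop)]
  congr 1
  ext y
  rw [Pi.mul_apply, gaussianPDF, gaussianPDF, ← ENNReal.ofReal_mul (gaussianPDFReal_nonneg _ _ _),
    gaussianPDFReal, gaussianPDFReal, hb]
  congr 1
  rw [add_sub_assoc, Real.exp_add, mul_comm (1 / 2 : ℝ), ← Real.rpow_def_of_pos (by positivity),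
    ← Real.sqrt_eq_rpow]
  have h1 : (√(2 * Real.pi * (v / (1 + t * v))))⁻¹ = (√(2 * Real.pi * v))⁻¹ * √(1 + t * v) := by
    rw [← mul_div_assoc, Real.sqrt_div' _ (by positivity), inv_div, div_eq_inv_mul]
  have h2 : Real.exp (-(y - t * v * x / (1 + t * v)) ^ 2 / (2 * (v / (1 + t * v)))) =
      Real.exp (-(y - 0) ^ 2 / (2 * v)) *
        Real.exp (t * x ^ 2 / (2 * (1 + t * v)) - t / 2 * (x - y) ^ 2) := by
    rw [← Real.exp_add]
    congr 1
    field_simp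
    ring
  rw [h1, h2]
  ring

/-- The exponent normalizing the Gaussian tilt around the point `x`. -/
def tiltExponent {d : ℕ} (v : Fin d → NNReal) (t : ℝ) (x : Fin d → ℝ) : ℝ :=
  ∑ r, (1 / 2 * Real.log (1 + t * v r) + t * x r ^ 2 / (2 * (1 + t * v r)))

/-- The variances `v / (1 + t v)` of the tilted law. -/
def tiltVar {d : ℕ} (v : Fin d → NNReal) (t : ℝ) (r : Fin d) : NNReal :=
  (v r / (1 + t * v r) : ℝ).toNNReal

lemma coe_tiltVar {d : ℕ} (v : Fin d → NNReal) {t : ℝ} (ht : 0 < t) (r : Fin d) :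
    (tiltVar v t r : ℝ) = v r / (1 + t * v r) := by
  rw [tiltVar, Real.coe_toNNReal _ (by positivity)]

/-- Complete the square in each coordinate. Writing the tilted point with `- w` makes the
displacement `x r - y r = x r/(1 + t v r) + w r` a sum of independent Gaussians. -/
lemma diagGaussian_tilt {d : ℕ} {v : Fin d → NNReal} (hv : ∀ r, v r ≠ 0) {t : ℝ} (ht : 0 < t)
    (x : Fin d → ℝ) :
    (diagGaussian v).withDensity (fun y => ENNReal.ofReal (Real.exp
      (tiltExponent v t x - t / 2 * ∑ r, (x r - y r) ^ 2))) =
    (diagGaussian (tiltVar v t)).map fun w r => t * v r * x r / (1 + t * v r) - w r := by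
  have htilt := fun r => gaussianReal_tilt (hv r) ht (coe_tiltVar v ht r) (x r)
  have hs : ∀ r, SigmaFinite ((gaussianReal 0 (v r)).withDensity (fun y => ENNReal.ofReal (Real.exp
      (1 / 2 * Real.log (1 + t * v r) + t * x r ^ 2 / (2 * (1 + t * v r)) -
        t / 2 * (x r - y) ^ 2)))) := fun r => by rw [htilt r]; infer_instance
  have hL : (diagGaussian v).withDensity (fun y => ENNReal.ofReal (Real.exp
      (tiltExponent v t x - t / 2 * ∑ r, (x r - y r) ^ 2))) =
      Measure.pi fun r => gaussianReal (t * v r * x r / (1 + t * v r)) (tiltVar v t r) := by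
    simp only [← htilt]
    rw [← withDensity_pi_exp (fun r => gaussianReal 0 (v r))
      (g := fun r y => 1 / 2 * Real.log (1 + t * v r) + t * x r ^ 2 / (2 * (1 + t * v r)) -
        t / 2 * (x r - y) ^ 2) fun r => by fun_prop]
    simp only [Finset.sum_sub_distrib, ← Finset.mul_sum]
    rfl
  have hR : ∀ r, (gaussianReal 0 (tiltVar v t r)).map
      (fun w => t * v r * x r / (1 + t * v r) - w) =
      gaussianReal (t * v r * x r / (1 + t * v r)) (tiltVar v t r) := fun r => by
    rw [gaussianReal_map_const_sub, sub_zero]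
  have hs2 : ∀ r, SigmaFinite ((gaussianReal 0 (tiltVar v t r)).map
      (fun w => t * v r * x r / (1 + t * v r) - w)) := fun r => by rw [hR r]; infer_instance
  rw [hL, diagGaussian, Measure.pi_map_pi (f := fun r w => t * v r * x r / (1 + t * v r) - w)
    fun r => by fun_prop]
  simp only [hR]

/-- A linear combination of independent diagonal Gaussian vectors. -/
lemma diagGaussian_prod_map_add {d : ℕ} {v b a : Fin d → NNReal} {κ : Fin d → ℝ}
    (ha : ∀ r, (a r : ℝ) = κ r ^ 2 * v r + b r) :
    ((diagGaussian v).prod (diagGaussian b)).map (fun z r => κ r * z.1 r + z.2 r) =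
      diagGaussian a := by
  have hm : Measurable fun (z : (Fin d → ℝ) × (Fin d → ℝ)) (r : Fin d) => κ r * z.1 r + z.2 r := by
    fun_prop
  have : IsProbabilityMeasure (((diagGaussian v).prod (diagGaussian b)).map
      (fun z r => κ r * z.1 r + z.2 r)) := Measure.isProbabilityMeasure_map hm.aemeasurable
  refine charFun_eq_pi_iff.1 fun t => ?_
  rw [charFun, integral_map (by fun_prop) (by fun_prop), integral_map (by fun_prop) (by fun_prop)]
  have h1 : ∀ z : (Fin d → ℝ) × (Fin d → ℝ),
      Complex.exp ((inner ℝ (WithLp.toLp 2 fun r => κ r * z.1 r + z.2 r) t : ℝ) * Complex.I) =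
      Complex.exp ((inner ℝ (WithLp.toLp 2 z.1) (WithLp.toLp 2 fun r => κ r * t r) : ℝ) * Complex.I) *
      Complex.exp ((inner ℝ (WithLp.toLp 2 z.2) t : ℝ) * Complex.I) := fun z => by
    rw [← Complex.exp_add, ← add_mul, ← Complex.ofReal_add]
    congr 3
    simp only [PiLp.inner_apply, RCLike.inner_apply, conj_trivial]
    rw [← Finset.sum_add_distrib]
    exact Finset.sum_congr rfl fun r _ => by ring
  simp only [h1]
  rw [integral_prod_mul (fun x : Fin d → ℝ => Complex.exp
      ((inner ℝ (WithLp.toLp 2 x) (WithLp.toLp 2 fun r => κ r * t r) : ℝ) * Complex.I))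
      (fun w : Fin d → ℝ => Complex.exp ((inner ℝ (WithLp.toLp 2 w) t : ℝ) * Complex.I))]
  have h2 : ∀ (u : Fin d → NNReal) (s : EuclideanSpace ℝ (Fin d)),
      ∫ x, Complex.exp ((inner ℝ (WithLp.toLp 2 x) s : ℝ) * Complex.I) ∂(diagGaussian u) =
      ∏ r, charFun (gaussianReal 0 (u r)) (s r) := fun u s => by
    rw [← charFun_pi, charFun, integral_map (by fun_prop) (by fun_prop)]
    rfl
  rw [h2, h2, ← Finset.prod_mul_distrib]
  refine Finset.prod_congr rfl fun r _ => ?_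
  rw [charFun_gaussianReal, charFun_gaussianReal, charFun_gaussianReal, ← Complex.exp_add]
  have := congrArg (fun x : ℝ => (x : ℂ)) (ha r)
  push_cast at this
  rw [this]
  congr 1
  push_cast
  ring

/-! ### Moments -/

/-- The moments `E g ^ (2 p)` of a standard Gaussian variable. -/
def gaussMoment (p : ℕ) : ℝ := ∫ x, (x ^ 2) ^ p ∂(gaussianReal 0 1)

lemma integrable_sq_pow_gaussianReal (v : NNReal) (p : ℕ) :
    Integrable (fun x => (x ^ 2) ^ p) (gaussianReal 0 v) := by
  have := (memLp_id_gaussianReal (μ := 0) (v := v) (2 * p : ℕ)).integrable_norm_pow'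
  refine this.congr (ae_of_all _ fun x => ?_)
  simp only [id_eq, Real.norm_eq_abs, pow_mul, sq_abs]

lemma integral_sq_pow_gaussianReal (v : NNReal) (p : ℕ) :
    ∫ x, (x ^ 2) ^ p ∂(gaussianReal 0 v) = v ^ p * gaussMoment p := by
  have h := gaussianReal_map_const_mul (μ := 0) (v := 1) (√v)
  have hv : NNReal.mk (√v ^ 2) (sq_nonneg _) * 1 = v := by
    ext; simp
  rw [mul_zero, hv] at h
  rw [← h, integral_map (by fun_prop) (by fun_prop), gaussMoment, ← integral_const_mul]
  refine integral_congr_ae (ae_of_all _ fun x => ?_)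
  simp only
  rw [mul_pow, Real.sq_sqrt v.coe_nonneg, mul_pow]

lemma gaussMoment_nonneg (p : ℕ) : 0 ≤ gaussMoment p :=
  integral_nonneg fun x => by positivity

lemma gaussMoment_one : gaussMoment 1 = 1 := by
  have h := variance_fun_id_gaussianReal (μ := 0) (v := 1)
  rw [variance_of_integral_eq_zero (by fun_prop) (by simp)] at h
  simpa [gaussMoment] using h

lemma integral_sq_gaussianReal (v : NNReal) : ∫ x, x ^ 2 ∂(gaussianReal 0 v) = v := by
  simpa [gaussMoment_one] using integral_sq_pow_gaussianReal v 1

lemma integrable_sq_eval_diagGaussian {d : ℕ} (v : Fin d → NNReal) (r : Fin d) :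
    Integrable (fun z => z r ^ 2) (diagGaussian v) :=
  (measurePreserving_eval (fun r => gaussianReal 0 (v r)) r).integrable_comp_of_integrable
    (g := fun x : ℝ => x ^ 2) (by simpa using integrable_sq_pow_gaussianReal (v r) 1)

lemma integral_sq_eval_diagGaussian {d : ℕ} (v : Fin d → NNReal) (r : Fin d) :
    ∫ z, z r ^ 2 ∂(diagGaussian v) = v r := by
  rw [diagGaussian, integral_comp_eval (μ := fun r => gaussianReal 0 (v r)) (i := r)
    (f := fun x : ℝ => x ^ 2) (by fun_prop), integral_sq_gaussianReal]

/-- Chebyshev's inequality for a diagonal quadratic form of a Gaussian vector. -/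
lemma diagGaussian_real_quadratic_le {d : ℕ} (v : Fin d → NNReal) (c : Fin d → ℝ) {B ε : ℝ}
    (hε : 0 < ε) (hB : ∀ r, |c r * v r| ≤ B) :
    (diagGaussian v).real {z | ε ≤ |∑ r, c r * z r ^ 2 - ∑ r, c r * v r|} ≤
      d * (B ^ 2 * gaussMoment 2) / ε ^ 2 := by
  have hL : ∀ r, MemLp (fun x : ℝ => c r * x ^ 2) 2 (gaussianReal 0 (v r)) := fun r => by
    rw [memLp_two_iff_integrable_sq (by fun_prop)]
    refine ((integrable_sq_pow_gaussianReal (v r) 2).const_mul (c r ^ 2)).congr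
      (ae_of_all _ fun x => ?_)
    simp only; ring
  set N : (Fin d → ℝ) → ℝ := ∑ r, fun z => c r * z r ^ 2 with hN
  have hNL : MemLp N 2 (diagGaussian v) := memLp_finsetSum' _ fun r _ =>
    (hL r).comp_measurePreserving (measurePreserving_eval (fun r => gaussianReal 0 (v r)) r)
  have hEN : ∫ z, N z ∂(diagGaussian v) = ∑ r, c r * v r := by
    simp only [hN, Finset.sum_apply]
    rw [integral_finsetSum _ fun r _ => (integrable_sq_eval_diagGaussian v r).const_mul _]
    simp only [integral_const_mul, integral_sq_eval_diagGaussian]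
  -- Only the products `c r * v r` are bounded; the eigenvalues themselves may be large.
  have hVN : Var[N; diagGaussian v] ≤ d * (B ^ 2 * gaussMoment 2) := by
    rw [hN, diagGaussian, variance_sum_pi (X := fun r x => c r * x ^ 2) hL]
    refine (Finset.sum_le_sum fun r _ => ?_).trans (b := ∑ _r : Fin d, B ^ 2 * gaussMoment 2)
      (by simp)
    refine (variance_le_expectation_sq (by fun_prop)).trans ?_
    have h1 : ∫ x, ((fun x : ℝ => c r * x ^ 2) ^ 2) x ∂(gaussianReal 0 (v r)) =
        (c r * v r) ^ 2 * gaussMoment 2 := by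
      have h2 : ∀ x : ℝ, ((fun x : ℝ => c r * x ^ 2) ^ 2) x = c r ^ 2 * (x ^ 2) ^ 2 := fun x => by
        simp only [Pi.pow_apply]; ring
      simp only [h2]
      rw [integral_const_mul, integral_sq_pow_gaussianReal]
      ring
    rw [h1, ← sq_abs]
    have := hB r
    have := gaussMoment_nonneg 2
    gcongr
  have hch := meas_ge_le_variance_div_sq hNL hε
  rw [measureReal_def]
  refine ENNReal.toReal_le_of_le_ofReal (by have := gaussMoment_nonneg 2; positivity) ?_
  refine le_trans (measure_mono fun z hz => ?_) (hch.trans (ENNReal.ofReal_le_ofReal ?_))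
  · rw [hEN]
    simpa [hN] using hz
  · gcongr

/-- Jensen for `u ↦ u^p` with weights `v r / V` applied to `z r² / v r`. The resulting bound
involves the variances only through their sum, which is the quantity that the trace hypothesis
controls. -/
lemma diagGaussian_sum_sq_pow {d : ℕ} {v : Fin d → NNReal} (hv : ∀ r, v r ≠ 0) (hd : 0 < d)
    (p : ℕ) :
    Integrable (fun z => (∑ r, z r ^ 2) ^ p) (diagGaussian v) ∧
      ∫ z, (∑ r, z r ^ 2) ^ p ∂(diagGaussian v) ≤ gaussMoment p * (∑ r, (v r : ℝ)) ^ p := by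
  have hv' : ∀ r, (0 : ℝ) < v r := fun r => NNReal.coe_pos.2 (pos_iff_ne_zero.2 (hv r))
  set V := ∑ r, (v r : ℝ) with hV
  have hV0 : 0 < V := Finset.sum_pos (fun r _ => hv' r) ⟨⟨0, hd⟩, Finset.mem_univ _⟩
  have hpt : ∀ z : Fin d → ℝ, (∑ r, z r ^ 2) ^ p ≤
      ∑ r, V ^ p * (v r / V) * (1 / (v r : ℝ) ^ p) * (z r ^ 2) ^ p := by
    intro z
    have hj := Real.pow_arith_mean_le_arith_mean_pow Finset.univ (fun r => v r / V)
      (fun r => z r ^ 2 / v r) (fun r _ => by positivity)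
      (by rw [← Finset.sum_div, ← hV, div_self hV0.ne'])
      (fun r _ => by positivity) p
    have h1 : ∑ r, v r / V * (z r ^ 2 / v r) = (∑ r, z r ^ 2) / V := by
      rw [Finset.sum_div]
      refine Finset.sum_congr rfl fun r _ => ?_
      have := (hv' r).ne'
      field_simp
    rw [h1, div_pow, div_le_iff₀ (by positivity), Finset.sum_mul] at hj
    refine hj.trans (le_of_eq (Finset.sum_congr rfl fun r _ => ?_))
    have := (hv' r).ne'
    rw [div_pow]
    field_simp
  have hi : ∀ r, Integrable (fun z : Fin d → ℝ => (z r ^ 2) ^ p) (diagGaussian v) := fun r =>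
    (measurePreserving_eval (fun r => gaussianReal 0 (v r)) r).integrable_comp_of_integrable
      (integrable_sq_pow_gaussianReal (v r) p)
  have hI : ∀ r, ∫ z, (z r ^ 2) ^ p ∂(diagGaussian v) = v r ^ p * gaussMoment p := fun r => by
    rw [diagGaussian, integral_comp_eval (μ := fun r => gaussianReal 0 (v r)) (i := r)
      (f := fun x : ℝ => (x ^ 2) ^ p) (by fun_prop), integral_sq_pow_gaussianReal]
  have hsum := integrable_finsetSum Finset.univ fun r _ =>
    (hi r).const_mul (V ^ p * (v r / V) * (1 / (v r : ℝ) ^ p))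
  have hint : Integrable (fun z => (∑ r, z r ^ 2) ^ p) (diagGaussian v) := by
    refine hsum.mono' (Measurable.aestronglyMeasurable (by fun_prop)) (ae_of_all _ fun z => ?_)
    rw [Real.norm_of_nonneg (by positivity)]
    exact hpt z
  refine ⟨hint, (integral_mono hint hsum hpt).trans (le_of_eq ?_)⟩
  rw [integral_finsetSum _ fun r _ => (hi r).const_mul _]
  simp only [integral_const_mul, hI]
  have h2 : ∀ r, V ^ p * (v r / V) * (1 / (v r : ℝ) ^ p) * (v r ^ p * gaussMoment p) =
      gaussMoment p * V ^ p * (v r / V) := fun r => by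
    have := (hv' r).ne'
    field_simp
  simp only [h2]
  rw [← Finset.mul_sum, ← Finset.sum_div, ← hV, div_self hV0.ne', mul_one]

end DiagGaussian

/-! ### Diagonalization of the data law -/

section Diagonalization

variable {d : ℕ} {C : Matrix (Fin d) (Fin d) ℝ}

/-- The eigenvalues of the covariance matrix, as nonnegative reals. -/
def eigVar (hC : C.PosDef) (r : Fin d) : NNReal := (hC.isHermitian.eigenvalues r).toNNReal

lemma coe_eigVar (hC : C.PosDef) (r : Fin d) :
    (eigVar hC r : ℝ) = hC.isHermitian.eigenvalues r :=
  Real.coe_toNNReal _ (hC.eigenvalues_pos r).le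

lemma eigVar_ne_zero (hC : C.PosDef) (r : Fin d) : eigVar hC r ≠ 0 := by
  have h := hC.eigenvalues_pos r
  rw [← coe_eigVar hC] at h
  exact (NNReal.coe_pos.1 h).ne'

instance (C : Matrix (Fin d) (Fin d) ℝ) : IsProbabilityMeasure (gaussianLaw C) := by
  unfold gaussianLaw; infer_instance

lemma dotProduct_mulVec_eq_sum (hC : C.PosDef) (t : EuclideanSpace ℝ (Fin d)) :
    (t : Fin d → ℝ) ⬝ᵥ C.mulVec t =
      ∑ r, hC.isHermitian.eigenvalues r * (hC.isHermitian.eigenvectorBasis.repr t r) ^ 2 := by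
  set b := hC.isHermitian.eigenvectorBasis with hb
  have h1 : (t : Fin d → ℝ) ⬝ᵥ C.mulVec t = inner ℝ t (WithLp.toLp 2 (C.mulVec t)) := by
    simp [PiLp.inner_apply, dotProduct, mul_comm]
  rw [h1, ← b.sum_inner_mul_inner]
  refine Finset.sum_congr rfl fun r _ => ?_
  have h2 : inner ℝ (b r) (WithLp.toLp 2 (C.mulVec t)) =
      hC.isHermitian.eigenvalues r * inner ℝ (b r) t := by
    have h3 : inner ℝ (b r) (WithLp.toLp 2 (C.mulVec t)) = (b r : Fin d → ℝ) ⬝ᵥ C.mulVec t := by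
      simp [PiLp.inner_apply, dotProduct, mul_comm]
    have h4 : C.transpose = C := by
      have := hC.isHermitian
      rwa [Matrix.IsHermitian, Matrix.conjTranspose_eq_transpose_of_trivial] at this
    rw [h3, Matrix.dotProduct_mulVec, ← Matrix.mulVec_transpose, h4, hb,
      hC.isHermitian.mulVec_eigenvectorBasis]
    simp only [PiLp.inner_apply, dotProduct, RCLike.inner_apply, conj_trivial, Pi.smul_apply,
      smul_eq_mul, Finset.mul_sum]
    exact Finset.sum_congr rfl fun i _ => by ring
  rw [h2, b.repr_apply_apply, real_inner_comm]
  ring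

/-- `V` is the rotation to an eigenbasis. It carries the diagonal Gaussian to the data law, by
characteristic functions, and also preserves Lebesgue measure and distances. -/
lemma exists_diagonalization (hC : C.PosDef) :
    ∃ V : (Fin d → ℝ) ≃ᵐ EuclideanSpace ℝ (Fin d),
      MeasurePreserving V (diagGaussian (eigVar hC)) (gaussianLaw C) ∧
      MeasurePreserving V volume volume ∧
      ∀ x y, ‖V x - V y‖ ^ 2 = ∑ r, (x r - y r) ^ 2 := by
  set b := hC.isHermitian.eigenvectorBasis with hb
  set V := (MeasurableEquiv.toLp 2 (Fin d → ℝ)).trans b.repr.symm.toMeasurableEquiv with hV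
  have hVx : ∀ x, V x = b.repr.symm (WithLp.toLp 2 x) := fun x => rfl
  refine ⟨V, ⟨V.measurable, ?_⟩, ?_, fun x y => ?_⟩
  · have : IsProbabilityMeasure ((diagGaussian (eigVar hC)).map V) :=
      Measure.isProbabilityMeasure_map V.measurable.aemeasurable
    refine Measure.ext_of_charFun (funext fun t => ?_)
    rw [gaussianLaw, charFun_multivariateGaussian hC.posSemidef, dotProduct_mulVec_eq_sum hC]
    have h1 : charFun ((diagGaussian (eigVar hC)).map V) t =
        charFun ((diagGaussian (eigVar hC)).map (WithLp.toLp 2)) (b.repr t) := by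
      rw [charFun, charFun, integral_map_equiv, integral_map (by fun_prop) (by fun_prop)]
      refine integral_congr_ae (ae_of_all _ fun x => ?_)
      simp only [hVx]
      rw [← b.repr.inner_map_map, LinearIsometryEquiv.apply_symm_apply]
    rw [h1, diagGaussian, charFun_pi]
    simp only [charFun_gaussianReal, inner_zero_right]
    rw [← Complex.exp_sum]
    congr 1
    push_cast
    rw [Finset.sum_div, zero_mul, zero_sub, ← Finset.sum_neg_distrib]
    refine Finset.sum_congr rfl fun r _ => ?_
    rw [← coe_eigVar hC r]
    ring
  · exact (LinearIsometryEquiv.measurePreserving b.repr.symm).comp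
      (PiLp.volume_preserving_toLp (Fin d))
  · rw [hVx, hVx, ← map_sub, LinearIsometryEquiv.norm_map, EuclideanSpace.norm_sq_eq]
    simp

/-- The tilted law has total mass one, so the exponent of its normalization is minus the logarithm
of the wanted Gaussian integral. -/
lemma annealed_gaussianLaw (hC : C.PosDef) (hd : 0 < d) {t : ℝ} (ht : 0 < t)
    {V : (Fin d → ℝ) ≃ᵐ EuclideanSpace ℝ (Fin d)}
    (hV : MeasurePreserving V (diagGaussian (eigVar hC)) (gaussianLaw C))
    (hVn : ∀ x y, ‖V x - V y‖ ^ 2 = ∑ r, (x r - y r) ^ 2) (x : Fin d → ℝ) :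
    annealed 1 1 t (gaussianLaw C) (V x) = -(1 / d * tiltExponent (eigVar hC) t x) := by
  have hd' : (d : ℝ) ≠ 0 := Nat.cast_ne_zero.2 hd.ne'
  have h1 := congrArg (fun μ => μ Set.univ) (diagGaussian_tilt (eigVar_ne_zero hC) ht x)
  rw [withDensity_apply _ MeasurableSet.univ, Measure.map_apply (by fun_prop) MeasurableSet.univ,
    Set.preimage_univ, measure_univ, Measure.restrict_univ] at h1
  have h2 : ∫ y, Real.exp (tiltExponent (eigVar hC) t x - t / 2 * ∑ r, (x r - y r) ^ 2)
      ∂(diagGaussian (eigVar hC)) = 1 := by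
    rw [integral_eq_lintegral_of_nonneg_ae (ae_of_all _ fun y => (Real.exp_pos _).le)
      (Measurable.aestronglyMeasurable (by fun_prop)), h1, ENNReal.toReal_one]
  simp only [sub_eq_add_neg, Real.exp_add] at h2
  rw [integral_const_mul] at h2
  have h3 : ∫ y, Real.exp (-(d * (t * energy 1 1 (V x - y)))) ∂(gaussianLaw C) =
      Real.exp (-tiltExponent (eigVar hC) t x) := by
    rw [← hV.integral_comp', Real.exp_neg, ← eq_inv_of_mul_eq_one_right h2]
    refine integral_congr_ae (ae_of_all _ fun y => ?_)
    simp only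
    rw [energy_one_one, hVn]
    congr 2
    field_simp
    simp [sub_eq_add_neg]
  rw [annealed, h3, Real.log_exp]
  ring

lemma integral_tiltExponent (v : Fin d → NNReal) (t : ℝ) :
    Integrable (tiltExponent v t) (diagGaussian v) ∧
    ∫ x, tiltExponent v t x ∂(diagGaussian v) =
      ∑ r, (1 / 2 * Real.log (1 + t * v r) + t * v r / (2 * (1 + t * v r))) := by
  have h : ∀ r, Integrable (fun x : Fin d → ℝ => 1 / 2 * Real.log (1 + t * v r) +
      t / (2 * (1 + t * v r)) * x r ^ 2) (diagGaussian v) := fun r =>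
    (integrable_const _).add ((integrable_sq_eval_diagGaussian v r).const_mul _)
  have he : tiltExponent v t = fun x => ∑ r, (1 / 2 * Real.log (1 + t * v r) +
      t / (2 * (1 + t * v r)) * x r ^ 2) := by
    ext x
    exact Finset.sum_congr rfl fun r _ => by ring
  rw [he]
  refine ⟨integrable_finsetSum _ fun r _ => h r, ?_⟩
  rw [integral_finsetSum _ fun r _ => h r]
  refine Finset.sum_congr rfl fun r _ => ?_
  rw [integral_add (integrable_const _) ((integrable_sq_eval_diagGaussian v r).const_mul _),
    integral_const, integral_const_mul, integral_sq_eval_diagGaussian]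
  simp
  ring

/-! ### Ball masses by tilting -/

/-- The variances of a displacement from a Gaussian point to a point of its tilted law. -/
def gapVar (v : Fin d → NNReal) (t : ℝ) (r : Fin d) : NNReal :=
  (v r / (1 + t * v r) + v r / (1 + t * v r) ^ 2 : ℝ).toNNReal

lemma coe_gapVar (v : Fin d → NNReal) {t : ℝ} (ht : 0 < t) (r : Fin d) :
    (gapVar v t r : ℝ) = v r / (1 + t * v r) + v r / (1 + t * v r) ^ 2 := by
  rw [gapVar, Real.coe_toNNReal _ (by positivity)]

/-- Lower bound for Gaussian ball masses, in finite dimension. -/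
lemma diagGaussian_ball_bad_le {v : Fin d → NNReal} (hv : ∀ r, v r ≠ 0) (hd : 0 < d) {t A L ε : ℝ}
    (ht : 0 < t) (hε : 0 < ε)
    (hA : ∑ r, (1 / 2 * Real.log (1 + t * v r) + t * v r / (2 * (1 + t * v r))) ≤ d * (A + ε / 8))
    (hL : |∑ r, (gapVar v t r : ℝ) - d * L| ≤ d * (min ε (ε / t) / 2))
    (hd2 : Real.log 2 ≤ d * (ε / 4)) :
    (diagGaussian v).real {x | (diagGaussian v).real {y | (∑ r, (x r - y r) ^ 2) / d ≤ L + ε} <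
      Real.exp (-(d * (A - t * L / 2 + ε)))} ≤
    gaussMoment 2 / d * (1 / (4 * (ε / 8) ^ 2) + 8 / t ^ 2 / (min ε (ε / t) / 2) ^ 2) := by
  have hd' : (0 : ℝ) < d := Nat.cast_pos.2 hd
  have hv' : ∀ r, (0 : ℝ) < v r := fun r => NNReal.coe_pos.2 (pos_iff_ne_zero.2 (hv r))
  -- Two constraints on the window: `η ≤ ε` keeps the good set inside the ball, and `tη ≤ ε` bounds
  -- the cost of the change of measure.
  set η := min ε (ε / t) with hη
  have hη0 : 0 < η := lt_min hε (by positivity)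
  have hη1 : η ≤ ε := min_le_left _ _
  have hη2 : t * η ≤ ε := by
    have := mul_le_mul_of_nonneg_left (min_le_right ε (ε / t)) ht.le
    rwa [mul_div_cancel₀ _ ht.ne'] at this
  set good : (Fin d → ℝ) → Set (Fin d → ℝ) := fun x =>
    {y | |∑ r, (x r - y r) ^ 2 - d * L| < d * η} with hgood
  have hgm : ∀ x, MeasurableSet (good x) := fun x =>
    measurableSet_lt (by fun_prop) measurable_const
  set Q : (Fin d → ℝ) → Measure (Fin d → ℝ) := fun x => (diagGaussian (tiltVar v t)).map
    fun w r => t * v r * x r / (1 + t * v r) - w r with hQ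
  have hQp : ∀ x, IsProbabilityMeasure (Q x) := fun x =>
    Measure.isProbabilityMeasure_map (Measurable.aemeasurable (by fun_prop))
  -- the exceptional sets
  set E₁ : Set (Fin d → ℝ) := {x | d * (A + ε / 4) < tiltExponent v t x} with hE₁
  set E₂ : Set (Fin d → ℝ) := {x | 1 / 2 ≤ (Q x).real (good x)ᶜ} with hE₂
  have hsub : {x | (diagGaussian v).real {y | (∑ r, (x r - y r) ^ 2) / d ≤ L + ε} <
      Real.exp (-(d * (A - t * L / 2 + ε)))} ⊆ E₁ ∪ E₂ := by
    intro x hx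
    by_contra hcon
    rw [Set.mem_union, not_or] at hcon
    have h1 : tiltExponent v t x ≤ d * (A + ε / 4) := not_lt.1 hcon.1
    have h2 : (Q x).real (good x)ᶜ < 1 / 2 := not_le.1 hcon.2
    rw [probReal_compl_eq_one_sub (hgm x)] at h2
    -- Change of measure: on `good x` the squared distance is at least `d(L - η)`, which bounds the
    -- density of `Q x` from above.
    have h3 : (Q x).real (good x) ≤ Real.exp (tiltExponent v t x - t / 2 * (d * (L - η))) *
        (diagGaussian v).real (good x) := by
      rw [measureReal_def, measureReal_def, hQ]
      simp only
      rw [← diagGaussian_tilt hv ht, withDensity_apply _ (hgm x)]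
      have h4 : ∫⁻ y in good x, ENNReal.ofReal (Real.exp
          (tiltExponent v t x - t / 2 * ∑ r, (x r - y r) ^ 2)) ∂(diagGaussian v) ≤
          ENNReal.ofReal (Real.exp (tiltExponent v t x - t / 2 * (d * (L - η)))) *
            (diagGaussian v) (good x) := by
        rw [← setLIntegral_const]
        refine setLIntegral_mono measurable_const fun y hy => ENNReal.ofReal_le_ofReal ?_
        have hy : |∑ r, (x r - y r) ^ 2 - d * L| < d * η := hy
        have h5 : d * (L - η) ≤ ∑ r, (x r - y r) ^ 2 := by
          have := (abs_lt.1 hy).1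
          linarith
        gcongr
      refine (ENNReal.toReal_mono (by finiteness) h4).trans (le_of_eq ?_)
      rw [ENNReal.toReal_mul, ENNReal.toReal_ofReal (Real.exp_pos _).le]
    have h6 : (diagGaussian v).real (good x) ≤
        (diagGaussian v).real {y | (∑ r, (x r - y r) ^ 2) / d ≤ L + ε} := by
      refine measureReal_mono fun y hy => ?_
      have hy : |∑ r, (x r - y r) ^ 2 - d * L| < d * η := hy
      have h7 := (abs_lt.1 hy).2
      have h8 : d * η ≤ d * ε := by gcongr
      simp only [Set.mem_ofPred_eq]
      rw [div_le_iff₀ hd']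
      linarith
    have hx : (diagGaussian v).real {y | (∑ r, (x r - y r) ^ 2) / d ≤ L + ε} <
      Real.exp (-(d * (A - t * L / 2 + ε))) := hx
    have h9 : 1 / 2 < Real.exp (tiltExponent v t x - t / 2 * (d * (L - η))) *
        Real.exp (-(d * (A - t * L / 2 + ε))) := by
      refine lt_of_lt_of_le (by linarith) (h3.trans ?_)
      gcongr
      exact h6.trans hx.le
    rw [← Real.exp_add] at h9
    -- Per dimension the exponent is at most `ε/4 + ε/2 - ε = -ε/4`, and `hd2` makes this at most
    -- `-log 2`.
    have h10 : Real.exp (tiltExponent v t x - t / 2 * (d * (L - η)) +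
        -(d * (A - t * L / 2 + ε))) ≤ Real.exp (-Real.log 2) := by
      rw [Real.exp_le_exp]
      have h11 : d * (t * η) ≤ d * ε := by gcongr
      nlinarith
    rw [Real.exp_neg, Real.exp_log two_pos] at h10
    linarith
  have hP₁ : (diagGaussian v).real E₁ ≤ gaussMoment 2 / d * (1 / (4 * (ε / 8) ^ 2)) := by
    have hch := diagGaussian_real_quadratic_le v (fun r => t / (2 * (1 + t * v r))) (B := 1 / 2)
      (ε := d * (ε / 8)) (by positivity) (fun r => by
        have := hv' r
        rw [abs_of_nonneg (by positivity), div_mul_eq_mul_div,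
          div_le_div_iff₀ (by positivity) two_pos]
        linarith)
    refine (measureReal_mono fun x hx => ?_).trans (hch.trans (le_of_eq ?_))
    · have hx : d * (A + ε / 4) < tiltExponent v t x := hx
      rw [Set.mem_ofPred_eq]
      refine le_trans ?_ (le_abs_self _)
      have h1 : tiltExponent v t x = ∑ r, 1 / 2 * Real.log (1 + t * v r) +
          ∑ r, t / (2 * (1 + t * v r)) * x r ^ 2 := by
        rw [← Finset.sum_add_distrib]
        exact Finset.sum_congr rfl fun r _ => by ring
      have h2 : ∑ r, (1 / 2 * Real.log (1 + t * v r) + t * v r / (2 * (1 + t * v r))) =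
          ∑ r, 1 / 2 * Real.log (1 + t * v r) + ∑ r, t / (2 * (1 + t * v r)) * v r := by
        rw [← Finset.sum_add_distrib]
        exact Finset.sum_congr rfl fun r _ => by ring
      rw [h1] at hx
      rw [h2] at hA
      linarith
    · field_simp
      ring
  have hP₂ : (diagGaussian v).real E₂ ≤ gaussMoment 2 / d * (8 / t ^ 2 / (η / 2) ^ 2) := by
    set κ : Fin d → ℝ := fun r => 1 / (1 + t * v r) with hκ
    set T : Set ((Fin d → ℝ) × (Fin d → ℝ)) :=
      {z | d * η ≤ |∑ r, (κ r * z.1 r + z.2 r) ^ 2 - d * L|} with hT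
    have hTm : MeasurableSet T := measurableSet_le measurable_const (by fun_prop)
    have hfib : ∀ x, (Q x) (good x)ᶜ = diagGaussian (tiltVar v t) (Prod.mk x ⁻¹' T) := fun x => by
      rw [hQ]
      simp only
      rw [Measure.map_apply (by fun_prop) (hgm x).compl]
      congr 1
      ext w
      have h1 : ∀ r, x r - (t * v r * x r / (1 + t * v r) - w r) = κ r * x r + w r := fun r => by
        have := hv' r
        rw [hκ]
        field_simp
        ring
      simp [hgood, hT, h1]
    have hlaw := diagGaussian_prod_map_add (v := v) (b := tiltVar v t) (a := gapVar v t) (κ := κ)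
      fun r => by
        have := hv' r
        rw [coe_gapVar v ht, coe_tiltVar v ht, hκ]
        field_simp
        ring
    -- Averaged over `x`, the displacement is a centered Gaussian with variances `gapVar`, each at
    -- most `2/t`. Chebyshev controls this joint law, and Markov then controls the set of `x` whose
    -- conditional failure probability is at least one half.
    have hTmeas : ((diagGaussian v).prod (diagGaussian (tiltVar v t))) T =
        diagGaussian (gapVar v t) {z | d * η ≤ |∑ r, z r ^ 2 - d * L|} := by
      rw [← hlaw, Measure.map_apply (by fun_prop) (measurableSet_le measurable_const (by fun_prop))]
      rfl
    have hch := diagGaussian_real_quadratic_le (gapVar v t) (fun _ => 1) (B := 2 / t)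
      (ε := d * (η / 2)) (by positivity) (fun r => by
        have := hv' r
        rw [one_mul, abs_of_nonneg (NNReal.coe_nonneg _), coe_gapVar v ht]
        have h1 : v r / (1 + t * v r) ≤ 1 / t := by
          rw [div_le_div_iff₀ (by positivity) ht]
          linarith
        have h2 : v r / (1 + t * v r) ^ 2 ≤ v r / (1 + t * v r) := by
          gcongr
          exact le_self_pow₀ (by nlinarith) two_ne_zero
        have h3 : 2 / t = 1 / t + 1 / t := by ring
        linarith)
    have hle : (diagGaussian (gapVar v t)).real {z | d * η ≤ |∑ r, z r ^ 2 - d * L|} ≤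
        d * ((2 / t) ^ 2 * gaussMoment 2) / (d * (η / 2)) ^ 2 := by
      refine (measureReal_mono fun z hz => ?_).trans hch
      have hz : d * η ≤ |∑ r, z r ^ 2 - d * L| := hz
      simp only [Set.mem_ofPred_eq, one_mul]
      have h1 := abs_sub_le (∑ r, z r ^ 2) (∑ r, (gapVar v t r : ℝ)) (d * L)
      linarith
    have hmark : (diagGaussian v) E₂ ≤ (2 : ℝ≥0∞) *
        diagGaussian (gapVar v t) {z | d * η ≤ |∑ r, z r ^ 2 - d * L|} := by
      rw [← hTmeas, Measure.prod_apply hTm]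
      have hm := mul_meas_ge_le_lintegral (μ := diagGaussian v)
        (measurable_measure_prodMk_left (ν := diagGaussian (tiltVar v t)) hTm) (2⁻¹ : ℝ≥0∞)
      have h1 : E₂ ⊆ {x | 2⁻¹ ≤ diagGaussian (tiltVar v t) (Prod.mk x ⁻¹' T)} := by
        intro x hx
        have hx : 1 / 2 ≤ (Q x).real (good x)ᶜ := hx
        rw [measureReal_def, hfib x] at hx
        have := ENNReal.ofReal_le_of_le_toReal hx
        rw [Set.mem_ofPred_eq]
        refine le_trans (le_of_eq ?_) this
        rw [one_div, ENNReal.ofReal_inv_of_pos two_pos]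
        simp
      have h2 := mul_le_mul_right (measure_mono (μ := diagGaussian v) h1) (2⁻¹ : ℝ≥0∞)
      have h3 := mul_le_mul_right (h2.trans hm) (2 : ℝ≥0∞)
      rwa [← mul_assoc, ENNReal.mul_inv_cancel two_ne_zero ENNReal.ofNat_ne_top, one_mul] at h3
    have hreal : (diagGaussian v).real E₂ ≤
        2 * (diagGaussian (gapVar v t)).real {z | d * η ≤ |∑ r, z r ^ 2 - d * L|} := by
      have := ENNReal.toReal_mono (by finiteness) hmark
      rwa [ENNReal.toReal_mul] at this
    refine hreal.trans ((mul_le_mul_of_nonneg_left hle zero_le_two).trans (le_of_eq ?_))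
    field_simp
    ring
  refine (measureReal_mono hsub).trans ((measureReal_union_le _ _).trans ?_)
  rw [mul_add]
  exact add_le_add hP₁ hP₂

end Diagonalization

/-! ### Spectral averages and the limits for Gaussian data -/

section GaussianLimits

variable {C : ∀ d : ℕ, Matrix (Fin d) (Fin d) ℝ} {hC : ∀ d, (C d).PosDef} {ρC : Measure ℝ}

/-- Weak convergence requires test functions that are continuous and bounded on all of `ℝ`, so `φ`
is extended by `φ (max c 0)`; eigenvalues are positive and `ρC` charges only `(0, ∞)`. -/
lemma SpectralLimit.tendsto_avg (hρC : SpectralLimit C hC ρC) (hpos : ∀ᵐ c ∂ρC, 0 < c)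
    {φ : ℝ → ℝ} (hφ : Continuous fun c => φ (max c 0)) {B : ℝ} (hB : ∀ c, 0 ≤ c → |φ c| ≤ B) :
    Tendsto (fun d : ℕ => 1 / (d : ℝ) * ∑ r, φ (eigVar (hC d) r)) atTop (𝓝 (∫ c, φ c ∂ρC)) := by
  have h := hρC (BoundedContinuousFunction.ofNormedAddCommGroup _ hφ B
    fun c => hB _ (le_max_right _ _))
  simp only [BoundedContinuousFunction.coe_ofNormedAddCommGroup] at h
  have h1 : ∫ c, φ (max c 0) ∂ρC = ∫ c, φ c ∂ρC := by
    refine integral_congr_ae ?_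
    filter_upwards [hpos] with c hc
    rw [max_eq_left hc.le]
  rw [h1] at h
  refine h.congr fun d => ?_
  simp only [coe_eigVar, max_eq_left ((hC d).eigenvalues_pos _).le]

lemma SpectralLimit.tendsto_gapVar (hρC : SpectralLimit C hC ρC) (hpos : ∀ᵐ c ∂ρC, 0 < c) {t : ℝ}
    (ht : 0 < t) :
    Tendsto (fun d : ℕ => 1 / (d : ℝ) * ∑ r, (gapVar (eigVar (hC d)) t r : ℝ)) atTop
      (𝓝 (spectralL ρC t)) := by
  have h := hρC.tendsto_avg hpos (φ := fun c => c / (1 + t * c) + c / (1 + t * c) ^ 2)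
    (B := 1 / t) (by
      have : ∀ c : ℝ, 1 + t * max c 0 ≠ 0 := fun c => by
        have : 0 ≤ max c 0 := le_max_right _ _
        positivity
      exact Continuous.add (Continuous.div₀ (by fun_prop) (by fun_prop) this)
        (Continuous.div₀ (by fun_prop) (by fun_prop) fun c => pow_ne_zero 2 (this c)))
    (fun c hc => by
      rcases hc.eq_or_lt with rfl | hc
      · simp [ht.le]
      · have := spectralL_integrand_bounds hc ht
        rw [abs_of_pos this.1]
        exact this.2.le)
  simp only [coe_gapVar _ ht]
  exact h

variable [IsProbabilityMeasure ρC]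

lemma sum_eigVar (d : ℕ) : ∑ r, (eigVar (hC d) r : ℝ) = (C d).trace := by
  rw [(hC d).isHermitian.trace_eq_sum_eigenvalues]
  simp [coe_eigVar]

/-- When `log y > K`, use `log y ≤ 2√y ≤ K + y/K`. Truncating the logarithm at `K` thus costs at
most trace over `K`, which makes up for its unboundedness under weak convergence. -/
lemma log_le_min_add {y K : ℝ} (hy : 0 < y) (hK : 0 < K) :
    Real.log y ≤ min (Real.log y) K + y / K := by
  rcases le_total (Real.log y) K with h | h
  · rw [min_eq_left h]
    have : 0 < y / K := by positivity
    linarith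
  · rw [min_eq_right h]
    have h1 : Real.log y = 2 * Real.log (√y) := by rw [Real.log_sqrt hy.le]; ring
    have h2 := Real.log_le_sub_one_of_pos (Real.sqrt_pos.2 hy)
    have h3 := Real.sq_sqrt hy.le
    have h4 : K + y / K - 2 * √y = (K - √y) ^ 2 / K := by
      field_simp
      nlinarith
    have h5 : 0 ≤ (K - √y) ^ 2 / K := by positivity
    linarith

lemma SpectralLimit.tendsto_avg_log (hρC : SpectralLimit C hC ρC) (hpos : ∀ᵐ c ∂ρC, 0 < c)
    (hlog : Integrable Real.log ρC) (htrace : ∃ M : ℝ, ∀ d : ℕ, (C d).trace ≤ M * d) {t : ℝ}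
    (ht : 0 < t) :
    Tendsto (fun d : ℕ => 1 / (d : ℝ) * ∑ r, Real.log (1 + eigVar (hC d) r * t)) atTop
      (𝓝 (∫ c, Real.log (1 + c * t) ∂ρC)) := by
  obtain ⟨M, hM⟩ := htrace
  rw [Metric.tendsto_nhds]
  intro ε hε
  have hI := integrable_log_one_add hpos hlog ht
  have hdom : Tendsto (fun K : ℝ => ∫ c, min (Real.log (1 + c * t)) K ∂ρC) atTop
      (𝓝 (∫ c, Real.log (1 + c * t) ∂ρC)) := by
    refine tendsto_integral_filter_of_dominated_convergence (fun c => |Real.log (1 + c * t)|)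
      (.of_forall fun K => Measurable.aestronglyMeasurable (by fun_prop)) ?_ hI.abs ?_
    · filter_upwards [eventually_ge_atTop 0] with K hK
      filter_upwards [hpos] with c hc
      have := Real.log_nonneg (show 1 ≤ 1 + c * t by nlinarith)
      rw [Real.norm_of_nonneg (le_min this hK)]
      exact (min_le_left _ _).trans (le_abs_self _)
    · refine ae_of_all _ fun c => tendsto_const_nhds.congr' ?_
      filter_upwards [eventually_ge_atTop (Real.log (1 + c * t))] with K hK
      rw [min_eq_left hK]
  have hK2 : Tendsto (fun K : ℝ => (1 + t * |M|) / K) atTop (𝓝 0) :=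
    tendsto_const_nhds.div_atTop tendsto_id
  obtain ⟨K, hK1, hKε, hK0⟩ := ((hdom.eventually (Metric.ball_mem_nhds _ (show 0 < ε / 3 by
    positivity))).and ((hK2.eventually (gt_mem_nhds (show 0 < ε / 3 by positivity))).and
    (eventually_gt_atTop 0))).exists
  have havg := hρC.tendsto_avg hpos (φ := fun c => min (Real.log (1 + c * t)) K) (B := K) (by
    refine Continuous.min (Continuous.log (by fun_prop) fun c => ?_) continuous_const
    have : 0 ≤ max c 0 * t := mul_nonneg (le_max_right _ _) ht.le
    positivity) (fun c hc => by
    have := Real.log_nonneg (show 1 ≤ 1 + c * t by nlinarith)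
    rw [abs_of_nonneg (le_min this hK0.le)]
    exact min_le_right _ _)
  filter_upwards [havg.eventually (Metric.ball_mem_nhds _ (show 0 < ε / 3 by positivity)),
    eventually_gt_atTop 0] with d hd hd0
  have hd' : (0 : ℝ) < d := Nat.cast_pos.2 hd0
  have h1 : 1 / (d : ℝ) * ∑ r, min (Real.log (1 + eigVar (hC d) r * t)) K ≤
      1 / (d : ℝ) * ∑ r, Real.log (1 + eigVar (hC d) r * t) := by
    gcongr with r
    exact min_le_left _ _
  have h2 : 1 / (d : ℝ) * ∑ r, Real.log (1 + eigVar (hC d) r * t) ≤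
      1 / (d : ℝ) * ∑ r, min (Real.log (1 + eigVar (hC d) r * t)) K + (1 + t * |M|) / K := by
    have h3 : ∑ r, Real.log (1 + eigVar (hC d) r * t) ≤
        ∑ r, (min (Real.log (1 + eigVar (hC d) r * t)) K + (1 + eigVar (hC d) r * t) / K) :=
      Finset.sum_le_sum fun r _ => log_le_min_add (by positivity) hK0
    rw [Finset.sum_add_distrib, ← Finset.sum_div, Finset.sum_add_distrib, ← Finset.sum_mul,
      sum_eigVar] at h3
    simp only [Finset.sum_const, Finset.card_univ, Fintype.card_fin, nsmul_eq_mul, mul_one] at h3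
    have h4 : (C d).trace ≤ |M| * d := (hM d).trans (by gcongr; exact le_abs_self M)
    have h5 : (d + (C d).trace * t) / K ≤ d * ((1 + t * |M|) / K) := by
      rw [mul_div_assoc']
      gcongr
      nlinarith
    have h6 := mul_le_mul_of_nonneg_left (h3.trans (add_le_add_right h5 _))
      (show 0 ≤ 1 / (d : ℝ) by positivity)
    refine h6.trans (le_of_eq ?_)
    rw [mul_add, ← mul_assoc, one_div_mul_cancel hd'.ne', one_mul]
  rw [Real.dist_eq, abs_lt] at hd hK1
  rw [Real.dist_eq, abs_lt]
  constructor <;> linarith [hd.1, hd.2, hK1.1, hK1.2]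

lemma SpectralLimit.tendsto_tiltExponent (hρC : SpectralLimit C hC ρC) (hpos : ∀ᵐ c ∂ρC, 0 < c)
    (hlog : Integrable Real.log ρC) (htrace : ∃ M : ℝ, ∀ d : ℕ, (C d).trace ≤ M * d) {t : ℝ}
    (ht : 0 < t) :
    Tendsto (fun d : ℕ => 1 / (d : ℝ) * ∑ r, (1 / 2 * Real.log (1 + t * eigVar (hC d) r) +
      t * eigVar (hC d) r / (2 * (1 + t * eigVar (hC d) r)))) atTop
      (𝓝 (spectralEntropy ρC t + t * spectralL ρC t / 2)) := by
  have h1 := hρC.tendsto_avg_log hpos hlog htrace ht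
  have h2 := hρC.tendsto_avg hpos (φ := fun c => t * c / (2 * (1 + t * c))) (B := 1) (by
      have : ∀ c : ℝ, 2 * (1 + t * max c 0) ≠ 0 := fun c => by
        have : 0 ≤ max c 0 := le_max_right _ _
        positivity
      exact Continuous.div₀ (by fun_prop) (by fun_prop) this)
    (fun c hc => by
      have h : 0 ≤ t * c := by positivity
      rw [abs_of_nonneg (by positivity), div_le_one (by positivity)]
      linarith)
  have h3 := (h1.const_mul (1 / 2)).add h2
  have hi1 := integrable_log_one_add hpos hlog ht
  have hi2 := integrable_div_one_add_sq (ρC := ρC) hpos ht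
  have hi3 := integrable_spectralL (ρC := ρC) hpos ht
  -- The term `λt/(1 + λt)²` of `S` cancels the second half of `tL`.
  have h4 : spectralEntropy ρC t + t * spectralL ρC t / 2 =
      1 / 2 * ∫ c, Real.log (1 + c * t) ∂ρC + ∫ c, t * c / (2 * (1 + t * c)) ∂ρC := by
    have h5 : t * spectralL ρC t / 2 =
        ∫ c, t / 2 * (c / (1 + t * c) + c / (1 + t * c) ^ 2) ∂ρC := by
      rw [integral_const_mul, spectralL]; ring
    have h6 : ∫ c, t * c / (2 * (1 + t * c)) ∂ρC =
        ∫ c, (t / 2 * (c / (1 + t * c) + c / (1 + t * c) ^ 2) -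
          1 / 2 * (c * t / (1 + c * t) ^ 2)) ∂ρC := by
      refine integral_congr_ae ?_
      filter_upwards [hpos] with c hc
      have : 1 + t * c ≠ 0 := by positivity
      rw [mul_comm c t]
      field_simp
      ring
    rw [h6, integral_sub (hi3.const_mul _) (hi2.const_mul _), h5, spectralEntropy,
      integral_sub hi1 hi2, integral_const_mul (1 / 2)]
    ring
  rw [h4]
  refine h3.congr fun d => ?_
  rw [← mul_assoc, mul_comm (1 / 2 : ℝ), mul_assoc, ← mul_add, Finset.mul_sum,
    ← Finset.sum_add_distrib]
  simp only [mul_comm t]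

/-- The limit of the annealed free energy of the quadratic energy. -/
lemma SpectralLimit.tendsto_annealed_one (hρC : SpectralLimit C hC ρC) (hpos : ∀ᵐ c ∂ρC, 0 < c)
    (hlog : Integrable Real.log ρC) (htrace : ∃ M : ℝ, ∀ d : ℕ, (C d).trace ≤ M * d) {t : ℝ}
    (ht : 0 < t) :
    Tendsto (fun d => ∫ x, annealed 1 1 t (gaussianLaw (C d)) x ∂(gaussianLaw (C d))) atTop
      (𝓝 (-(spectralEntropy ρC t + t * spectralL ρC t / 2))) := by
  refine (hρC.tendsto_tiltExponent hpos hlog htrace ht).neg.congr' ?_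
  filter_upwards [eventually_gt_atTop 0] with d hd
  obtain ⟨V, hV, -, hVn⟩ := exists_diagonalization (hC d)
  rw [← hV.integral_comp']
  simp only [annealed_gaussianLaw (hC d) hd ht hV hVn]
  rw [integral_neg, integral_const_mul, (integral_tiltExponent _ t).2]

/-- The tilt exponent concentrates at `dA`, and the tilt weight at squared distance `dL` gives back
`tdL/2`; the mass exponent is `A - tL/2 = S`. -/
lemma SpectralLimit.ballMassLimit (hρC : SpectralLimit C hC ρC) (hpos : ∀ᵐ c ∂ρC, 0 < c)
    (hlog : Integrable Real.log ρC) (htrace : ∃ M : ℝ, ∀ d : ℕ, (C d).trace ≤ M * d) {t : ℝ}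
    (ht : 0 < t) :
    BallMassLimit (fun d => gaussianLaw (C d)) (spectralEntropy ρC t) (spectralL ρC t) := by
  intro ε hε
  set A := spectralEntropy ρC t + t * spectralL ρC t / 2 with hA
  have hη : 0 < min ε (ε / t) / 2 := by positivity
  have h1 := (hρC.tendsto_tiltExponent hpos hlog htrace ht).eventually
    (gt_mem_nhds (show A < A + ε / 8 by linarith))
  have h2 := (hρC.tendsto_gapVar hpos ht).eventually (Metric.closedBall_mem_nhds _ hη)
  have h3 : ∀ᶠ d : ℕ in atTop, Real.log 2 ≤ d * (ε / 4) :=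
    (tendsto_natCast_atTop_atTop.atTop_mul_const (show 0 < ε / 4 by positivity)).eventually_ge_atTop _
  have hlim : Tendsto (fun d : ℕ => gaussMoment 2 / (d : ℝ) * (1 / (4 * (ε / 8) ^ 2) +
      8 / t ^ 2 / (min ε (ε / t) / 2) ^ 2)) atTop (𝓝 0) := by
    have := (tendsto_const_div_atTop_nhds_zero_nat (gaussMoment 2)).mul_const
      (1 / (4 * (ε / 8) ^ 2) + 8 / t ^ 2 / (min ε (ε / t) / 2) ^ 2)
    rwa [zero_mul] at this
  refine squeeze_zero' (.of_forall fun d => measureReal_nonneg) ?_ hlim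
  filter_upwards [h1, h2, h3, eventually_gt_atTop 0] with d h1 h2 h3 hd
  have hd' : (0 : ℝ) < d := Nat.cast_pos.2 hd
  obtain ⟨V, hV, -, hVn⟩ := exists_diagonalization (hC d)
  have hVr : ∀ s, (gaussianLaw (C d)).real s = (diagGaussian (eigVar (hC d))).real (V ⁻¹' s) :=
    fun s => by rw [measureReal_def, measureReal_def, hV.measure_preimage_equiv]
  have key := diagGaussian_ball_bad_le (eigVar_ne_zero (hC d)) hd (A := A)
    (L := spectralL ρC t) ht hε (by
      rw [one_div_mul_eq_div, div_lt_iff₀ hd'] at h1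
      linarith) (by
      rw [Real.dist_eq] at h2
      have h4 : ∑ r, (gapVar (eigVar (hC d)) t r : ℝ) - d * spectralL ρC t =
          d * (1 / (d : ℝ) * ∑ r, (gapVar (eigVar (hC d)) t r : ℝ) - spectralL ρC t) := by
        field_simp
      rw [h4, abs_mul, abs_of_pos hd']
      gcongr) h3
  refine le_trans (le_of_eq ?_) key
  rw [hVr]
  congr 1
  ext x
  simp only [Set.mem_preimage, Set.mem_ofPred_eq, hVr]
  have h5 : A - t * spectralL ρC t / 2 + ε = spectralEntropy ρC t + ε := by rw [hA]; ring
  rw [h5]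
  simp only [Set.preimage_ofPred_eq, hVn]

lemma momentBounds_gaussianLaw (hC : ∀ d, (C d).PosDef)
    (htrace : ∃ M : ℝ, ∀ d : ℕ, (C d).trace ≤ M * d) :
    MomentBounds fun d => gaussianLaw (C d) := by
  obtain ⟨M, hM⟩ := htrace
  intro p
  -- The extra `1` covers dimension `0`, where the normalized norm is `0` by convention and `0 ^ 0 =
  -- 1`.
  refine ⟨gaussMoment p * (2 * |M|) ^ p + 1, fun d => ?_⟩
  have hg := gaussMoment_nonneg p
  rcases Nat.eq_zero_or_pos d with rfl | hd
  · have h0 : ∀ z : EuclideanSpace ℝ (Fin 0) × EuclideanSpace ℝ (Fin 0),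
        (‖z.1 - z.2‖ ^ 2 / ((0 : ℕ) : ℝ)) ^ p = 0 ^ p := fun z => by simp
    simp only [h0]
    refine ⟨integrable_const _, ?_⟩
    simp only [integral_const, probReal_univ, one_smul]
    have h1 : (0 : ℝ) ^ p ≤ 1 := pow_le_one₀ le_rfl zero_le_one
    have h2 : 0 ≤ gaussMoment p * (2 * |M|) ^ p := by positivity
    linarith
  have hd' : (0 : ℝ) < d := Nat.cast_pos.2 hd
  obtain ⟨V, hV, -, hVn⟩ := exists_diagonalization (hC d)
  set v := eigVar (hC d) with hv
  have hlaw := diagGaussian_prod_map_add (v := v) (b := v) (a := fun r => 2 * v r)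
    (κ := fun _ => -1) fun r => by push_cast; ring
  have hmp : MeasurePreserving
      (fun (z : (Fin d → ℝ) × (Fin d → ℝ)) (r : Fin d) => -1 * z.1 r + z.2 r)
      ((diagGaussian v).prod (diagGaussian v)) (diagGaussian fun r => 2 * v r) :=
    ⟨by fun_prop, hlaw⟩
  obtain ⟨hi, hb⟩ := diagGaussian_sum_sq_pow (v := fun r => 2 * v r)
    (fun r => mul_ne_zero two_ne_zero (eigVar_ne_zero (hC d) r)) hd p
  have hVV : MeasurePreserving (MeasurableEquiv.prodCongr V V)
      ((diagGaussian v).prod (diagGaussian v)) ((gaussianLaw (C d)).prod (gaussianLaw (C d))) :=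
    hV.prod hV
  have hfun : ∀ z : (Fin d → ℝ) × (Fin d → ℝ),
      (‖(MeasurableEquiv.prodCongr V V z).1 - (MeasurableEquiv.prodCongr V V z).2‖ ^ 2 / d) ^ p =
      1 / (d : ℝ) ^ p * (∑ r, (-1 * z.1 r + z.2 r) ^ 2) ^ p := fun z => by
    have h1 : ‖(MeasurableEquiv.prodCongr V V z).1 - (MeasurableEquiv.prodCongr V V z).2‖ ^ 2 =
        ∑ r, (-1 * z.1 r + z.2 r) ^ 2 :=
      (hVn z.1 z.2).trans (Finset.sum_congr rfl fun r _ => by ring)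
    rw [h1, div_pow]
    ring
  have hi2 : Integrable (fun z : (Fin d → ℝ) × (Fin d → ℝ) =>
      (∑ r, (-1 * z.1 r + z.2 r) ^ 2) ^ p) ((diagGaussian v).prod (diagGaussian v)) :=
    hmp.integrable_comp_of_integrable hi
  constructor
  · rw [← hVV.integrable_comp_emb (MeasurableEquiv.measurableEmbedding _)]
    exact (hi2.const_mul (1 / (d : ℝ) ^ p)).congr (ae_of_all _ fun z => (hfun z).symm)
  · rw [← hVV.integral_comp']
    simp only [hfun]
    rw [integral_const_mul]
    have h2 : ∫ z : (Fin d → ℝ) × (Fin d → ℝ), (∑ r, (-1 * z.1 r + z.2 r) ^ 2) ^ p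
        ∂((diagGaussian v).prod (diagGaussian v)) =
        ∫ z, (∑ r, z r ^ 2) ^ p ∂(diagGaussian fun r => 2 * v r) := by
      rw [← hlaw, integral_map hmp.measurable.aemeasurable
        (Measurable.aestronglyMeasurable (by fun_prop))]
    rw [h2]
    have h3 : ∑ r, ((2 * v r : NNReal) : ℝ) ≤ 2 * |M| * d := by
      push_cast
      rw [← Finset.mul_sum, hv, sum_eigVar]
      have h4 : (C d).trace ≤ |M| * d := (hM d).trans (by gcongr; exact le_abs_self M)
      linarith
    calc 1 / (d : ℝ) ^ p * ∫ z, (∑ r, z r ^ 2) ^ p ∂(diagGaussian fun r => 2 * v r)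
        ≤ 1 / (d : ℝ) ^ p * (gaussMoment p * (2 * |M| * d) ^ p) := by
          gcongr
          exact hb.trans (by gcongr)
      _ = gaussMoment p * (2 * |M|) ^ p := by
          rw [mul_pow _ (d : ℝ)]
          field_simp
      _ ≤ _ := by linarith

end GaussianLimits

/-! ### The normalization of the kernel -/

section Normalization

variable {γ : ℝ} {d : ℕ}

lemma kernelRate_ge_affine (hγ : 1 ≤ γ) {u : ℝ} (hu : 0 ≤ u) :
    1 / (2 * γ) + 1 / 2 * (u - 1) ≤ kernelRate γ u := by
  have := kernelRate_tangent hγ hu one_pos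
  simpa [kernelRate] using this

lemma integrable_exp_neg_sq_norm :
    Integrable fun x : EuclideanSpace ℝ (Fin d) => Real.exp (-(1 / 2) * ‖x‖ ^ 2) := by
  -- A non-integrable function would have integral `0` by convention, whereas the Gaussian formula
  -- gives a positive value.
  by_contra h
  have h1 := GaussianFourier.integral_rexp_neg_mul_sq_norm (V := EuclideanSpace ℝ (Fin d))
    (show (0 : ℝ) < 1 / 2 by norm_num)
  rw [integral_undef h] at h1
  have : 0 < (Real.pi / (1 / 2)) ^ (Module.finrank ℝ (EuclideanSpace ℝ (Fin d)) / 2 : ℝ) := by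
    have := Real.pi_pos
    positivity
  linarith

lemma exp_kernelRate_le (hγ : 1 ≤ γ) (hd : 0 < d) (x : EuclideanSpace ℝ (Fin d)) :
    Real.exp (-((d : ℝ) * kernelRate γ (‖x‖ ^ 2 / d))) ≤
      Real.exp (d * (1 / 2 - 1 / (2 * γ))) * Real.exp (-(1 / 2) * ‖x‖ ^ 2) := by
  have hd' : (0 : ℝ) < d := Nat.cast_pos.2 hd
  rw [← Real.exp_add, Real.exp_le_exp]
  have h1 := mul_le_mul_of_nonneg_left
    (kernelRate_ge_affine hγ (show 0 ≤ ‖x‖ ^ 2 / d by positivity)) hd'.le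
  have h2 : d * (1 / (2 * γ) + 1 / 2 * (‖x‖ ^ 2 / d - 1)) =
      -(d * (1 / 2 - 1 / (2 * γ)) + -(1 / 2) * ‖x‖ ^ 2) := by field_simp; ring
  linarith

lemma continuous_exp_kernelRate (hγ : 1 ≤ γ) : Continuous
    fun x : EuclideanSpace ℝ (Fin d) => Real.exp (-((d : ℝ) * kernelRate γ (‖x‖ ^ 2 / d))) := by
  have := continuous_kernelRate hγ
  fun_prop

lemma integrable_exp_kernelRate (hγ : 1 ≤ γ) (hd : 0 < d) : Integrable
    fun x : EuclideanSpace ℝ (Fin d) => Real.exp (-((d : ℝ) * kernelRate γ (‖x‖ ^ 2 / d))) := by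
  refine (integrable_exp_neg_sq_norm.const_mul (Real.exp (d * (1 / 2 - 1 / (2 * γ))))).mono'
    (continuous_exp_kernelRate hγ).aestronglyMeasurable (ae_of_all _ fun x => ?_)
  rw [Real.norm_of_nonneg (Real.exp_pos _).le]
  exact exp_kernelRate_le hγ hd x

lemma integral_exp_kernelRate_pos (hγ : 1 ≤ γ) (hd : 0 < d) :
    0 < ∫ x : EuclideanSpace ℝ (Fin d), Real.exp (-((d : ℝ) * kernelRate γ (‖x‖ ^ 2 / d))) :=
  integral_exp_pos (integrable_exp_kernelRate hγ hd)

lemma integrable_kernel (hγ : 1 ≤ γ) (hd : 0 < d) : Integrable (kernel γ d) := by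
  have h := (integrable_exp_kernelRate hγ hd).const_mul (Real.exp (d * kernelConst γ d))
  refine h.congr (ae_of_all _ fun x => ?_)
  simp only
  rw [kernel, ← Real.exp_add]
  ring_nf

lemma integral_kernel (hγ : 1 ≤ γ) (hd : 0 < d) : ∫ x, kernel γ d x = 1 := by
  have hd' : (d : ℝ) ≠ 0 := Nat.cast_ne_zero.2 hd.ne'
  have h1 : ∀ x, kernel γ d x = Real.exp (d * kernelConst γ d) *
      Real.exp (-((d : ℝ) * kernelRate γ (‖x‖ ^ 2 / d))) := fun x => by
    rw [kernel, ← Real.exp_add]; ring_nf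
  simp only [h1]
  rw [integral_const_mul, kernelConst]
  have h2 : (d : ℝ) * (-(1 / (d : ℝ)) * Real.log (∫ x : EuclideanSpace ℝ (Fin d),
      Real.exp (-((d : ℝ) * kernelRate γ (‖x‖ ^ 2 / d))))) = -Real.log (∫ x :
      EuclideanSpace ℝ (Fin d), Real.exp (-((d : ℝ) * kernelRate γ (‖x‖ ^ 2 / d)))) := by
    field_simp
  have h3 := integral_exp_kernelRate_pos (d := d) hγ hd
  rw [h2, Real.exp_neg, Real.exp_log h3, inv_mul_cancel₀ h3.ne']

/-- The tangent of `f` at `u = 1` dominates the kernel by a Gaussian, whose integral is explicit.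
The reverse bound below says that nothing is lost, because Gaussian mass sits at `|x|² ≈ d`. -/
lemma neg_kernelConst_le (hγ : 1 ≤ γ) (hd : 0 < d) :
    -kernelConst γ d ≤ 1 / 2 - 1 / (2 * γ) + 1 / 2 * Real.log (2 * Real.pi) := by
  have hd' : (0 : ℝ) < d := Nat.cast_pos.2 hd
  have hpi := Real.pi_pos
  have h1 := integral_mono (integrable_exp_kernelRate hγ hd)
    (integrable_exp_neg_sq_norm.const_mul (Real.exp (d * (1 / 2 - 1 / (2 * γ)))))
    (exp_kernelRate_le (d := d) hγ hd)
  rw [integral_const_mul, GaussianFourier.integral_rexp_neg_mul_sq_norm (by norm_num)] at h1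
  have h2 := Real.log_le_log (integral_exp_kernelRate_pos hγ hd) h1
  rw [Real.log_mul (Real.exp_pos _).ne' (by positivity), Real.log_exp,
    Real.log_rpow (by positivity), finrank_euclideanSpace_fin] at h2
  have h3 : Real.pi / (1 / 2) = 2 * Real.pi := by ring
  rw [h3] at h2
  rw [kernelConst, neg_mul, neg_neg, one_div_mul_eq_div, div_le_iff₀ hd']
  linarith

lemma le_neg_kernelConst (hγ : 1 ≤ γ) (hd : 0 < d) {ε : ℝ} (hε : 0 < ε)
    (hm : d * gaussMoment 2 / (d * ε) ^ 2 ≤ 1 / 2) :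
    1 / 2 * Real.log (2 * Real.pi) + (1 - ε) / 2 - kernelRate γ (1 + ε) - 1 / d * Real.log 2 ≤
      -kernelConst γ d := by
  have hd' : (0 : ℝ) < d := Nat.cast_pos.2 hd
  have hpi := Real.pi_pos
  set g : (Fin d → ℝ) → ℝ := fun x =>
    Real.exp (-((d : ℝ) * kernelRate γ ((∑ r, x r ^ 2) / d))) with hg
  have hgm : Measurable g := by
    have := (continuous_kernelRate hγ).measurable
    fun_prop
  have hmp := PiLp.volume_preserving_toLp (Fin d)
  have hI : ∫ x : EuclideanSpace ℝ (Fin d), Real.exp (-((d : ℝ) * kernelRate γ (‖x‖ ^ 2 / d))) =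
      ∫ x, g x := by
    rw [← hmp.integral_comp (MeasurableEquiv.toLp 2 (Fin d → ℝ)).measurableEmbedding]
    simp [hg, EuclideanSpace.norm_sq_eq]
  have hgi : Integrable g := by
    have h := (hmp.integrable_comp_emb
      (MeasurableEquiv.toLp 2 (Fin d → ℝ)).measurableEmbedding).2 (integrable_exp_kernelRate hγ hd)
    refine h.congr (ae_of_all _ fun x => ?_)
    simp [hg, EuclideanSpace.norm_sq_eq]
  set N := diagGaussian (fun _ : Fin d => (1 : NNReal)) with hN
  set ψ : (Fin d → ℝ) → ℝ := fun x =>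
    ∑ r, (1 / 2 * Real.log (2 * Real.pi * (1 : NNReal)) + x r ^ 2 / (2 * (1 : NNReal))) with hψ
  have hψm : Measurable ψ := by fun_prop
  have hψe : ∀ x, ψ x = d * (1 / 2 * Real.log (2 * Real.pi)) + (∑ r, x r ^ 2) / 2 := fun x => by
    simp [hψ, Finset.sum_add_distrib, Finset.sum_div]
  have hvol : N.withDensity (fun x => ENNReal.ofReal (Real.exp (ψ x))) = volume :=
    diagGaussian_withDensity_eq_volume fun _ => one_ne_zero
  have hI2 : ∫ x, g x = ∫ x, Real.exp (ψ x) * g x ∂N := by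
    rw [← hvol, integral_withDensity_eq_integral_toReal_smul (by fun_prop) (by simp)]
    refine integral_congr_ae (ae_of_all _ fun x => ?_)
    simp only [smul_eq_mul]
    rw [ENNReal.toReal_ofReal (Real.exp_pos _).le]
  have hgi2 : Integrable (fun x => Real.exp (ψ x) * g x) N := by
    rw [← hvol, integrable_withDensity_iff (by fun_prop) (by simp)] at hgi
    refine hgi.congr (ae_of_all _ fun x => ?_)
    simp only
    rw [ENNReal.toReal_ofReal (Real.exp_pos _).le, mul_comm]
  set B : Set (Fin d → ℝ) := {x | |∑ r, x r ^ 2 - d| < d * ε} with hB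
  have hBm : MeasurableSet B := measurableSet_lt (by fun_prop) measurable_const
  -- Chebyshev: under the standard Gaussian the shell `|x|² ≈ d` carries at least half of the mass.
  have hBp : 1 / 2 ≤ N.real B := by
    have hch := diagGaussian_real_quadratic_le (fun _ : Fin d => (1 : NNReal)) (fun _ => 1) (B := 1)
      (ε := d * ε) (by positivity) (by simp)
    have h1 : N.real Bᶜ ≤ 1 / 2 := by
      refine le_trans (le_of_eq ?_) (hch.trans (by simpa using hm))
      congr 1
      ext x
      simp [hB]
    rw [probReal_compl_eq_one_sub hBm] at h1
    linarith
  set b := Real.exp (d * (1 / 2 * Real.log (2 * Real.pi)) + d * (1 - ε) / 2 -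
    d * kernelRate γ (1 + ε)) with hb
  have hlow : b * N.real B ≤ ∫ x, Real.exp (ψ x) * g x ∂N := by
    have h1 : b * N.real B = ∫ x, B.indicator (fun _ => b) x ∂N := by
      rw [integral_indicator hBm]; simp [mul_comm]
    rw [h1]
    refine integral_mono ((integrable_const _).indicator hBm) hgi2 fun x => ?_
    by_cases hx : x ∈ B
    · rw [Set.indicator_of_mem hx]
      have hx : |∑ r, x r ^ 2 - d| < d * ε := hx
      have h2 := abs_lt.1 hx
      simp only [hg, hb]
      rw [← Real.exp_add, Real.exp_le_exp, hψe]
      have h3 : (∑ r, x r ^ 2) / d ≤ 1 + ε := by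
        rw [div_le_iff₀ hd']; linarith
      have h4 := mul_le_mul_of_nonneg_left
        (kernelRate_mono hγ (show 0 ≤ (∑ r, x r ^ 2) / d by positivity) h3) hd'.le
      linarith [h2.1]
    · rw [Set.indicator_of_notMem hx]
      positivity
  have hb0 : 0 < b := Real.exp_pos _
  have h5 : b * (1 / 2) ≤ ∫ x : EuclideanSpace ℝ (Fin d),
      Real.exp (-((d : ℝ) * kernelRate γ (‖x‖ ^ 2 / d))) := by
    rw [hI, hI2]
    exact (mul_le_mul_of_nonneg_left hBp hb0.le).trans hlow
  have h6 := Real.log_le_log (by positivity) h5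
  rw [Real.log_mul hb0.ne' (by norm_num), hb, Real.log_exp, one_div, Real.log_inv] at h6
  rw [kernelConst, neg_mul, neg_neg]
  refine le_trans (le_of_eq ?_)
    (mul_le_mul_of_nonneg_left h6 (show 0 ≤ 1 / (d : ℝ) by positivity))
  field_simp
  ring

/-- The limit of the normalization constants of the kernels. -/
lemma tendsto_kernelConst (hγ : 1 ≤ γ) : Tendsto (kernelConst γ) atTop
    (𝓝 (1 / (2 * γ) - 1 / 2 - 1 / 2 * Real.log (2 * Real.pi))) := by
  set c := 1 / (2 * γ) - 1 / 2 - 1 / 2 * Real.log (2 * Real.pi) with hc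
  rw [Metric.tendsto_nhds]
  intro ε' hε'
  have hcont : ContinuousAt (fun ε => (1 - ε) / 2 - kernelRate γ (1 + ε)) 0 := by
    have := continuous_kernelRate hγ
    fun_prop
  have hlt : 1 / 2 - 1 / (2 * γ) - ε' / 2 < (fun ε => (1 - ε) / 2 - kernelRate γ (1 + ε)) 0 := by
    simp [kernelRate]
    linarith
  obtain ⟨ε, hε1, hε0⟩ := (((hcont.tendsto.mono_left nhdsWithin_le_nhds).eventually
    (lt_mem_nhds hlt)).and (self_mem_nhdsWithin (s := Set.Ioi (0 : ℝ)))).exists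
  have hε0 : 0 < ε := hε0
  have hl1 : Tendsto (fun d : ℕ => 1 / (d : ℝ) * Real.log 2) atTop (𝓝 0) := by
    simpa using tendsto_one_div_atTop_nhds_zero_nat.mul_const (Real.log 2)
  have hl2 : Tendsto (fun d : ℕ => gaussMoment 2 / ε ^ 2 / (d : ℝ)) atTop (𝓝 0) :=
    tendsto_const_div_atTop_nhds_zero_nat _
  filter_upwards [eventually_gt_atTop 0, hl1.eventually (gt_mem_nhds (show 0 < ε' / 2 by
    positivity)), hl2.eventually (gt_mem_nhds (show (0 : ℝ) < 1 / 2 by norm_num))] with d hd h1 h2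
  have hd' : (0 : ℝ) < d := Nat.cast_pos.2 hd
  have hu := neg_kernelConst_le hγ hd
  have hlo := le_neg_kernelConst hγ hd hε0 (by
    refine le_trans (le_of_eq ?_) h2.le
    field_simp)
  rw [Real.dist_eq, abs_lt]
  constructor <;> linarith

end Normalization

/-! ### The Kullback-Leibler divergence -/

section Divergence

variable {γ h : ℝ} {d n : ℕ}

lemma integral_kde (hγ : 1 ≤ γ) (hh : 0 < h) (hd : 0 < d) (hn : 0 < n)
    (y : Fin n → EuclideanSpace ℝ (Fin d)) :
    Integrable (kde γ h y) ∧ ∫ x, kde γ h y x = 1 := by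
  have hi : ∀ i, Integrable fun x => kernel γ d (h⁻¹ • (x - y i)) := fun i =>
    ((integrable_kernel hγ hd).comp_smul (inv_ne_zero hh.ne')).comp_sub_right (y i)
  have hI : ∀ i, ∫ x, kernel γ d (h⁻¹ • (x - y i)) = h ^ d := fun i => by
    rw [integral_sub_right_eq_self (fun x => kernel γ d (h⁻¹ • x)),
      Measure.integral_comp_inv_smul_of_nonneg _ _ hh.le, integral_kernel hγ hd,
      finrank_euclideanSpace_fin]
    simp
  have hs := integrable_finsetSum Finset.univ fun i _ => hi i
  refine ⟨hs.const_mul _, ?_⟩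
  unfold kde
  rw [integral_const_mul, integral_finsetSum _ fun i _ => hi i]
  have hn' : (n : ℝ) ≠ 0 := Nat.cast_ne_zero.2 hn.ne'
  simp only [hI, Finset.sum_const, Finset.card_univ, Fintype.card_fin, nsmul_eq_mul]
  field_simp

lemma kde_eq (hd : 0 < d) (hh : 0 < h) (hn : 0 < n) (y : Fin n → EuclideanSpace ℝ (Fin d))
    (x : EuclideanSpace ℝ (Fin d)) :
    kde γ h y x = Real.exp (d * (kernelConst γ d - Real.log h + quenched γ h (x, y))) := by
  have hd' : (d : ℝ) ≠ 0 := Nat.cast_ne_zero.2 hd.ne'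
  have hn' : (0 : ℝ) < n := Nat.cast_pos.2 hn
  have hs := sum_exp_pos hn fun i => -(d * energy γ h (x - y i))
  have h1 : d * (kernelConst γ d - Real.log h + quenched γ h (x, y)) =
      d * kernelConst γ d + (-(d * Real.log h) +
        Real.log (1 / n * ∑ i, Real.exp (-(d * energy γ h (x - y i))))) := by
    rw [quenched]; field_simp; ring
  rw [h1, Real.exp_add, Real.exp_add, Real.exp_log (by positivity), Real.exp_neg,
    ← Real.log_pow, Real.exp_log (by positivity), kde]
  have h2 : ∀ i, kernel γ d (h⁻¹ • (x - y i)) =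
      Real.exp (d * kernelConst γ d) * Real.exp (-(d * energy γ h (x - y i))) := fun i => by
    rw [kernel, ← Real.exp_add, energy]; ring_nf
  simp only [h2]
  rw [← Finset.mul_sum]
  field_simp

lemma isProbabilityMeasure_kdeMeasure (hγ : 1 ≤ γ) (hh : 0 < h) (hd : 0 < d) (hn : 0 < n)
    (y : Fin n → EuclideanSpace ℝ (Fin d)) : IsProbabilityMeasure (kdeMeasure γ h y) := by
  obtain ⟨hi, hI⟩ := integral_kde hγ hh hd hn y
  refine ⟨?_⟩
  rw [kdeMeasure, withDensity_apply _ MeasurableSet.univ, Measure.restrict_univ,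
    ← ofReal_integral_eq_lintegral_ofReal hi (ae_of_all _ fun x => ?_), hI, ENNReal.ofReal_one]
  rw [kde_eq hd hh hn]
  exact (Real.exp_pos _).le

variable {C : Matrix (Fin d) (Fin d) ℝ}

/-- Lebesgue measure has a density with respect to a Gaussian law, whose logarithm has an explicit
integral. -/
lemma exists_volume_density (hC : C.PosDef) :
    ∃ φ : EuclideanSpace ℝ (Fin d) → ℝ, Measurable φ ∧
      (gaussianLaw C).withDensity (fun x => ENNReal.ofReal (Real.exp (φ x))) = volume ∧
      Integrable φ (gaussianLaw C) ∧ ∫ x, φ x ∂(gaussianLaw C) =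
        d * (1 / 2 * Real.log (2 * Real.pi) + 1 / 2) + 1 / 2 * ∑ r, Real.log (eigVar hC r) := by
  obtain ⟨V, hV, hVv, -⟩ := exists_diagonalization hC
  set v := eigVar hC with hv
  have hv' : ∀ r, (0 : ℝ) < v r := fun r => NNReal.coe_pos.2 (pos_iff_ne_zero.2 (eigVar_ne_zero hC r))
  set ψ : (Fin d → ℝ) → ℝ := fun x =>
    ∑ r, (1 / 2 * Real.log (2 * Real.pi * v r) + x r ^ 2 / (2 * v r)) with hψ
  have hψm : Measurable ψ := by fun_prop
  have hvol : (diagGaussian v).withDensity (fun x => ENNReal.ofReal (Real.exp (ψ x))) = volume :=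
    diagGaussian_withDensity_eq_volume (eigVar_ne_zero hC)
  have hsq : ∀ r, Integrable (fun x : Fin d → ℝ => x r ^ 2 / (2 * v r)) (diagGaussian v) :=
    fun r => (integrable_sq_eval_diagGaussian v r).div_const _
  have hterm : ∀ r, Integrable (fun x : Fin d → ℝ =>
      1 / 2 * Real.log (2 * Real.pi * v r) + x r ^ 2 / (2 * v r)) (diagGaussian v) :=
    fun r => (integrable_const _).add (hsq r)
  have hψi : Integrable ψ (diagGaussian v) := integrable_finsetSum _ fun r _ => hterm r
  have hcomp : ∀ x, (fun z => ψ (V.symm z)) (V x) = ψ x := fun x => by simp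
  refine ⟨fun z => ψ (V.symm z), by fun_prop, ?_, ?_, ?_⟩
  · refine Measure.ext fun s hs => ?_
    rw [withDensity_apply _ hs, ← hVv.measure_preimage_equiv, ← hvol,
      withDensity_apply _ (V.measurable hs), ← hV.setLIntegral_comp_preimage hs (by fun_prop)]
    simp
  · rw [← hV.integrable_comp_emb V.measurableEmbedding]
    exact hψi.congr (ae_of_all _ fun x => (hcomp x).symm)
  · rw [← hV.integral_comp']
    simp only [MeasurableEquiv.symm_apply_apply, hψ]
    rw [integral_finsetSum _ fun r _ => hterm r]
    have h1 : ∀ r, ∫ x : Fin d → ℝ, (1 / 2 * Real.log (2 * Real.pi * v r) + x r ^ 2 / (2 * v r))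
        ∂(diagGaussian v) = (1 / 2 * Real.log (2 * Real.pi) + 1 / 2) + 1 / 2 * Real.log (v r) :=
      fun r => by
        have := Real.pi_pos
        have := (hv' r).ne'
        rw [integral_add (integrable_const _) (hsq r), integral_div, integral_sq_eval_diagGaussian,
          Real.log_mul (by positivity) this]
        simp
        field_simp
        ring
    simp only [h1]
    rw [Finset.sum_add_distrib, ← Finset.mul_sum]
    simp
    ring

/-- Relative to the Gaussian law the estimator has density `exp g`, so the log-likelihood ratio is
`-g`, with explicit integral. The sign claim is Gibbs' inequality; it is recorded because
`ENNReal.ofReal` would truncate negative values. -/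
lemma normalizedKL_eq (hC : C.PosDef) (hγ : 1 ≤ γ) (hh : 0 < h) (hd : 0 < d) (hn : 0 < n)
    {y : Fin n → EuclideanSpace ℝ (Fin d)}
    (hq : Integrable (fun x => quenched γ h (x, y)) (gaussianLaw C)) :
    normalizedKL γ h C y = ENNReal.ofReal (-(1 / 2 * Real.log (2 * Real.pi) + 1 / 2) -
      1 / 2 * (1 / d * ∑ r, Real.log (eigVar hC r)) - kernelConst γ d + Real.log h -
      ∫ x, quenched γ h (x, y) ∂(gaussianLaw C)) ∧
    0 ≤ -(1 / 2 * Real.log (2 * Real.pi) + 1 / 2) -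
      1 / 2 * (1 / d * ∑ r, Real.log (eigVar hC r)) - kernelConst γ d + Real.log h -
      ∫ x, quenched γ h (x, y) ∂(gaussianLaw C) := by
  have hd' : (0 : ℝ) < d := Nat.cast_pos.2 hd
  obtain ⟨φ, hφm, hφv, hφi, hφI⟩ := exists_volume_density hC
  have hP := isProbabilityMeasure_kdeMeasure hγ hh hd hn y
  set κ := kernelConst γ d - Real.log h with hκ
  have hqm : Measurable fun x => quenched γ h (x, y) :=
    (measurable_quenched hγ).comp (measurable_id.prodMk measurable_const)
  set g : EuclideanSpace ℝ (Fin d) → ℝ := fun x => φ x + d * (κ + quenched γ h (x, y)) with hg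
  have hgm : Measurable g := by fun_prop
  have hkde : kdeMeasure γ h y =
      (gaussianLaw C).withDensity fun x => ENNReal.ofReal (Real.exp (g x)) := by
    have h1 : (fun x => ENNReal.ofReal (kde γ h y x)) =
        fun x => ENNReal.ofReal (Real.exp (d * (κ + quenched γ h (x, y)))) := by
      ext x; rw [kde_eq hd hh hn]
    rw [kdeMeasure, ← hφv, h1, ← withDensity_mul _ (by fun_prop) (by fun_prop)]
    congr with x
    simp only [Pi.mul_apply]
    rw [← ENNReal.ofReal_mul (Real.exp_pos _).le, ← Real.exp_add]
  have hac : gaussianLaw C ≪ kdeMeasure γ h y := by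
    rw [hkde]
    refine withDensity_absolutelyContinuous' (by fun_prop) (ae_of_all _ fun x => ?_)
    simp [Real.exp_pos]
  have hllr : llr (gaussianLaw C) (kdeMeasure γ h y) =ᵐ[gaussianLaw C] fun x => -g x := by
    have h1 := neg_llr hac
    have h2 : (kdeMeasure γ h y).rnDeriv (gaussianLaw C) =ᵐ[gaussianLaw C]
        fun x => ENNReal.ofReal (Real.exp (g x)) := by
      rw [hkde]
      exact Measure.rnDeriv_withDensity _ (by fun_prop)
    filter_upwards [h1, h2] with x hx1 hx2
    rw [Pi.neg_apply, llr, llr, hx2, ENNReal.toReal_ofReal (Real.exp_pos _).le, Real.log_exp] at hx1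
    rw [llr, ← hx1, neg_neg]
  have hgi : Integrable g (gaussianLaw C) :=
    hφi.add (((integrable_const _).add hq).const_mul _)
  have hli : Integrable (llr (gaussianLaw C) (kdeMeasure γ h y)) (gaussianLaw C) :=
    hgi.neg.congr hllr.symm
  have hlI : ∫ x, llr (gaussianLaw C) (kdeMeasure γ h y) x ∂(gaussianLaw C) =
      (-(1 / 2 * Real.log (2 * Real.pi) + 1 / 2) -
      1 / 2 * (1 / d * ∑ r, Real.log (eigVar hC r)) - kernelConst γ d + Real.log h -
      ∫ x, quenched γ h (x, y) ∂(gaussianLaw C)) * d := by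
    have hi2 : Integrable (fun x => κ + quenched γ h (x, y)) (gaussianLaw C) :=
      (integrable_const _).add hq
    rw [integral_congr_ae hllr, integral_neg, integral_add hφi (hi2.const_mul _),
      integral_const_mul, integral_add (integrable_const _) hq, hφI, hκ]
    simp only [integral_const, probReal_univ, one_smul]
    field_simp
    ring
  have hnn := integral_llr_add_sub_measure_univ_nonneg hac hli
  have hkl := klDiv_of_ac_of_integrable hac hli
  rw [probReal_univ, probReal_univ, add_sub_cancel_right, hlI] at hnn hkl
  constructor
  · rw [normalizedKL, hkl, ← ENNReal.ofReal_natCast d, ← ENNReal.ofReal_div_of_pos hd',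
      mul_div_cancel_right₀ _ hd'.ne']
  · exact nonneg_of_mul_nonneg_left hnn hd'

end Divergence

/-! ### From convergence in mean to concentration of the divergence -/

section Concentration

variable {γ h : ℝ} {C : ∀ d : ℕ, Matrix (Fin d) (Fin d) ℝ}

/-- Convergence in mean of the quenched free energy implies concentration of the divergence. -/
lemma concentratesAt_normalizedKL (hC : ∀ d, (C d).PosDef)
    (htrace : ∃ M : ℝ, ∀ d : ℕ, (C d).trace ≤ M * d) {ℓ : ℝ}
    (hlogdet : Tendsto (fun d : ℕ => 1 / (d : ℝ) * ∑ r, Real.log (eigVar (hC d) r)) atTop (𝓝 ℓ))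
    (hγ : 1 ≤ γ) (hh : 0 < h) {n : ℕ → ℕ} (hn : ∀ᶠ d in atTop, 0 < n d) {F : ℝ}
    (hF : Tendsto (fun d => ∫ z, |quenched γ h (n := n d) z - F|
      ∂((gaussianLaw (C d)).prod (databaseLaw (C d) (n d)))) atTop (𝓝 0)) :
    ConcentratesAt (fun d => databaseLaw (C d) (n d)) (fun d y => normalizedKL γ h (C d) y)
      (-(1 / 2 * ℓ) - 1 / (2 * γ) + Real.log h - F) := by
  obtain ⟨M, hM⟩ := (momentBounds_gaussianLaw hC htrace).exists_energy_bound hγ hh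
  set D := -(1 / 2 * ℓ) - 1 / (2 * γ) + Real.log h - F with hD
  have hprob : ∀ d, IsProbabilityMeasure (databaseLaw (C d) (n d)) := fun d => by
    unfold databaseLaw; infer_instance
  set κ : ℕ → ℝ := fun d => -(1 / 2 * Real.log (2 * Real.pi) + 1 / 2) -
      1 / 2 * (1 / d * ∑ r, Real.log (eigVar (hC d) r)) - kernelConst γ d + Real.log h with hκ
  set T : ∀ d, (Fin (n d) → EuclideanSpace ℝ (Fin d)) → ℝ := fun d y =>
    κ d - ∫ x, quenched γ h (x, y) ∂(gaussianLaw (C d)) with hT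
  have hκlim : Tendsto κ atTop (𝓝 (D + F)) := by
    have h1 := (((hlogdet.const_mul (1 / 2)).const_sub
      (-(1 / 2 * Real.log (2 * Real.pi) + 1 / 2))).sub (tendsto_kernelConst hγ)).add_const
      (Real.log h)
    have h2 : -(1 / 2 * Real.log (2 * Real.pi) + 1 / 2) - 1 / 2 * ℓ -
        (1 / (2 * γ) - 1 / 2 - 1 / 2 * Real.log (2 * Real.pi)) + Real.log h = D + F := by
      rw [hD]; ring
    rwa [h2] at h1
  -- properties valid in large dimension
  have hQ : ∀ᶠ d in atTop, Integrable (quenched γ h (n := n d))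
      ((gaussianLaw (C d)).prod (databaseLaw (C d) (n d))) := by
    filter_upwards [hn, eventually_gt_atTop 0] with d hnd hd
    exact integrable_quenched hγ hnd hd (hM d).1
  -- Fubini gives integrability in `x` only for almost every database, which suffices for both the
  -- mean and the probability.
  have hKL : ∀ᶠ d in atTop, ∀ᵐ y ∂(databaseLaw (C d) (n d)),
      normalizedKL γ h (C d) y = ENNReal.ofReal (T d y) ∧ 0 ≤ T d y := by
    filter_upwards [hn, eventually_gt_atTop 0, hQ] with d hnd hd hq
    filter_upwards [hq.prod_left_ae] with y hy
    exact normalizedKL_eq (hC d) hγ hh hd hnd hy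
  have hTi : ∀ᶠ d in atTop, Integrable (T d) (databaseLaw (C d) (n d)) := by
    filter_upwards [hQ] with d hq
    exact (integrable_const _).sub hq.integral_prod_right
  have hTL1 : Tendsto (fun d => ∫ y, |T d y - D| ∂(databaseLaw (C d) (n d))) atTop (𝓝 0) := by
    have hlim : Tendsto (fun d => |κ d - (D + F)| + ∫ z, |quenched γ h (n := n d) z - F|
      ∂((gaussianLaw (C d)).prod (databaseLaw (C d) (n d)))) atTop (𝓝 0) := by
      have h1 := ((hκlim.sub_const (D + F)).abs).add hF
      simpa using h1
    refine squeeze_zero' (.of_forall fun d => integral_nonneg fun y => abs_nonneg _) ?_ hlim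
    filter_upwards [hQ, hTi] with d hq ht
    have hq2 : Integrable (fun z => |quenched γ h (n := n d) z - F|)
        ((gaussianLaw (C d)).prod (databaseLaw (C d) (n d))) := (hq.sub (integrable_const _)).abs
    rw [integral_prod_symm _ hq2]
    have h1 : |κ d - (D + F)| + ∫ y, ∫ x, |quenched γ h (x, y) - F| ∂(gaussianLaw (C d))
        ∂(databaseLaw (C d) (n d)) = ∫ y, (|κ d - (D + F)| +
          ∫ x, |quenched γ h (x, y) - F| ∂(gaussianLaw (C d))) ∂(databaseLaw (C d) (n d)) := by
      rw [integral_add (integrable_const _) hq2.integral_prod_right]; simp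
    rw [h1]
    refine integral_mono_ae (ht.sub (integrable_const _)).abs
      ((integrable_const _).add hq2.integral_prod_right) ?_
    filter_upwards [hq.prod_left_ae] with y hy
    have h2 : T d y - D = (κ d - (D + F)) -
        ∫ x, (quenched γ h (x, y) - F) ∂(gaussianLaw (C d)) := by
      rw [integral_sub hy (integrable_const _)]
      simp [hT]
      ring
    rw [h2]
    exact (abs_sub _ _).trans (by gcongr; exact abs_integral_le_integral_abs)
  constructor
  · have h1 := tendsto_integral_of_abs_sub (X := T) hTi hTL1
    refine (ENNReal.tendsto_ofReal h1).congr' ?_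
    filter_upwards [hKL, hTi] with d hkl hti
    rw [ofReal_integral_eq_lintegral_ofReal hti (hkl.mono fun y hy => hy.2)]
    exact lintegral_congr_ae (hkl.mono fun y hy => hy.1.symm)
  · intro ε hε
    -- Markov's inequality applied to `|T - D|`.
    have hlim : Tendsto (fun d => ENNReal.ofReal ((∫ y, |T d y - D| ∂(databaseLaw (C d) (n d))) / ε))
        atTop (𝓝 0) := by
      have := ENNReal.tendsto_ofReal (hTL1.div_const ε)
      simpa using this
    refine tendsto_of_tendsto_of_tendsto_of_le_of_le' tendsto_const_nhds hlim
      (.of_forall fun d => zero_le) ?_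
    filter_upwards [hKL, hTi] with d hkl hti
    have h1 : {y | normalizedKL γ h (C d) y = ∞ ∨ ε ≤ |(normalizedKL γ h (C d) y).toReal - D|}
        ≤ᵐ[databaseLaw (C d) (n d)] {y | ε ≤ |T d y - D|} := by
      filter_upwards [hkl] with y hy hmem
      rcases hmem with hmem | hmem
      · rw [hy.1] at hmem
        exact absurd hmem ENNReal.ofReal_ne_top
      · rwa [hy.1, ENNReal.toReal_ofReal hy.2] at hmem
    refine (measure_mono_ae h1).trans ?_
    have h2 := mul_meas_ge_le_integral_of_nonneg (μ := databaseLaw (C d) (n d))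
      (ae_of_all _ fun y => abs_nonneg (T d y - D)) (hti.sub (integrable_const D)).abs ε
    rw [← ofReal_measureReal]
    refine ENNReal.ofReal_le_ofReal ?_
    rw [le_div_iff₀ hε, mul_comm]
    exact h2

end Concentration

/-! ### The phase diagram -/

section Phase

variable {ρC : Measure ℝ} [IsProbabilityMeasure ρC] {γ h : ℝ}

/-- By `dS = -(t/2) dL` the function of `x` has derivative `(x - t) Q(x)/2`, so its minimum is at `x
= t`. -/
lemma spectralEntropy_add_mul_spectralL_le (hpos : ∀ᵐ c ∂ρC, 0 < c)
    (hlog : Integrable Real.log ρC) {s t : ℝ} (hs : 0 < s) (ht : 0 < t) :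
    spectralEntropy ρC t + t * spectralL ρC t / 2 ≤ spectralEntropy ρC s + t * spectralL ρC s / 2 := by
  have hd : ∀ x, 0 < x → HasDerivAt (fun x => spectralEntropy ρC x + t * spectralL ρC x / 2)
      ((x - t) * spectralQ ρC x / 2) x := fun x hx => by
    refine ((hasDerivAt_spectralEntropy hpos hlog hx).add
      (((hasDerivAt_spectralL hpos hx).const_mul t).div_const 2)).congr_deriv ?_
    ring
  rcases le_total s t with hst | hst
  · refine antitoneOn_of_deriv_nonpos (convex_Icc s t)
      (fun x hx => (hd x (hs.trans_le hx.1)).continuousAt.continuousWithinAt)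
      (fun x hx => (hd x (hs.trans_le (interior_subset hx).1)).differentiableAt.differentiableWithinAt)
      (fun x hx => ?_) ⟨le_rfl, hst⟩ ⟨hst, le_rfl⟩ hst
    have hx := interior_subset hx
    have hx0 := hs.trans_le hx.1
    rw [(hd x hx0).deriv]
    have := spectralQ_pos hpos hx0
    nlinarith [hx.2]
  · refine monotoneOn_of_deriv_nonneg (convex_Icc t s)
      (fun x hx => (hd x (ht.trans_le hx.1)).continuousAt.continuousWithinAt)
      (fun x hx => (hd x (ht.trans_le (interior_subset hx).1)).differentiableAt.differentiableWithinAt)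
      (fun x hx => ?_) ⟨le_rfl, hst⟩ ⟨hst, le_rfl⟩ hst
    have hx := interior_subset hx
    have hx0 := ht.trans_le hx.1
    rw [(hd x hx0).deriv]
    have := spectralQ_pos hpos hx0
    have := mul_nonneg (sub_nonneg.2 hx.1) this.le
    linarith

/-- The stationarity condition in its two forms. -/
lemma tilt_stationary {t L m : ℝ} (hh : 0 < h) (hL : 0 < L)
    (htm : t / L ^ (γ - 1) = m / (h ^ 2) ^ γ) : t * h ^ 2 = m * (L / h ^ 2) ^ (γ - 1) := by
  have hh2 : 0 < h ^ 2 := by positivity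
  have h1 := Real.rpow_pos_of_pos hL (γ - 1)
  have h2 := Real.rpow_pos_of_pos hh2 γ
  rw [Real.div_rpow hL.le hh2.le, Real.rpow_sub_one hh2.ne']
  rw [div_eq_div_iff h1.ne' h2.ne'] at htm
  field_simp
  linarith

/-- The stationary tilt minimizes the variational free energy. -/
lemma variational_le (hpos : ∀ᵐ c ∂ρC, 0 < c) (hlog : Integrable Real.log ρC) (hγ : 1 ≤ γ)
    (hh : 0 < h) {m s t : ℝ} (hm : 0 < m) (hs : 0 < s) (ht : 0 < t)
    (htm : t / spectralL ρC t ^ (γ - 1) = m / (h ^ 2) ^ γ) :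
    spectralEntropy ρC t + m * kernelRate γ (spectralL ρC t / h ^ 2) ≤
      spectralEntropy ρC s + m * kernelRate γ (spectralL ρC s / h ^ 2) := by
  have hLt := spectralL_pos hpos ht
  have hLs := spectralL_pos hpos hs
  have h1 := spectralEntropy_add_mul_spectralL_le hpos hlog hs ht
  have h2 := mul_le_mul_of_nonneg_left (kernelRate_tangent (γ := γ) (u := spectralL ρC s / h ^ 2)
    (v := spectralL ρC t / h ^ 2) hγ (by positivity) (by positivity)) hm.le
  have h3 : m * ((spectralL ρC t / h ^ 2) ^ (γ - 1) / 2 *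
      (spectralL ρC s / h ^ 2 - spectralL ρC t / h ^ 2)) =
      t * (spectralL ρC s - spectralL ρC t) / 2 := by
    have h4 : m * ((spectralL ρC t / h ^ 2) ^ (γ - 1) / 2 *
      (spectralL ρC s / h ^ 2 - spectralL ρC t / h ^ 2)) =
      m * (spectralL ρC t / h ^ 2) ^ (γ - 1) / 2 *
      (spectralL ρC s / h ^ 2 - spectralL ρC t / h ^ 2) := by ring
    rw [h4, ← tilt_stationary hh hLt htm]
    field_simp
  rw [mul_add, h3] at h2
  linarith

/-- `T` is the inverse of the increasing bijection `t ↦ t / L(t) ^ (γ - 1)` of `(0, ∞)`. -/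
def IsTiltInverse (ρC : Measure ℝ) (γ : ℝ) (T : ℝ → ℝ) : Prop :=
  ∀ v, 0 < v → 0 < T v ∧ T v / spectralL ρC (T v) ^ (γ - 1) = v

lemma exists_isTiltInverse (hpos : ∀ᵐ c ∂ρC, 0 < c) (hγ : 1 ≤ γ) :
    ∃ T, IsTiltInverse ρC γ T := by
  choose! T hT using fun v (hv : 0 < v) => exists_div_spectralL_rpow_eq (ρC := ρC) hpos hγ hv
  exact ⟨T, hT⟩

variable {T : ℝ → ℝ}

lemma IsTiltInverse.lt_iff (hT : IsTiltInverse ρC γ T) (hpos : ∀ᵐ c ∂ρC, 0 < c) (hγ : 1 ≤ γ)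
    {a v : ℝ} (ha : 0 < a) (hv : 0 < v) :
    a < T v ↔ a / spectralL ρC a ^ (γ - 1) < v := by
  have h := (strictMonoOn_div_spectralL_rpow hpos hγ).lt_iff_lt (a := a) (b := T v) ha (hT v hv).1
  rw [(hT v hv).2] at h
  exact h.symm

lemma IsTiltInverse.lt_iff' (hT : IsTiltInverse ρC γ T) (hpos : ∀ᵐ c ∂ρC, 0 < c) (hγ : 1 ≤ γ)
    {a v : ℝ} (ha : 0 < a) (hv : 0 < v) :
    T v < a ↔ v < a / spectralL ρC a ^ (γ - 1) := by
  have h := (strictMonoOn_div_spectralL_rpow hpos hγ).lt_iff_lt (a := T v) (b := a) (hT v hv).1 ha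
  rw [(hT v hv).2] at h
  exact h.symm

/-- `a < T v` and `T v < a` are explicit strict inequalities on `v`, hence open conditions. -/
lemma IsTiltInverse.continuousAt (hT : IsTiltInverse ρC γ T) (hpos : ∀ᵐ c ∂ρC, 0 < c) (hγ : 1 ≤ γ)
    {v : ℝ} (hv : 0 < v) : ContinuousAt T v := by
  refine tendsto_order.2 ⟨fun a ha => ?_, fun b hb => ?_⟩
  · rcases le_or_gt a 0 with ha0 | ha0
    · filter_upwards [lt_mem_nhds hv] with w hw
      exact ha0.trans_lt (hT w hw).1
    · filter_upwards [lt_mem_nhds hv, lt_mem_nhds ((hT.lt_iff hpos hγ ha0 hv).1 ha)] with w hw hw2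
      exact (hT.lt_iff hpos hγ ha0 hw).2 hw2
  · have hb0 := (hT v hv).1.trans hb
    filter_upwards [lt_mem_nhds hv, gt_mem_nhds ((hT.lt_iff' hpos hγ hb0 hv).1 hb)] with w hw hw2
    exact (hT.lt_iff' hpos hγ hb0 hw).2 hw2

/-- The limit of `gMean`, in terms of the inverse `T`. -/
def limitG (ρC : Measure ℝ) (γ : ℝ) (T : ℝ → ℝ) (h m : ℝ) : ℝ :=
  m * (1 / (2 * γ) - 1 / 2 - 1 / 2 * Real.log (2 * Real.pi)) - m * Real.log h -
    (spectralEntropy ρC (T (m / (h ^ 2) ^ γ)) +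
      m * kernelRate γ (spectralL ρC (T (m / (h ^ 2) ^ γ)) / h ^ 2))

/-- The derivative of the variational free energy, by the envelope theorem. -/
lemma hasDerivAt_variational (hT : IsTiltInverse ρC γ T) (hpos : ∀ᵐ c ∂ρC, 0 < c)
    (hlog : Integrable Real.log ρC) (hγ : 1 ≤ γ) (hh : 0 < h) :
    HasDerivAt (fun m => spectralEntropy ρC (T (m / (h ^ 2) ^ γ)) +
      m * kernelRate γ (spectralL ρC (T (m / (h ^ 2) ^ γ)) / h ^ 2))
      (kernelRate γ (spectralL ρC (T (1 / (h ^ 2) ^ γ)) / h ^ 2)) 1 := by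
  have hH : 0 < (h ^ 2) ^ γ := Real.rpow_pos_of_pos (by positivity) _
  set t : ℝ → ℝ := fun m => T (m / (h ^ 2) ^ γ) with ht
  set f : ℝ → ℝ := fun m => kernelRate γ (spectralL ρC (t m) / h ^ 2) with hf
  have ht0 : ∀ m, 0 < m → 0 < t m := fun m hm => (hT _ (div_pos hm hH)).1
  have hts : ∀ m, 0 < m → t m / spectralL ρC (t m) ^ (γ - 1) = m / (h ^ 2) ^ γ :=
    fun m hm => (hT _ (div_pos hm hH)).2
  have hcont : ContinuousAt f 1 := by
    have h1 : ContinuousAt t 1 := ContinuousAt.comp (f := fun m => m / (h ^ 2) ^ γ) (g := T)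
      (hT.continuousAt hpos hγ (div_pos one_pos hH)) (by fun_prop)
    have h2 : ContinuousAt (fun m => spectralL ρC (t m)) 1 :=
      ContinuousAt.comp (f := t) (hasDerivAt_spectralL hpos (ht0 1 one_pos)).continuousAt h1
    exact (continuous_kernelRate hγ).continuousAt.comp (h2.div_const _)
  rw [hasDerivAt_iff_isLittleO, Asymptotics.isLittleO_iff]
  intro c hc
  filter_upwards [hcont.eventually (Metric.closedBall_mem_nhds _ hc),
    lt_mem_nhds (zero_lt_one (α := ℝ))] with m hm hm0
  rw [Real.dist_eq] at hm
  -- Minimality at `m` and at `1` sandwiches the increment between `(m - 1) f m` and `(m - 1) f 1`,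
  -- so continuity of `T` is enough and its differentiability is not needed.
  have h1 := variational_le hpos hlog hγ hh hm0 (ht0 1 one_pos) (ht0 m hm0) (hts m hm0)
  have h2 := variational_le hpos hlog hγ hh one_pos (ht0 m hm0) (ht0 1 one_pos) (hts 1 one_pos)
  change ‖spectralEntropy ρC (t m) + m * f m - (spectralEntropy ρC (t 1) + 1 * f 1) -
    (m - 1) • f 1‖ ≤ c * ‖m - 1‖
  change spectralEntropy ρC (t m) + m * f m ≤ spectralEntropy ρC (t 1) + m * f 1 at h1
  change spectralEntropy ρC (t 1) + 1 * f 1 ≤ spectralEntropy ρC (t m) + 1 * f m at h2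
  have h3 : |(m - 1) * (f m - f 1)| ≤ c * |m - 1| := by
    rw [abs_mul, mul_comm]
    gcongr
  have h4 := (abs_le.1 h3).1
  rw [smul_eq_mul, Real.norm_eq_abs, Real.norm_eq_abs, abs_le]
  have h5 : 0 ≤ c * |m - 1| := by positivity
  constructor <;> linarith

/-- At `m = 1` the derivative is `-α - g(1) + g'(1)`. By the envelope theorem the constants and
energies cancel, leaving `S(T) - α`: the glass transition is the bandwidth at which the dominant
scale runs out of data points. -/
lemma hasDerivAt_replicaFreeEntropy (hT : IsTiltInverse ρC γ T) (hpos : ∀ᵐ c ∂ρC, 0 < c)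
    (hlog : Integrable Real.log ρC) (hγ : 1 ≤ γ) (hh : 0 < h) (α : ℝ) :
    HasDerivAt (replicaFreeEntropy (limitG ρC γ T) α h)
      (spectralEntropy ρC (T (1 / (h ^ 2) ^ γ)) - α) 1 := by
  have hk := hasDerivAt_variational hT hpos hlog hγ hh
  have hid := hasDerivAt_id (1 : ℝ)
  have h1 := (((hid.const_sub 1).div hid one_ne_zero).mul_const α).add
    (((hasDerivAt_const (1 : ℝ) (1 : ℝ)).div hid one_ne_zero).mul
      (((hid.mul_const (1 / (2 * γ) - 1 / 2 - 1 / 2 * Real.log (2 * Real.pi))).sub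
        (hid.mul_const (Real.log h))).sub hk))
  refine h1.congr_deriv ?_
  simp
  ring

/-- `T(h^{-2γ})` decreases in `h` and `S` increases, so `S(T) - α` changes sign exactly where
`T(h^{-2γ}) = lhat`. -/
lemma isGlassBandwidth (hT : IsTiltInverse ρC γ T) (hpos : ∀ᵐ c ∂ρC, 0 < c)
    (hlog : Integrable Real.log ρC) (hγ : 1 ≤ γ) {α lhat hG : ℝ} (hl : 0 < lhat)
    (hlα : spectralEntropy ρC lhat = α) (hG0 : 0 < hG)
    (hGe : 1 / (hG ^ 2) ^ γ = lhat / spectralL ρC lhat ^ (γ - 1)) :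
    IsGlassBandwidth (limitG ρC γ T) α hG := by
  refine ⟨hG0, fun h hh => ?_⟩
  have hγ0 : 0 < γ := by linarith
  have hd := hasDerivAt_replicaFreeEntropy hT hpos hlog hγ hh α
  have hv : 0 < 1 / (h ^ 2) ^ γ := div_pos one_pos (Real.rpow_pos_of_pos (by positivity) _)
  have hT0 := (hT _ hv).1
  have hS := strictMonoOn_spectralEntropy hpos hlog
  have hmono : ∀ a b : ℝ, 0 < a → a < b → 1 / (b ^ 2) ^ γ < 1 / (a ^ 2) ^ γ := fun a b ha hab =>
    one_div_lt_one_div_of_lt (Real.rpow_pos_of_pos (by positivity) _)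
      (Real.rpow_lt_rpow (by positivity) (by gcongr) hγ0)
  refine ⟨hd.differentiableAt, fun hlt => ?_, fun heq => ?_, fun hlt => ?_⟩ <;>
    rw [glassD, hd.deriv]
  · have h1 := (hT.lt_iff hpos hγ hl hv).2 (hGe ▸ hmono h hG hh hlt)
    have := hS hl hT0 h1
    linarith
  · have h1 : T (1 / (h ^ 2) ^ γ) = lhat := by
      rcases lt_trichotomy (T (1 / (h ^ 2) ^ γ)) lhat with h2 | h2 | h2
      · have := (hT.lt_iff' hpos hγ hl hv).1 h2
        rw [← hGe, heq] at this
        exact absurd this (lt_irrefl _)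
      · exact h2
      · have := (hT.lt_iff hpos hγ hl hv).1 h2
        rw [← hGe, heq] at this
        exact absurd this (lt_irrefl _)
    rw [h1, hlα, sub_self]
  · have h1 := (hT.lt_iff' hpos hγ hl hv).2 (hGe ▸ hmono hG h hG0 hlt)
    have := hS hT0 hl h1
    linarith

/-! ### The limiting divergence and its minimizer -/

/-- The tilt that dominates the estimator: the stationary one, or the frozen one `lhat`. -/
def dominantTilt (γ : ℝ) (T : ℝ → ℝ) (lhat h : ℝ) : ℝ := min (T (1 / (h ^ 2) ^ γ)) lhat

/-- The limit of the divergence per dimension. -/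
def limitKL (ρC : Measure ℝ) (γ : ℝ) (T : ℝ → ℝ) (lhat h : ℝ) : ℝ :=
  -(1 / 2 * ∫ c, Real.log c ∂ρC) - 1 / (2 * γ) + Real.log h +
    (spectralEntropy ρC (dominantTilt γ T lhat h) +
      kernelRate γ (spectralL ρC (dominantTilt γ T lhat h) / h ^ 2))

/-- Substitute `log h = ½ log L - (1/(2γ)) log w` with `w = (L/h²)^γ`. This separates a part
depending only on the tilt from a nonnegative part vanishing only at `w = 1`. -/
lemma limitKL_eq (hpos : ∀ᵐ c ∂ρC, 0 < c) (hγ : 1 ≤ γ) {lhat : ℝ} (hh : 0 < h)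
    (hτ : 0 < dominantTilt γ T lhat h) :
    limitKL ρC γ T lhat h = -(1 / 2 * ∫ c, Real.log c ∂ρC) +
      (spectralEntropy ρC (dominantTilt γ T lhat h) +
        1 / 2 * Real.log (spectralL ρC (dominantTilt γ T lhat h))) +
      1 / (2 * γ) * ((spectralL ρC (dominantTilt γ T lhat h) / h ^ 2) ^ γ - 1 -
        Real.log ((spectralL ρC (dominantTilt γ T lhat h) / h ^ 2) ^ γ)) := by
  have hL := spectralL_pos hpos hτ
  have hγ0 : γ ≠ 0 := by linarith
  rw [limitKL, Real.log_rpow (by positivity), Real.log_div hL.ne' (by positivity), Real.log_pow,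
    kernelRate]
  field_simp
  push_cast
  ring

lemma limitKL_lt (hT : IsTiltInverse ρC γ T) (hpos : ∀ᵐ c ∂ρC, 0 < c)
    (hlog : Integrable Real.log ρC) (hγ : 1 ≤ γ) {α lhat : ℝ} (hl : 0 < lhat)
    (hlα : spectralEntropy ρC lhat = α) (hh : 0 < h) (hne : h ≠ √(spectralL ρC lhat)) :
    α - 1 / 2 * ∫ c, Real.log c ∂ρC + 1 / 2 * Real.log (spectralL ρC lhat) <
      limitKL ρC γ T lhat h := by
  have hv : 0 < 1 / (h ^ 2) ^ γ := div_pos one_pos (Real.rpow_pos_of_pos (by positivity) _)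
  have hT0 := (hT _ hv).1
  have hτ : 0 < dominantTilt γ T lhat h := lt_min hT0 hl
  rw [limitKL_eq hpos hγ hh hτ]
  set τ := dominantTilt γ T lhat h with hτd
  have hL := spectralL_pos hpos hτ
  have h1 := antitoneOn_spectralEntropy_add_log hpos hlog hτ hl (min_le_right _ _)
  simp only at h1
  rw [hlα] at h1
  have hw0 : 0 < (spectralL ρC τ / h ^ 2) ^ γ := Real.rpow_pos_of_pos (by positivity) _
  have hw1 : (spectralL ρC τ / h ^ 2) ^ γ ≠ 1 := by
    rcases lt_or_ge (T (1 / (h ^ 2) ^ γ)) lhat with hlt | hge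
    · have hτT : τ = T (1 / (h ^ 2) ^ γ) := min_eq_left hlt.le
      have h2 := (hT _ hv).2
      rw [← hτT] at h2
      -- In the unfrozen phase stationarity gives `w = τ L(τ) < 1`, so the last term of `limitKL_eq`
      -- cannot vanish.
      have h3 : (spectralL ρC τ / h ^ 2) ^ γ = τ * spectralL ρC τ := by
        rw [Real.div_rpow hL.le (by positivity), div_eq_mul_one_div, ← h2,
          Real.rpow_sub_one hL.ne']
        have := (Real.rpow_pos_of_pos hL γ).ne'
        field_simp
      rw [h3]
      exact (mul_spectralL_lt_one hpos hτ).ne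
    · have hτl : τ = lhat := min_eq_right hge
      intro h2
      rw [hτl] at h2 hL
      have h3 : spectralL ρC lhat / h ^ 2 = 1 := by
        have h4 := congrArg (fun x => x ^ (1 / γ)) h2
        rwa [← Real.rpow_mul (by positivity), mul_one_div_cancel (by linarith), Real.rpow_one,
          Real.one_rpow] at h4
      rw [div_eq_one_iff_eq (by positivity)] at h3
      rw [h3, Real.sqrt_sq hh.le] at hne
      exact hne rfl
  have h5 := Real.log_lt_sub_one_of_pos hw0 hw1
  have h6 : 0 < 1 / (2 * γ) * ((spectralL ρC τ / h ^ 2) ^ γ - 1 -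
      Real.log ((spectralL ρC τ / h ^ 2) ^ γ)) := by
    have : 0 < (spectralL ρC τ / h ^ 2) ^ γ - 1 - Real.log ((spectralL ρC τ / h ^ 2) ^ γ) := by
      linarith
    positivity
  linarith

/-- A restatement of `lhat · L(lhat) < 1`. It serves twice: the tilt at `h = √l` is the frozen one,
and `√l` lies below the glass bandwidth. -/
lemma one_div_rpow_lt (hpos : ∀ᵐ c ∂ρC, 0 < c) {lhat : ℝ} (hl : 0 < lhat) :
    lhat / spectralL ρC lhat ^ (γ - 1) < 1 / (√(spectralL ρC lhat) ^ 2) ^ γ := by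
  have hL := spectralL_pos hpos hl
  have h1 := Real.rpow_pos_of_pos hL γ
  rw [Real.sq_sqrt hL.le, Real.rpow_sub_one hL.ne', div_lt_div_iff₀ (by positivity) h1]
  have h2 := mul_lt_mul_of_pos_right (mul_spectralL_lt_one hpos hl) h1
  have h3 := div_lt_div_of_pos_right h2 hL
  calc lhat * spectralL ρC lhat ^ γ
      = lhat * spectralL ρC lhat * spectralL ρC lhat ^ γ / spectralL ρC lhat := by field_simp
    _ < _ := by rw [← mul_div_assoc]; exact h3

lemma limitKL_sqrt (hT : IsTiltInverse ρC γ T) (hpos : ∀ᵐ c ∂ρC, 0 < c) (hγ : 1 ≤ γ)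
    {α lhat : ℝ} (hl : 0 < lhat) (hlα : spectralEntropy ρC lhat = α) :
    limitKL ρC γ T lhat (√(spectralL ρC lhat)) =
      α - 1 / 2 * ∫ c, Real.log c ∂ρC + 1 / 2 * Real.log (spectralL ρC lhat) := by
  have hL := spectralL_pos hpos hl
  have hs := Real.sqrt_pos.2 hL
  have hv : 0 < 1 / (√(spectralL ρC lhat) ^ 2) ^ γ :=
    div_pos one_pos (Real.rpow_pos_of_pos (by positivity) _)
  have hlt := (hT.lt_iff hpos hγ hl hv).2 (one_div_rpow_lt hpos hl)
  have hτ : dominantTilt γ T lhat (√(spectralL ρC lhat)) = lhat := min_eq_right hlt.le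
  rw [limitKL_eq hpos hγ hs (by rw [hτ]; exact hl), hτ, hlα, Real.sq_sqrt hL.le, div_self hL.ne']
  simp
  ring

/-! ### Limits of the free energies for the Gaussian data -/

variable {C : ∀ d : ℕ, Matrix (Fin d) (Fin d) ℝ} {hC : ∀ d, (C d).PosDef}

lemma isLimitG_limitG (hT : IsTiltInverse ρC γ T) (hρC : SpectralLimit C hC ρC)
    (hpos : ∀ᵐ c ∂ρC, 0 < c) (hlog : Integrable Real.log ρC)
    (htrace : ∃ M : ℝ, ∀ d : ℕ, (C d).trace ≤ M * d) (hγ : 1 ≤ γ) :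
    IsLimitG γ C (limitG ρC γ T) := by
  intro h m hh hm
  have hmom := momentBounds_gaussianLaw hC htrace
  obtain ⟨M, hM⟩ := hmom.exists_energy_bound hγ hh
  have hv : 0 < m / (h ^ 2) ^ γ := div_pos hm (Real.rpow_pos_of_pos (by positivity) _)
  obtain ⟨ht, hts⟩ := hT _ hv
  have hA := tendsto_annealed hmom hγ hh hm ht (spectralL_pos hpos ht)
    (tilt_stationary hh (spectralL_pos hpos ht) hts)
    (hρC.tendsto_annealed_one hpos hlog htrace ht) (hρC.ballMassLimit hpos hlog htrace ht)
  have hlim := (((tendsto_kernelConst hγ).const_mul m).sub_const (m * Real.log h)).add hA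
  rw [limitG, sub_eq_add_neg _ (_ + _)]
  refine hlim.congr' ?_
  filter_upwards [eventually_gt_atTop 0] with d hd
  have hd' : (d : ℝ) ≠ 0 := Nat.cast_ne_zero.2 hd.ne'
  have hai := integrable_annealed hγ hm.le hd (hM d).1
  have h1 : ∀ x, Real.log (∫ y, kernel γ d (h⁻¹ • (x - y)) ^ m ∂(gaussianLaw (C d))) =
      d * (m * kernelConst γ d + annealed γ h m (gaussianLaw (C d)) x) := fun x => by
    have h2 : ∀ y, kernel γ d (h⁻¹ • (x - y)) ^ m = Real.exp (d * (m * kernelConst γ d)) *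
        Real.exp (-(d * (m * energy γ h (x - y)))) := fun y => by
      rw [kernel, ← Real.exp_mul, ← Real.exp_add, energy]
      ring_nf
    simp only [h2]
    rw [integral_const_mul, Real.log_mul (Real.exp_pos _).ne'
      (integral_exp_energy_pos hγ hm.le x).ne', Real.log_exp, annealed]
    field_simp
  rw [gMean]
  simp only [h1]
  rw [integral_const_mul, integral_add (integrable_const _) hai]
  simp only [integral_const, probReal_univ, one_smul]
  field_simp
  ring

lemma tendsto_quenched_gaussianLaw (hT : IsTiltInverse ρC γ T) (hρC : SpectralLimit C hC ρC)
    (hpos : ∀ᵐ c ∂ρC, 0 < c) (hlog : Integrable Real.log ρC)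
    (htrace : ∃ M : ℝ, ∀ d : ℕ, (C d).trace ≤ M * d) (hγ : 1 ≤ γ) {α lhat : ℝ} (hα : 0 < α)
    (hl : 0 < lhat) (hlα : spectralEntropy ρC lhat = α) (hh : 0 < h) {n : ℕ → ℕ}
    (hn : Tendsto (fun d : ℕ => Real.log (n d) / d) atTop (𝓝 α)) :
    Tendsto (fun d => ∫ z, |quenched γ h (n := n d) z -
        -(spectralEntropy ρC (dominantTilt γ T lhat h) +
          kernelRate γ (spectralL ρC (dominantTilt γ T lhat h) / h ^ 2))|
      ∂((gaussianLaw (C d)).prod (databaseLaw (C d) (n d)))) atTop (𝓝 0) := by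
  have hmom := momentBounds_gaussianLaw hC htrace
  have hH : 0 < (h ^ 2) ^ γ := Real.rpow_pos_of_pos (by positivity) _
  have hv : 0 < 1 / (h ^ 2) ^ γ := div_pos one_pos hH
  obtain ⟨hT0, hTs⟩ := hT _ hv
  have hτ : 0 < dominantTilt γ T lhat h := lt_min hT0 hl
  have hτl : dominantTilt γ T lhat h ≤ lhat := min_le_right _ _
  have hS := strictMonoOn_spectralEntropy hpos hlog
  have hann : ∀ m t, 0 < m → 0 < t → t / spectralL ρC t ^ (γ - 1) = m / (h ^ 2) ^ γ →
      Tendsto (fun d => ∫ x, annealed γ h m (gaussianLaw (C d)) x ∂(gaussianLaw (C d))) atTop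
        (𝓝 (-(spectralEntropy ρC t + m * kernelRate γ (spectralL ρC t / h ^ 2)))) :=
    fun m t hm ht hts => tendsto_annealed hmom hγ hh hm ht (spectralL_pos hpos ht)
      (tilt_stationary hh (spectralL_pos hpos ht) hts)
      (hρC.tendsto_annealed_one hpos hlog htrace ht) (hρC.ballMassLimit hpos hlog htrace ht)
  have hlow : ∀ ε' > 0, ∃ S L ε, 0 < ε ∧ S + ε < α ∧
      BallMassLimit (fun d => gaussianLaw (C d)) S L ∧
      -(spectralEntropy ρC (dominantTilt γ T lhat h) +
          kernelRate γ (spectralL ρC (dominantTilt γ T lhat h) / h ^ 2)) - ε' <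
        -(S + ε + kernelRate γ ((L + ε) / h ^ 2)) := by
    intro ε' hε'
    set τ := dominantTilt γ T lhat h
    have hkc := continuous_kernelRate hγ
    have hc1 : ContinuousAt (fun s => spectralEntropy ρC s + kernelRate γ (spectralL ρC s / h ^ 2))
        τ := by
      refine (hasDerivAt_spectralEntropy hpos hlog hτ).continuousAt.add ?_
      exact hkc.continuousAt.comp ((hasDerivAt_spectralL hpos hτ).continuousAt.div_const _)
    have hev := (hc1.tendsto.mono_left (nhdsWithin_le_nhds (s := Set.Iio τ))).eventually
      (gt_mem_nhds (show spectralEntropy ρC τ + kernelRate γ (spectralL ρC τ / h ^ 2) <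
        spectralEntropy ρC τ + kernelRate γ (spectralL ρC τ / h ^ 2) + ε' by linarith))
    -- In the frozen phase `S(τ) = α`, and the count needs a strict inequality. A tilt slightly
    -- below `τ` has `S(t) < α` at an arbitrarily small loss in free energy.
    obtain ⟨t, ⟨ht1, ht0, htτ⟩⟩ := (hev.and (Ioo_mem_nhdsLT hτ)).exists
    have hSt : spectralEntropy ρC t < α := hlα ▸ hS ht0 hl (htτ.trans_le hτl)
    have hc2 : ContinuousAt (fun ε => spectralEntropy ρC t + ε +
        kernelRate γ ((spectralL ρC t + ε) / h ^ 2)) 0 := by fun_prop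
    have hev2 := (hc2.tendsto.mono_left (nhdsWithin_le_nhds (s := Set.Ioi 0))).eventually
      (gt_mem_nhds (show _ < spectralEntropy ρC τ + kernelRate γ (spectralL ρC τ / h ^ 2) + ε' by
        simpa using ht1))
    obtain ⟨ε, hε1, hε0, hε2⟩ := (hev2.and (Ioo_mem_nhdsGT (sub_pos.2 hSt))).exists
    exact ⟨_, _, ε, hε0, by linarith, hρC.ballMassLimit hpos hlog htrace ht0, by linarith⟩
  rcases le_or_gt (T (1 / (h ^ 2) ^ γ)) lhat with hle | hlt
  -- Unfrozen phase: the annealed bound `m = 1` is sharp.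
  · have hτT : dominantTilt γ T lhat h = T (1 / (h ^ 2) ^ γ) := min_eq_left hle
    refine tendsto_integral_abs_quenched_sub hmom hγ hh hα hn one_pos le_rfl
      (hann 1 _ one_pos hT0 hTs) ?_ hlow
    rw [hτT]
    ring
  · have hτT : dominantTilt γ T lhat h = lhat := min_eq_right hlt.le
    have hL := spectralL_pos hpos hl
    have hR : 0 < lhat / spectralL ρC lhat ^ (γ - 1) := div_pos hl (Real.rpow_pos_of_pos hL _)
    -- Frozen phase: `m` is the exponent whose stationary tilt is `lhat`. Then `(1-m)/m · α - (α + m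
    -- f)/m = -(α + f)`, matching the lower bound.
    set m := lhat / spectralL ρC lhat ^ (γ - 1) * (h ^ 2) ^ γ with hm
    have hm0 : 0 < m := mul_pos hR hH
    have hm1 : m ≤ 1 := by
      have := (hT.lt_iff hpos hγ hl hv).1 hlt
      rw [lt_div_iff₀ hH] at this
      exact this.le
    refine tendsto_integral_abs_quenched_sub hmom hγ hh hα hn hm0 hm1
      (hann m lhat hm0 hl (by rw [hm, mul_div_cancel_right₀ _ hH.ne'])) ?_ hlow
    rw [hτT, hlα]
    field_simp
    ring

/-- `u f'(u) = u^γ/2`, so the equation forces `u = 1` whatever `γ` is. -/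
lemma mul_deriv_kernelRate_eq_iff (hγ : 1 ≤ γ) {l : ℝ} (hl : 0 < l) (hh : 0 < h) :
    l / h ^ 2 * deriv (kernelRate γ) (l / h ^ 2) = 1 / 2 ↔ h = √l := by
  have hu : 0 < l / h ^ 2 := by positivity
  have hγ0 : γ ≠ 0 := by linarith
  have hd : deriv (kernelRate γ) (l / h ^ 2) = (l / h ^ 2) ^ (γ - 1) / 2 := by
    have h1 := (Real.hasDerivAt_rpow_const (x := l / h ^ 2) (p := γ) (Or.inl hu.ne')).div_const
      (2 * γ)
    have h2 : deriv (kernelRate γ) (l / h ^ 2) = _ := h1.deriv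
    rw [h2]
    field_simp
  rw [hd, Real.rpow_sub_one hu.ne', ← mul_div_assoc, mul_div_cancel₀ _ hu.ne']
  have h3 : (l / h ^ 2) ^ γ / 2 = 1 / 2 ↔ l / h ^ 2 = 1 := by
    rw [div_left_inj' two_ne_zero]
    constructor
    · intro h4
      have h5 := congrArg (fun x => x ^ (1 / γ)) h4
      rwa [← Real.rpow_mul hu.le, mul_one_div_cancel hγ0, Real.rpow_one, Real.one_rpow] at h5
    · intro h4
      rw [h4, Real.one_rpow]
  rw [h3, div_eq_one_iff_eq (by positivity), ← Real.sqrt_eq_iff_eq_sq hl.le hh.le]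
  exact eq_comm

end Phase

end HighDimKDE

end

/-! ### The theorem -/

theorem proposition13
    (C : ∀ d : ℕ, Matrix (Fin d) (Fin d) ℝ) (hC : ∀ d, (C d).PosDef)
    (htrace : ∃ M : ℝ, ∀ d : ℕ, (C d).trace ≤ M * d)
    (ρC : Measure ℝ) [IsProbabilityMeasure ρC]
    (hρC : HighDimKDE.SpectralLimit C hC ρC)
    (hpos : ∀ᵐ c ∂ρC, 0 < c) (hlog : Integrable Real.log ρC)
    (hlogdet : Tendsto
      (fun d : ℕ => (1 / (d : ℝ)) * ∑ r, Real.log ((hC d).isHermitian.eigenvalues r))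
      atTop (𝓝 (∫ c, Real.log c ∂ρC)))
    (α : ℝ) (hα : 0 < α) :
    ∃ lhat l : ℝ,
      (∀ t : ℝ, 0 < t → (HighDimKDE.spectralEntropy ρC t = α ↔ t = lhat)) ∧
      0 < lhat ∧ l = HighDimKDE.spectralL ρC lhat ∧ 0 < l ∧
      ∀ γ : ℝ, 1 ≤ γ →
        ∃ (gbar : ℝ → ℝ → ℝ) (hG hstar : ℝ) (D : ℝ → ℝ),
          HighDimKDE.IsLimitG γ C gbar ∧
          HighDimKDE.IsGlassBandwidth gbar α hG ∧
          -- the limiting KL divergence per dimension, as a function of the bandwidth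
          (∀ n : ℕ → ℕ, Tendsto (fun d : ℕ => Real.log (n d) / d) atTop (𝓝 α) →
            ∀ h : ℝ, 0 < h →
              HighDimKDE.ConcentratesAt (fun d => HighDimKDE.databaseLaw (C d) (n d))
                (fun d y => HighDimKDE.normalizedKL γ h (C d) y) (D h)) ∧
          -- `hstar` is the unique solution of the optimality equation
          0 < hstar ∧
          (∀ h : ℝ, 0 < h →
            (l / h ^ 2 * deriv (HighDimKDE.kernelRate γ) (l / h ^ 2) = 1 / 2 ↔ h = hstar)) ∧
          -- `hstar` is the unique minimizer, and it lies in the 1RSB phase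
          (∀ h : ℝ, 0 < h → h ≠ hstar → D hstar < D h) ∧
          hstar < hG ∧
          -- the minimal value, the same for all kernels
          D hstar = α - (1 / 2) * ∫ c, Real.log c ∂ρC + (1 / 2) * Real.log l := by
  obtain ⟨lhat, hl, hlα⟩ := HighDimKDE.exists_spectralEntropy_eq hpos hlog hα
  have hL := HighDimKDE.spectralL_pos hpos hl
  have hS := HighDimKDE.strictMonoOn_spectralEntropy hpos hlog
  refine ⟨lhat, HighDimKDE.spectralL ρC lhat, fun t ht => ⟨fun h => ?_, fun h => ?_⟩, hl, rfl, hL,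
    fun γ hγ => ?_⟩
  · exact hS.injOn ht hl (h.trans hlα.symm)
  · rw [h, hlα]
  obtain ⟨T, hT⟩ := HighDimKDE.exists_isTiltInverse (ρC := ρC) hpos hγ
  have hγ0 : γ ≠ 0 := by linarith
  set R := lhat / HighDimKDE.spectralL ρC lhat ^ (γ - 1) with hR
  have hR0 : 0 < R := div_pos hl (Real.rpow_pos_of_pos hL _)
  -- `hG` solves `hG^{-2γ} = R`, that is `T(hG^{-2γ}) = lhat`.
  set hG := √((1 / R) ^ (1 / γ)) with hhG
  have hRp : 0 < (1 / R) ^ (1 / γ) := Real.rpow_pos_of_pos (by positivity) _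
  have hG0 : 0 < hG := Real.sqrt_pos.2 hRp
  have hGe : 1 / (hG ^ 2) ^ γ = R := by
    rw [hhG, Real.sq_sqrt hRp.le, ← Real.rpow_mul (by positivity), one_div_mul_cancel hγ0,
      Real.rpow_one, one_div_one_div]
  have hsqrt : 0 < √(HighDimKDE.spectralL ρC lhat) := Real.sqrt_pos.2 hL
  refine ⟨HighDimKDE.limitG ρC γ T, hG, √(HighDimKDE.spectralL ρC lhat),
    HighDimKDE.limitKL ρC γ T lhat,
    HighDimKDE.isLimitG_limitG hT hρC hpos hlog htrace hγ,
    HighDimKDE.isGlassBandwidth hT hpos hlog hγ hl hlα hG0 hGe, fun n hn h hh => ?_, hsqrt,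
    fun h hh => HighDimKDE.mul_deriv_kernelRate_eq_iff hγ hL hh, fun h hh hne => ?_, ?_,
    HighDimKDE.limitKL_sqrt hT hpos hγ hl hlα⟩
  · have hdet : Tendsto (fun d : ℕ => 1 / (d : ℝ) *
        ∑ r, Real.log (HighDimKDE.eigVar (hC d) r)) atTop (𝓝 (∫ c, Real.log c ∂ρC)) := by
      simpa only [HighDimKDE.coe_eigVar] using hlogdet
    have h1 := HighDimKDE.concentratesAt_normalizedKL hC htrace hdet hγ hh
      (HighDimKDE.eventually_pos_of_log_div_tendsto hα hn)
      (HighDimKDE.tendsto_quenched_gaussianLaw hT hρC hpos hlog htrace hγ hα hl hlα hh hn)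
    rwa [sub_neg_eq_add] at h1
  · rw [HighDimKDE.limitKL_sqrt hT hpos hγ hl hlα]
    exact HighDimKDE.limitKL_lt hT hpos hlog hγ hl hlα hh hne
  · have h1 := HighDimKDE.one_div_rpow_lt (γ := γ) hpos hl
    rw [← hR, ← hGe] at h1
    by_contra! hle
    have h2 : 1 / (√(HighDimKDE.spectralL ρC lhat) ^ 2) ^ γ ≤ 1 / (hG ^ 2) ^ γ :=
      one_div_le_one_div_of_le (Real.rpow_pos_of_pos (by positivity) _)
        (Real.rpow_le_rpow (by positivity) (by gcongr) (by linarith))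
    linarith
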